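/- **Setting.** Let $\Lambda$ be a finite connected graph with shortest-path distance $d_{i,j}$; put $d_{X,Y}=\min_{i\in X,j\in Y}d_{i,j}$, $\mathrm{diam}(X)=1+\max_{i,j\in X}d_{i,j}$ and $X[r]=\{i\in\Lambda: d_{X,i}\le r\}$. For $\xi\ge 0$ let $\Lambda^{(\xi)}$ be a set of minimal cardinality with $\Lambda^{(\xi)}[\xi]=\Lambda$, and for $X\subseteq\Lambda$ let $X^{(\xi)}$ be a subset of $\Lambda^{(\xi)}$ of minimal cardinality with $X^{(\xi)}[\xi]\supseteq X$ (any choice of minimizers is allowed). Let $D\ge 1$ be an integer and suppose that $\gamma\ge 1$ satisfies, for all $i\in\Lambda$ and $X\subseteq\Lambda$, $$|X|\le\gamma\,\mathrm{diam}(X)^D,\qquad |\{i\}[r]|\le\gamma(2r)^D\ (r\ge 1),\qquad |X^{(\xi)}|\le\gamma\max\bigl(1,(\mathrm{diam}(X)/\xi)^D\bigr)\ (\xi>0),$$ $$\#\{j\in\Lambda^{(\xi)}: r\le d_{i,j}<r+\xi\}\le 2\gamma D(2r/\xi)^{D-1}\quad(r\ge\xi\ge 1).$$ Each site $i$ carries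 a finite-dimensional Hilbert space $\mathbb C^{q_i}$ (of arbitrary dimension). Let $H=\sum_{Z\subseteq\Lambda}h_Z$ with $h_Z$ self-adjoint and supported on $Z$, and suppose that, for some $\alpha>2D+1$ and $g_0>0$, for all $i,j\in\Lambda$ and $r>0$, $$\sum_{Z\ni i,\ \mathrm{diam}(Z)\ge r}\|h_Z\|\le r^{-\alpha+D},\qquad \sum_{Z\ni i,j}\|h_Z\|\le g_0(d_{i,j}+1)^{-\alpha}$$ (the energy unit is chosen so that the constant in the first condition is $1$). For $\ell>0$ let $H_{\le\ell}$ and $H_{>\ell}$ be the sums of the $h_Z$ with $\mathrm{diam}(Z)\le\ell$ and with $\mathrm{diam}(Z)>\ell$, and write $O(A,\tau)=e^{iA\tau}Oe^{-iA\tau}$. For $|t|\ge 1$ let $$\ell_t=|t|^{\tilde\eta},\qquad \tilde\eta=1-\frac{\alpha-2D-1}{2(\alpha-D)},\qquad U_{>\ell_t}=\mathcal T\exp\Bigl(-i\int_0^t H_{>\ell_t}(H_{\le\ell_t},\tau)\,d\tau\Bigr),$$ i.e. $U_{>\ell_t}=U(t)$ where $U(0)=1$ and $U'(s)=-i\,H_{>\ell_t}(H_{\le\ell_t},s)\,U(s)$.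 **Theorem 3.** For every $v^*>0$ there are constants $\mathcal J_0,\kappa_0>0$ depending only on $D,g_0,\alpha,\gamma,v^*$ such that in the above setting, for all $|t|\ge 1$, all $X,Y\subseteq\Lambda$ with $x=d_{X,Y}>\kappa_0v^*|t|$, and all operators $O_X$, $O_Y$ supported on $X$ and $Y$, $$\bigl\|[U_{>\ell_t}^\dagger O_XU_{>\ell_t},O_Y]\bigr\|\le \mathcal J_0\,|X^{(v^*|t|)}|\,|Y^{(v^*|t|)}|\,\frac{|t|^{2D+1}\log^{2D}(x+1)}{(x-\kappa_0v^*|t|)^\alpha}\,\|O_X\|\,\|O_Y\|.$$ **Theorem 3′.** For every $v^*>0$ and every $k\in\mathbb N$ there are constants $\mathcal J_0^{(k)},\kappa_0>0$ depending only on $D,g_0,\alpha,\gamma,v^*,k$ such that in the above setting, if moreover $H$ is $k$-local ($h_Z=0$ whenever $|Z|>k$), then for all $|t|\ge1$, all $X,Y\subseteq\Lambda$ with $x=d_{X,Y}>\kappa_0v^*|t|$, and all operators $O_X$, $O_Y$ supported on $X$ and $Y$, $$\bigl\|[U_{>\ell_t}^\dagger O_XU_{>\ell_t},O_Y]\bigr\|\le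 \mathcal J_0^{(k)}\,|X^{(v^*|t|)}|\,|Y^{(v^*|t|)}|\,\frac{|t|^{2D+1}}{(x-\kappa_0v^*|t|)^\alpha}\,\|O_X\|\,\|O_Y\|.$$ -/

import Mathlib

open scoped Matrix Matrix.Norms.L2Operator

universe u

noncomputable section

namespace LongRange

/-! ### Geometry of the lattice: a finite graph with its shortest-path distance -/

/-- `d_{X,Y}`: the shortest path length between two (nonempty) sets of sites. -/
def setDist {Λ : Type*} (G : SimpleGraph Λ) (X Y : Finset Λ) : ℕ :=
  sInf {n : ℕ | ∃ i ∈ X, ∃ j ∈ Y, G.dist i j = n}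

/-- `diam(X) = 1 + max_{i,j ∈ X} d_{i,j}`. -/
def diam {Λ : Type*} (G : SimpleGraph Λ) (X : Finset Λ) : ℕ :=
  1 + X.sup fun i => X.sup fun j => G.dist i j

/-- `X[r]`: the sites at distance at most `r` from `X`. -/
def ball {Λ : Type*} [Fintype Λ] (G : SimpleGraph Λ) (X : Finset Λ) (r : ℝ) : Finset Λ :=
  Finset.univ.filter fun i => ∃ j ∈ X, (G.dist j i : ℝ) ≤ r

/-- A choice of the coarse grained sets: `net ξ` is the coarse grained lattice `Λ^(ξ)`, a set of
minimal cardinality among those whose `ξ`-neighbourhood is everything, and `sub X ξ` is the set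
`X^(ξ)`, of minimal cardinality among the subsets of `Λ^(ξ)` whose `ξ`-neighbourhood
contains `X`. -/
structure CoarseGraining {Λ : Type*} [Fintype Λ] (G : SimpleGraph Λ) where
  net : ℝ → Finset Λ
  net_covers : ∀ ξ, 0 ≤ ξ → ball G (net ξ) ξ = Finset.univ
  net_minimal : ∀ ξ, 0 ≤ ξ → ∀ Z : Finset Λ, ball G Z ξ = Finset.univ → (net ξ).card ≤ Z.card
  sub : Finset Λ → ℝ → Finset Λ
  sub_subset : ∀ X ξ, 0 ≤ ξ → sub X ξ ⊆ net ξ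
  sub_covers : ∀ X ξ, 0 ≤ ξ → X ⊆ ball G (sub X ξ) ξ
  sub_minimal : ∀ X ξ, 0 ≤ ξ → ∀ Z : Finset Λ, Z ⊆ net ξ → X ⊆ ball G Z ξ →
    (sub X ξ).card ≤ Z.card

/-- Coarse grained sets exist on every finite graph. -/
theorem CoarseGraining.nonempty {Λ : Type*} [Fintype Λ] (G : SimpleGraph Λ) :
    Nonempty (CoarseGraining G) := by
  have h1 : ∀ ξ : ℝ, ∃ N : Finset Λ, 0 ≤ ξ → (ball G N ξ = Finset.univ ∧
      ∀ Z : Finset Λ, ball G Z ξ = Finset.univ → N.card ≤ Z.card) := by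
    intro ξ
    by_cases hξ : 0 ≤ ξ
    · obtain ⟨N, hN, hmin⟩ := Set.exists_min_image {Z : Finset Λ | ball G Z ξ = Finset.univ}
        Finset.card (Set.toFinite _) ⟨Finset.univ, by
          ext i
          simp only [ball, Finset.mem_filter, Finset.mem_univ, true_and, iff_true]
          exact ⟨i, by simpa using hξ⟩⟩
      exact ⟨N, fun _ => ⟨hN, fun Z hZ => hmin Z hZ⟩⟩
    · exact ⟨∅, fun h => absurd h hξ⟩
  choose N hN using h1
  have h2 : ∀ (X : Finset Λ) (ξ : ℝ), ∃ S : Finset Λ, 0 ≤ ξ → (S ⊆ N ξ ∧ X ⊆ ball G S ξ ∧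
      ∀ Z : Finset Λ, Z ⊆ N ξ → X ⊆ ball G Z ξ → S.card ≤ Z.card) := by
    intro X ξ
    by_cases hξ : 0 ≤ ξ
    · obtain ⟨S, hS, hmin⟩ := Set.exists_min_image
        {Z : Finset Λ | Z ⊆ N ξ ∧ X ⊆ ball G Z ξ} Finset.card (Set.toFinite _)
        ⟨N ξ, subset_rfl, by rw [(hN ξ hξ).1]; exact Finset.subset_univ X⟩
      exact ⟨S, fun _ => ⟨hS.1, hS.2, fun Z h h' => hmin Z ⟨h, h'⟩⟩⟩
    · exact ⟨∅, fun h => absurd h hξ⟩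
  choose S hS using h2
  exact ⟨⟨N, fun ξ h => (hN ξ h).1, fun ξ h => (hN ξ h).2, S, fun X ξ h => (hS X ξ h).1,
    fun X ξ h => (hS X ξ h).2.1, fun X ξ h => (hS X ξ h).2.2⟩⟩

/-- `γ ≥ 1` is a geometric parameter of the `D`-dimensional lattice: volume growth of sets and
balls, number of sites of a coarse grained set (of order one for sets of diameter at most `ξ`, of
order `(diam(X)/ξ)^D` otherwise), and number of sites of `Λ^(ξ)` in a shell of width `ξ`. -/
structure IsGeometricParameter {Λ : Type*} [Fintype Λ] (G : SimpleGraph Λ)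
    (C : CoarseGraining G) (D : ℕ) (γ : ℝ) : Prop where
  one_le : 1 ≤ γ
  card_le : ∀ X : Finset Λ, (X.card : ℝ) ≤ γ * (diam G X : ℝ) ^ D
  card_ball_le : ∀ (i : Λ) (r : ℝ), 1 ≤ r → ((ball G {i} r).card : ℝ) ≤ γ * (2 * r) ^ D
  card_sub_le : ∀ (X : Finset Λ) (ξ : ℝ), 0 < ξ →
    ((C.sub X ξ).card : ℝ) ≤ γ * max 1 (((diam G X : ℝ) / ξ) ^ D)
  card_shell_le : ∀ (i : Λ) (r ξ : ℝ), 1 ≤ ξ → ξ ≤ r →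
    (((C.net ξ).filter fun j => r ≤ (G.dist i j : ℝ) ∧ (G.dist i j : ℝ) < r + ξ).card : ℝ)
      ≤ 2 * γ * D * (2 * r / ξ) ^ (D - 1)

/-! ### Spin systems -/

/-- Basis configurations of a spin system whose site `i` carries the Hilbert space `ℂ^(q i)`. -/
abbrev Config {Λ : Type*} (q : Λ → ℕ) : Type _ := (i : Λ) → Fin (q i)

/-- Operators on `⨂ i, ℂ^(q i)`, as matrices in the product basis. The norm is the operator
norm. -/
abbrev Op {Λ : Type*} (q : Λ → ℕ) : Type _ := Matrix (Config q) (Config q) ℂ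

/-- `A` is supported on `X`: it is of the form `a ⊗ 1` with `a` acting on the sites of `X`. -/
def SupportedOn {Λ : Type*} {q : Λ → ℕ} (X : Finset Λ) (A : Op q) : Prop :=
  ∃ a : ((i : X) → Fin (q i)) → ((i : X) → Fin (q i)) → ℂ,
    (∀ s s' : Config q, (∀ i, i ∉ X → s i = s' i) →
      A s s' = a (fun i => s i) (fun i => s' i)) ∧
    (∀ s s' : Config q, (∃ i, i ∉ X ∧ s i ≠ s' i) → A s s' = 0)

section Dynamics

variable {Λ : Type*} [Fintype Λ] [DecidableEq Λ]

/-- The interaction terms of a long-range Hamiltonian `H = ∑_Z h_Z` with power-law decay, in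
energy units for which the constant of the first decay condition is `1`. -/
structure IsPowerLawInteraction (G : SimpleGraph Λ) {q : Λ → ℕ} (D : ℕ) (α g₀ : ℝ)
    (h : Finset Λ → Op q) : Prop where
  isHermitian : ∀ Z, (h Z).IsHermitian
  supported : ∀ Z, SupportedOn Z (h Z)
  tail_le : ∀ (i : Λ) (r : ℝ), 0 < r →
    ∑ Z : Finset Λ with i ∈ Z ∧ r ≤ (diam G Z : ℝ), ‖h Z‖ ≤ r ^ (-α + D)
  pair_le : ∀ i j : Λ,
    ∑ Z : Finset Λ with i ∈ Z ∧ j ∈ Z, ‖h Z‖ ≤ g₀ * ((G.dist i j : ℝ) + 1) ^ (-α)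

/-- `H_{≤ ℓ}`: the interaction terms of diameter at most `ℓ`. -/
def hamLE (G : SimpleGraph Λ) {q : Λ → ℕ} (h : Finset Λ → Op q) (ℓ : ℝ) : Op q :=
  ∑ Z : Finset Λ with (diam G Z : ℝ) ≤ ℓ, h Z

/-- `H_{> ℓ}`: the interaction terms of diameter larger than `ℓ`. -/
def hamGT (G : SimpleGraph Λ) {q : Λ → ℕ} (h : Finset Λ → Op q) (ℓ : ℝ) : Op q :=
  ∑ Z : Finset Λ with ℓ < (diam G Z : ℝ), h Z

/-- `O(A, τ) = e^{iAτ} O e^{-iAτ}`. -/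
def evolve {q : Λ → ℕ} (A O : Op q) (τ : ℝ) : Op q :=
  NormedSpace.exp ((Complex.I * τ) • A) * O * NormedSpace.exp ((-(Complex.I * τ)) • A)

/-- `U(s) = 𝒯 exp(-i ∫_0^s K(τ) dτ)`: the time-ordered exponential of `K`, i.e. the solution of
`U' = -i K U` with `U(0) = 1`. -/
def IsTimeOrderedExp {q : Λ → ℕ} (K U : ℝ → Op q) : Prop :=
  U 0 = 1 ∧ ∀ s : ℝ, HasDerivAt U ((-Complex.I) • (K s * U s)) s

theorem hasDerivAt_exp_smul {q : Λ → ℕ} (c : ℂ) (A : Op q) (s : ℝ) :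
    HasDerivAt (fun τ : ℝ => NormedSpace.exp ((c * τ) • A))
      (NormedSpace.exp ((c * s) • A) * (c • A)) s := by
  have h := (hasDerivAt_exp_smul_const (𝕂 := ℂ) (c • A) (s : ℂ)).scomp s
    (Complex.ofRealCLM.hasDerivAt (x := s))
  simpa [Function.comp_def, smul_smul, mul_comm] using h

/-- The time-ordered exponential of the interaction picture Hamiltonian exists and is unique. -/
theorem existsUnique_isTimeOrderedExp {q : Λ → ℕ} (A B : Op q) :
    ∃! U : ℝ → Op q, IsTimeOrderedExp (fun τ => evolve A B τ) U := by
  have hE : ∀ (M : Op q) (s : ℝ), NormedSpace.exp ((Complex.I * s) • M) *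
      NormedSpace.exp ((-(Complex.I * s)) • M) = 1 := by
    intro M s
    rw [neg_smul, ← Matrix.exp_add_of_commute _ _ ((Commute.refl ((Complex.I * (s : ℂ)) • M)).neg_right)]
    simp
  have hE' : ∀ (M : Op q) (s : ℝ), NormedSpace.exp ((-(Complex.I * s)) • M) *
      NormedSpace.exp ((Complex.I * s) • M) = 1 := by
    intro M s
    rw [neg_smul, ← Matrix.exp_add_of_commute _ _ ((Commute.refl ((Complex.I * (s : ℂ)) • M)).neg_left)]
    simp
  have hcomm : ∀ (M : Op q) (s : ℝ), NormedSpace.exp ((-(Complex.I * s)) • M) * M =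
      M * NormedSpace.exp ((-(Complex.I * s)) • M) := fun M s =>
    (((Commute.refl M).smul_left (-(Complex.I * s))).exp_left).eq
  have hD1 : ∀ (M : Op q) (s : ℝ), HasDerivAt (fun τ : ℝ => NormedSpace.exp ((Complex.I * τ) • M))
      (NormedSpace.exp ((Complex.I * s) • M) * (Complex.I • M)) s := fun M s =>
    hasDerivAt_exp_smul Complex.I M s
  have hD2 : ∀ (M : Op q) (s : ℝ),
      HasDerivAt (fun τ : ℝ => NormedSpace.exp ((-(Complex.I * τ)) • M))
      (NormedSpace.exp ((-(Complex.I * s)) • M) * ((-Complex.I) • M)) s := fun M s => by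
    simpa only [neg_mul] using hasDerivAt_exp_smul (-Complex.I) M s
  refine ⟨fun s => NormedSpace.exp ((Complex.I * s) • A) *
    NormedSpace.exp ((-(Complex.I * s)) • (A + B)), ⟨by simp, fun s => ?_⟩, ?_⟩
  · refine ((hD1 A s).mul (hD2 (A + B) s)).congr_deriv ?_
    symm
    have e2 := hcomm (A + B) s
    have e1 := hE' A s
    simp only [evolve]
    generalize NormedSpace.exp ((Complex.I * s) • A) = P at *
    generalize NormedSpace.exp ((-(Complex.I * s)) • A) = P' at *
    generalize NormedSpace.exp ((-(Complex.I * s)) • (A + B)) = Q at *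
    have e3 : P * B * P' * (P * Q) = P * B * Q := by
      rw [show P * B * P' * (P * Q) = P * B * (P' * P) * Q by noncomm_ring, e1, mul_one]
    rw [e3, mul_smul_comm, mul_smul_comm, e2, mul_smul_comm, smul_mul_assoc]
    rw [show P * B * Q = P * ((A + B) * Q) - P * A * Q by noncomm_ring]
    module
  · intro V hV
    have hW : ∀ s : ℝ, HasDerivAt (fun τ : ℝ => NormedSpace.exp ((Complex.I * τ) • (A + B)) *
        (NormedSpace.exp ((-(Complex.I * τ)) • A) * V τ)) 0 s := by
      intro s
      refine ((hD1 (A + B) s).mul ((hD2 A s).mul (hV.2 s))).congr_deriv ?_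
      have e1 := hE' A s
      have e2 := hcomm A s
      simp only [evolve, Pi.mul_apply]
      generalize NormedSpace.exp ((Complex.I * s) • A) = P at *
      generalize NormedSpace.exp ((-(Complex.I * s)) • A) = P' at *
      generalize NormedSpace.exp ((Complex.I * s) • (A + B)) = Q at *
      have e3 : P' * (P * B * P' * V s) = B * P' * V s := by
        rw [show P' * (P * B * P' * V s) = (P' * P) * B * P' * V s by noncomm_ring, e1, one_mul]
      simp only [mul_smul_comm, smul_mul_assoc, e3, e2, ← mul_assoc]
      rw [show Q * (A + B) * P' * V s = Q * A * P' * V s + Q * B * P' * V s by noncomm_ring]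
      simp only [mul_add, mul_smul_comm, ← mul_assoc]
      module
    have hc := is_const_of_deriv_eq_zero (fun s => (hW s).differentiableAt)
      (fun s => (hW s).deriv)
    funext s
    have h0 : NormedSpace.exp ((Complex.I * s) • (A + B)) *
        (NormedSpace.exp ((-(Complex.I * s)) • A) * V s) = 1 := by
      have := hc s 0
      simpa [hV.1] using this
    have e1 := hE A s
    have e2 := hE' (A + B) s
    generalize NormedSpace.exp ((Complex.I * s) • A) = P at *
    generalize NormedSpace.exp ((-(Complex.I * s)) • A) = P' at *
    generalize NormedSpace.exp ((Complex.I * s) • (A + B)) = Q at *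
    generalize NormedSpace.exp ((-(Complex.I * s)) • (A + B)) = Q' at *
    calc V s = (P * ((Q' * Q) * P')) * V s := by rw [e2, one_mul, e1, one_mul]
      _ = P * Q' * (Q * (P' * V s)) := by noncomm_ring
      _ = P * Q' := by rw [h0, mul_one]

end Dynamics

/-- `‖[U† O_X U, O_Y]‖ ≤ b ‖O_X‖ ‖O_Y‖` for all operators `O_X`, `O_Y` supported on `X`, `Y`. -/
def CommutatorBound {Λ : Type*} [Fintype Λ] [DecidableEq Λ] {q : Λ → ℕ} (U : Op q)
    (X Y : Finset Λ) (b : ℝ) : Prop :=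
  ∀ O_X O_Y : Op q, SupportedOn X O_X → SupportedOn Y O_Y →
    ‖(Uᴴ * O_X * U) * O_Y - O_Y * (Uᴴ * O_X * U)‖ ≤ b * (‖O_X‖ * ‖O_Y‖)

/-- The exponent `η̃` of the truncation length. -/
def etaTilde (D : ℕ) (α : ℝ) : ℝ := 1 - (α - 2 * D - 1) / (2 * (α - D))

/-- The truncation length `ℓ_t = |t|^η̃`. -/
def truncLength (D : ℕ) (α t : ℝ) : ℝ := |t| ^ etaTilde D α

/-- `U` is the interaction picture propagator `s ↦ 𝒯 exp(-i ∫_0^s H_{>ℓ}(H_{≤ℓ}, τ) dτ)`. -/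
def IsLongRangePropagator {Λ : Type*} [Fintype Λ] [DecidableEq Λ] (G : SimpleGraph Λ)
    {q : Λ → ℕ} (h : Finset Λ → Op q) (ℓ : ℝ) (U : ℝ → Op q) : Prop :=
  IsTimeOrderedExp (fun τ => evolve (hamLE G h ℓ) (hamGT G h ℓ) τ) U

end LongRange

end

open LongRange

/-! The propagator `U(t)` is the product of `e^{itA}`, with `A` the truncated Hamiltonian, and
`e^{-itH}`, with `H` the full one. So `U(t)† O U(t)` is `O` evolved by time `-t` under `A` and then
by time `t` under `H` (`IsTimeOrderedExp.eq_flow_mul_flow`). It suffices that the first evolution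
has a linear light cone with exponential tails and that the second has a power-law tail:
`LocalNet.commBound_mul` composes the two.

Time is rescaled first. Evolving by `t` under `H` is evolving by `|t|/τ` under `±τH`, so the
coupling may be taken as small as every perturbative step wants, at the price of constants only.
Estimates concern pairs of sets inside blocks whose radius is proportional to the time `T`; general
sets are covered by blocks at the end, which produces the cardinalities of the coarse grained sets.

The engine is perturbative. An evolution with exponential tails writes an evolved operator as a sum
over growing neighbourhoods (`LocalNet.exists_shell_decomposition`). Duhamel's formula then bounds
the perturbed evolution in terms of itself: a bound with prefactor `M` improves to one with
prefactor `k + M/2`. Some `M` works trivially on a finite lattice, so `2k` works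
(`LocalNet.blockBound_bootstrap`).

For the truncated Hamiltonian there is an induction over `T = 2^n`, with tails of range `σ = T^η̃`
and truncation at `σ/2` (`LocalNet.blockBound_truncLE_step`). One step adds the next interactions,
doubles the time by composing two halves and doubles the blocks. Every prefactor is turned into a
shift of the cone by a multiple of `σ`, that is, a change of velocity or an offset of order `σ`. The
velocity changes are of order `T^(η̃-1)`, geometrically summable over the scales because `η̃ < 1`.
With `δ = α - 2D - 1`, the perturbation has strength `T · T^D · T^(-η̃(α-D)) = T^(-δ/2)`.

For the full Hamiltonian all remaining terms are added at once (`LocalNet.blockBound_full`), against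
a profile which falls from order one to `T^(-δ)` over `κ` block radii and like `(r/T)^(-α)` beyond.
Nearby couplings of strength `T^(-δ/2)` meet a variation of the profile of at most `T^(δ/2)`.
Distant ones have strength `T · T^(2D) · T^(-α) = T^(-δ)` and may lose `T^δ`. The plateau gives
`T^(-δ) (r/T)^(-α) = T^(2D+1) r^(-α)`. No logarithm arises, and `log(x+1) ≥ 1` in the range
considered, so this one bound yields both estimates. -/

namespace LongRange

/-! ### Local algebras and conjugation by unitaries -/

/-- A net of local subalgebras of a C⋆-algebra, together with expectations `expect Y` which remove
the sites of `Y` from the support by averaging over unitaries supported on `Y`. -/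
structure LocalNet (Λ 𝒜 : Type*) [Fintype Λ] [DecidableEq Λ] [CStarAlgebra 𝒜] where
  alg : Finset Λ → Subalgebra ℂ 𝒜
  mono : ∀ {X Y : Finset Λ}, X ⊆ Y → alg X ≤ alg Y
  mem_univ : ∀ a : 𝒜, a ∈ alg Finset.univ
  comm : ∀ {X Y : Finset Λ} {a b : 𝒜}, Disjoint X Y → a ∈ alg X → b ∈ alg Y → a * b = b * a
  expect : Finset Λ → 𝒜 →ₗ[ℂ] 𝒜
  expect_mem : ∀ (Y : Finset Λ) {W : Finset Λ} {a : 𝒜}, a ∈ alg W → expect Y a ∈ alg (W \ Y)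
  expect_hull : ∀ (Y : Finset Λ) (a : 𝒜), expect Y a ∈
    convexHull ℝ {x | ∃ g ∈ unitary 𝒜, g ∈ alg Y ∧ x = g * a * star g}

/-- The automorphism `a ↦ u a u⋆` of a unitary `u`. -/
def unitaryConj {𝒜 : Type*} [CStarAlgebra 𝒜] (u : unitary 𝒜) (a : 𝒜) : 𝒜 :=
  (u : 𝒜) * a * star (u : 𝒜)

section UnitaryConj

variable {𝒜 : Type*} [CStarAlgebra 𝒜] (u v : unitary 𝒜) (a b : 𝒜)

theorem unitaryConj_mul : unitaryConj u (a * b) = unitaryConj u a * unitaryConj u b := by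
  have := Unitary.coe_star_mul_self u
  simp only [unitaryConj]
  calc (u : 𝒜) * (a * b) * star (u : 𝒜) = u * a * 1 * b * star (u : 𝒜) := by noncomm_ring
    _ = _ := by rw [← this]; noncomm_ring

theorem unitaryConj_sub : unitaryConj u (a - b) = unitaryConj u a - unitaryConj u b := by
  simp only [unitaryConj]; noncomm_ring

theorem unitaryConj_sum {ι : Type*} (s : Finset ι) (f : ι → 𝒜) :
    unitaryConj u (∑ i ∈ s, f i) = ∑ i ∈ s, unitaryConj u (f i) := by
  simp only [unitaryConj, Finset.mul_sum, Finset.sum_mul]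

theorem unitaryConj_mul_left : unitaryConj (u * v) a = unitaryConj u (unitaryConj v a) := by
  simp [unitaryConj, mul_assoc]

theorem unitaryConj_one : unitaryConj 1 a = a := by simp [unitaryConj]

theorem norm_unitaryConj : ‖unitaryConj u a‖ = ‖a‖ := by
  rw [unitaryConj, ← Unitary.coe_star, CStarRing.norm_mul_coe_unitary,
    CStarRing.norm_coe_unitary_mul]

theorem unitaryConj_star_conj : unitaryConj u (unitaryConj (star u) a) = a := by
  rw [← unitaryConj_mul_left, Unitary.mul_star_self, unitaryConj_one]

theorem norm_commutator_le : ‖a * b - b * a‖ ≤ 2 * (‖a‖ * ‖b‖) := by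
  have h1 := norm_sub_le (a * b) (b * a)
  have h2 := norm_mul_le a b
  have h3 := norm_mul_le b a
  nlinarith

theorem norm_unitaryConj_commutator :
    ‖unitaryConj u a * b - b * unitaryConj u a‖ =
      ‖a * unitaryConj (star u) b - unitaryConj (star u) b * a‖ := by
  rw [← norm_unitaryConj u (a * _ - _), unitaryConj_sub, unitaryConj_mul, unitaryConj_mul,
    unitaryConj_star_conj]

/-- Conjugation by a unitary moves `a` by at most the norm of the commutator. -/
theorem norm_conj_sub_self {g : 𝒜} (hg : g ∈ unitary 𝒜) :
    ‖g * a * star g - a‖ = ‖a * g - g * a‖ := by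
  have h : (g * a * star g - a) * g = g * a - a * g := by
    have := (Unitary.mem_iff.1 hg).1
    rw [sub_mul, mul_assoc (g * a), this, mul_one]
  rw [← CStarRing.norm_mul_mem_unitary _ hg, h, norm_sub_rev]

theorem norm_le_one_of_mem_unitary {g : 𝒜} (hg : g ∈ unitary 𝒜) : ‖g‖ ≤ 1 := by
  nontriviality 𝒜
  exact (CStarRing.norm_of_mem_unitary hg).le

end UnitaryConj

/-! ### Localization by averaging, and commutator bounds for pairs of regions -/

namespace LocalNet

variable {Λ 𝒜 : Type*} [Fintype Λ] [DecidableEq Λ] [CStarAlgebra 𝒜] (N : LocalNet Λ 𝒜)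

theorem norm_expect_sub_le (Y : Finset Λ) (a : 𝒜) (δ : ℝ)
    (h : ∀ g ∈ unitary 𝒜, g ∈ N.alg Y → ‖a * g - g * a‖ ≤ δ) : ‖N.expect Y a - a‖ ≤ δ := by
  have h1 : convexHull ℝ {x | ∃ g ∈ unitary 𝒜, g ∈ N.alg Y ∧ x = g * a * star g} ⊆
      Metric.closedBall a δ := by
    refine convexHull_min ?_ (convex_closedBall a δ)
    rintro x ⟨g, hg, hgY, rfl⟩
    rw [mem_closedBall_iff_norm, norm_conj_sub_self a hg]
    exact h g hg hgY
  exact mem_closedBall_iff_norm.1 (h1 (N.expect_hull Y a))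

theorem norm_expect_le (Y : Finset Λ) (a : 𝒜) : ‖N.expect Y a‖ ≤ ‖a‖ := by
  have h1 : convexHull ℝ {x | ∃ g ∈ unitary 𝒜, g ∈ N.alg Y ∧ x = g * a * star g} ⊆
      Metric.closedBall 0 ‖a‖ := by
    refine convexHull_min ?_ (convex_closedBall 0 ‖a‖)
    rintro x ⟨g, hg, hgY, rfl⟩
    rw [mem_closedBall_zero_iff]
    exact (norm_unitaryConj ⟨g, hg⟩ a).le
  simpa using h1 (N.expect_hull Y a)

/-- An operator which almost commutes with the operators on each of the sets `Q k` is close to an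
operator supported away from these sets. -/
theorem exists_localized {ι : Type*} [DecidableEq ι] (I : Finset ι) (Q : ι → Finset Λ)
    (δ : ι → ℝ) {W : Finset Λ} {a : 𝒜} (ha : a ∈ N.alg W)
    (h : ∀ k ∈ I, ∀ g ∈ unitary 𝒜, g ∈ N.alg (Q k) → ‖a * g - g * a‖ ≤ δ k) :
    ∃ a' ∈ N.alg (W \ I.biUnion Q), ‖a'‖ ≤ ‖a‖ ∧ ‖a' - a‖ ≤ ∑ k ∈ I, δ k := by
  induction I using Finset.induction_on with
  | empty => exact ⟨a, by simpa using ha, le_rfl, by simp⟩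
  | insert k I hk ih =>
    obtain ⟨a', ha', hn, hd⟩ := ih fun j hj => h j (Finset.mem_insert_of_mem hj)
    refine ⟨N.expect (Q k) a', ?_, (N.norm_expect_le _ _).trans hn, ?_⟩
    · have := N.expect_mem (Q k) ha'
      rwa [Finset.biUnion_insert, Finset.union_comm, ← Finset.sup_eq_union, ← sdiff_sdiff_left]
    · rw [Finset.sum_insert hk]
      -- The hypothesis controls the commutators of `a`, not those of the already modified `a'`.
      -- Linearity and contractivity of the expectation carry the earlier error along.
      have h1 : N.expect (Q k) a' - a = (N.expect (Q k) a - a) + N.expect (Q k) (a' - a) := by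
        rw [map_sub]; abel
      rw [h1]
      exact (norm_add_le _ _).trans (add_le_add
        (N.norm_expect_sub_le _ _ _ (h k (Finset.mem_insert_self _ _)))
        ((N.norm_expect_le _ _).trans hd))

/-- `‖[T a, b]‖ ≤ c ‖a‖ ‖b‖` for all `a`, `b` supported on `X`, `Y`. -/
def CommBound (T : 𝒜 → 𝒜) (X Y : Finset Λ) (c : ℝ) : Prop :=
  ∀ a ∈ N.alg X, ∀ b ∈ N.alg Y, ‖T a * b - b * T a‖ ≤ c * (‖a‖ * ‖b‖)

variable {N}

theorem CommBound.weaken {T : 𝒜 → 𝒜} {X X' Y Y' : Finset Λ} {c c' : ℝ} (h : N.CommBound T X Y c)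
    (hX : X' ⊆ X) (hY : Y' ⊆ Y) (hc : c ≤ c') : N.CommBound T X' Y' c' := fun a ha b hb =>
  (h a (N.mono hX ha) b (N.mono hY hb)).trans (by gcongr)

theorem commBound_two (u : unitary 𝒜) (X Y : Finset Λ) :
    N.CommBound (unitaryConj u) X Y 2 := fun a _ b _ => by
  simpa [norm_unitaryConj] using norm_commutator_le (unitaryConj u a) b

theorem CommBound.norm_commutator_unitary_le {T : 𝒜 → 𝒜} {X Y : Finset Λ} {c : ℝ} (hc : 0 ≤ c)
    (h : N.CommBound T X Y c) {a g : 𝒜} (ha : a ∈ N.alg X) (hg : g ∈ unitary 𝒜)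
    (hgY : g ∈ N.alg Y) : ‖T a * g - g * T a‖ ≤ c * ‖a‖ :=
  (h a ha g hgY).trans (by
    have := norm_le_one_of_mem_unitary hg
    have h2 : ‖a‖ * ‖g‖ ≤ ‖a‖ := mul_le_of_le_one_right (norm_nonneg _) this
    gcongr)

/-- Conjugating the whole commutator by the inverse unitary transfers the evolution to the other
operator without changing the norm. -/
theorem CommBound.symm {u : unitary 𝒜} {X Y : Finset Λ} {c : ℝ}
    (h : N.CommBound (unitaryConj u) X Y c) : N.CommBound (unitaryConj (star u)) Y X c :=
  fun a ha b hb => by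
    rw [norm_unitaryConj_commutator, star_star, norm_sub_rev, mul_comm ‖a‖]
    exact h b hb a ha

/-- An operator on a union is not a sum of operators on the pieces, so the bounds cannot just be
added. Instead the evolved operator is localized away from all pieces; the localized one commutes
exactly with `b`, and the error costs a factor two. -/
theorem CommBound.biUnion_right {ι : Type*} [DecidableEq ι] {u : unitary 𝒜} {I : Finset ι}
    {X Y : Finset Λ} {Q : ι → Finset Λ} {c : ι → ℝ} (hc : ∀ k ∈ I, 0 ≤ c k)
    (h : ∀ k ∈ I, N.CommBound (unitaryConj u) X (Q k) (c k)) (hY : Y ⊆ I.biUnion Q) :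
    N.CommBound (unitaryConj u) X Y (2 * ∑ k ∈ I, c k) := by
  intro a ha b hb
  obtain ⟨a', ha', -, hd⟩ := N.exists_localized I Q (fun k => c k * ‖a‖)
    (N.mem_univ (unitaryConj u a)) fun k hk g hg hgQ =>
      (h k hk).norm_commutator_unitary_le (hc k hk) ha hg hgQ
  have hcomm : a' * b = b * a' := N.comm
    (Finset.disjoint_of_subset_right hY Finset.sdiff_disjoint) ha' hb
  have h1 : unitaryConj u a * b - b * unitaryConj u a =
      (unitaryConj u a - a') * b - b * (unitaryConj u a - a') := by
    rw [sub_mul, mul_sub, hcomm]; abel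
  rw [h1]
  refine (norm_commutator_le _ _).trans ?_
  rw [norm_sub_rev] at hd
  calc 2 * (‖unitaryConj u a - a'‖ * ‖b‖) ≤ 2 * ((∑ k ∈ I, c k * ‖a‖) * ‖b‖) := by gcongr
    _ = _ := by rw [← Finset.sum_mul]; ring

theorem CommBound.biUnion_left {ι : Type*} [DecidableEq ι] {u : unitary 𝒜} {I : Finset ι}
    {X Y : Finset Λ} {P : ι → Finset Λ} {c : ι → ℝ} (hc : ∀ k ∈ I, 0 ≤ c k)
    (h : ∀ k ∈ I, N.CommBound (unitaryConj u) (P k) Y (c k)) (hX : X ⊆ I.biUnion P) :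
    N.CommBound (unitaryConj u) X Y (2 * ∑ k ∈ I, c k) := by
  have := (CommBound.biUnion_right hc (fun k hk => (h k hk).symm) hX).symm
  rwa [star_star] at this

end LocalNet

/-! ### Blocks -/

section BlockNet

variable {Λ : Type*} [PseudoMetricSpace Λ]

/-- A net of centers of blocks of radius `ξ` which cover everything, of dimension less
than `p`. -/
structure BlockNet (Λ : Type*) [PseudoMetricSpace Λ] (ξ K : ℝ) (p : ℕ) where
  net : Finset Λ
  covers : ∀ i, ∃ m ∈ net, dist m i ≤ ξ
  sum_le : ∀ a, ∑ m ∈ net, ((1 + dist a m / ξ) ^ p)⁻¹ ≤ K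

variable {ξ K : ℝ} {p : ℕ}

/-- Markov's inequality: each center counted contributes at least `(1 + t)⁻ᵖ` to a sum bounded by
`K`. -/
theorem BlockNet.card_le (B : BlockNet Λ ξ K p) (hξ : 0 < ξ) (a : Λ) {t : ℝ} (ht : 0 ≤ t)
    {I : Finset Λ} (hI : I ⊆ B.net) (h : ∀ m ∈ I, dist a m ≤ t * ξ) :
    (I.card : ℝ) ≤ K * (1 + t) ^ p := by
  have h1 : (I.card : ℝ) * ((1 + t) ^ p)⁻¹ ≤ K := by
    refine le_trans ?_ (B.sum_le a)
    calc (I.card : ℝ) * ((1 + t) ^ p)⁻¹ = ∑ m ∈ I, ((1 + t) ^ p)⁻¹ := by simp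
      _ ≤ ∑ m ∈ I, ((1 + dist a m / ξ) ^ p)⁻¹ := by
        refine Finset.sum_le_sum fun m hm => ?_
        have : dist a m / ξ ≤ t := by rw [div_le_iff₀ hξ]; exact h m hm
        gcongr
      _ ≤ _ := Finset.sum_le_sum_of_subset_of_nonneg hI fun _ _ _ => by positivity
  have h2 : (0 : ℝ) < (1 + t) ^ p := by positivity
  rwa [← div_eq_mul_inv, div_le_iff₀ h2] at h1

end BlockNet

section Blocks

variable {Λ : Type*} [Fintype Λ] [PseudoMetricSpace Λ]

open Classical in
/-- The closed `r`-neighbourhood of a finite set of sites. -/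
noncomputable def nbhd (X : Finset Λ) (r : ℝ) : Finset Λ :=
  Finset.univ.filter fun i => ∃ j ∈ X, dist j i ≤ r

open Classical in
/-- The closed ball of radius `r` as a finite set of sites. -/
noncomputable def block (m : Λ) (r : ℝ) : Finset Λ :=
  Finset.univ.filter fun i => dist m i ≤ r

theorem mem_nbhd {X : Finset Λ} {r : ℝ} {i : Λ} : i ∈ nbhd X r ↔ ∃ j ∈ X, dist j i ≤ r := by
  simp [nbhd]

theorem mem_block {m : Λ} {r : ℝ} {i : Λ} : i ∈ block m r ↔ dist m i ≤ r := by
  simp [block]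

/-- `X` and `Y` have distance at least `r`. -/
def Apart (r : ℝ) (X Y : Finset Λ) : Prop := ∀ i ∈ X, ∀ j ∈ Y, r ≤ dist i j

/-- Finiteness of the diameter enters only qualitatively: it ends the shell expansions and starts
the bootstrap. No constant in the final bounds depends on `M`. -/
theorem exists_dist_le (Λ : Type*) [Fintype Λ] [PseudoMetricSpace Λ] :
    ∃ M : ℝ, 0 ≤ M ∧ ∀ i j : Λ, dist i j ≤ M := by
  have h := (Metric.isBounded_iff_nndist.1 (Set.finite_univ (α := Λ)).isBounded)
  obtain ⟨M, hM⟩ := h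
  exact ⟨M, M.2, fun i j => by exact_mod_cast hM (Set.mem_univ i) (Set.mem_univ j)⟩

end Blocks

/-! ### Quasi-locality: decomposition of evolved operators into shells -/

theorem exp_neg_le_inv_pow (p : ℕ) {z : ℝ} (hz : 0 ≤ z) :
    Real.exp (-z) ≤ p.factorial * Real.exp 1 * ((1 + z) ^ p)⁻¹ := by
  have h := Real.pow_div_factorial_le_exp (1 + z) (by positivity) p
  rw [Real.exp_neg, ← div_eq_mul_inv]
  rw [div_le_iff₀ (by positivity), Real.exp_add] at h
  rw [inv_le_iff_one_le_mul₀ (Real.exp_pos z), div_mul_eq_mul_div, one_le_div (by positivity)]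
  linarith

namespace LocalNet

variable {Λ 𝒜 : Type*} [Fintype Λ] [DecidableEq Λ] [PseudoMetricSpace Λ] [CStarAlgebra 𝒜]
  {N : LocalNet Λ 𝒜} {ξ K : ℝ} {p : ℕ}

/-- Commutators of operators on sets inside blocks of radius `ξ` are bounded by the function `f`
of the distance. -/
def BlockBound (N : LocalNet Λ 𝒜) (ξ : ℝ) (T : 𝒜 → 𝒜) (f : ℝ → ℝ) : Prop :=
  ∀ (r : ℝ) (a b : Λ) (X Y : Finset Λ), X.Nonempty → Y.Nonempty → X ⊆ block a ξ →
    Y ⊆ block b ξ → Apart r X Y → N.CommBound T X Y (f r)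

/-- The constant of the shell decomposition. -/
noncomputable def shellConst (p : ℕ) (K : ℝ) : ℝ :=
  4 * p.factorial * Real.exp 1 ^ 2 * K + 1

/-- Makes the tail summable over all blocks. Since `σ ≤ ξ`, the excess of the distance over `r`
decays at least exponentially in units of `ξ`; this is traded for the weight `(1 + d/ξ)⁻ᵖ` that the
net can sum. -/
theorem exp_block_le {ξ σ R r d : ℝ} (p : ℕ) (hσ : 0 < σ) (hσξ : σ ≤ ξ) (hr : 0 ≤ r)
    (hd : 0 ≤ d) :
    2 * Real.exp (-(max r (d - 2 * ξ) - R) / σ) ≤ 2 * (p.factorial * Real.exp 1) *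
      (3 + r / ξ) ^ p * Real.exp (-(r - R) / σ) * ((1 + d / ξ) ^ p)⁻¹ := by
  have hξ : 0 < ξ := hσ.trans_le hσξ
  set z := max 0 ((d - 2 * ξ - r) / ξ) with hz
  have hz0 : 0 ≤ z := le_max_left _ _
  have h1 : Real.exp (-(max r (d - 2 * ξ) - R) / σ) ≤ Real.exp (-(r - R) / σ) * Real.exp (-z) := by
    rw [← Real.exp_add, Real.exp_le_exp]
    have h2 : max r (d - 2 * ξ) = r + z * ξ := by
      rw [hz, max_mul_of_nonneg _ _ hξ.le, div_mul_cancel₀ _ hξ.ne', zero_mul]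
      rw [← max_add_add_left]; simp
    rw [h2]
    have h3 : z ≤ z * ξ / σ := by
      rw [le_div_iff₀ hσ]; gcongr
    have : -(r + z * ξ - R) / σ = -(r - R) / σ - z * ξ / σ := by ring
    linarith
  have h4 : 1 + d / ξ ≤ (3 + r / ξ) * (1 + z) := by
    have h5 : (d - 2 * ξ - r) / ξ ≤ z := le_max_right _ _
    have h6 : (d - 2 * ξ - r) / ξ = d / ξ - 2 - r / ξ := by field_simp
    have h7 : 0 ≤ r / ξ := by positivity
    nlinarith
  have h8 : ((1 + z) ^ p)⁻¹ ≤ (3 + r / ξ) ^ p * ((1 + d / ξ) ^ p)⁻¹ := by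
    have h9 : (1 + d / ξ) ^ p ≤ (3 + r / ξ) ^ p * (1 + z) ^ p := by
      rw [← mul_pow]; gcongr
    have h10 : 0 < (1 + z) ^ p := by positivity
    have h11 : 0 < (1 + d / ξ) ^ p := by positivity
    rw [← div_eq_mul_inv, le_div_iff₀ h11, inv_mul_le_iff₀ h10]
    linarith
  calc 2 * Real.exp (-(max r (d - 2 * ξ) - R) / σ)
      ≤ 2 * (Real.exp (-(r - R) / σ) * Real.exp (-z)) := by gcongr
    _ ≤ 2 * (Real.exp (-(r - R) / σ) * (p.factorial * Real.exp 1 *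
          ((3 + r / ξ) ^ p * ((1 + d / ξ) ^ p)⁻¹))) := by
        gcongr
        exact (exp_neg_le_inv_pow p hz0).trans (by gcongr)
    _ = _ := by ring

section Shell

variable (B : BlockNet Λ ξ K p) {u : unitary 𝒜} {σ R : ℝ} {X : Finset Λ} {a₀ : Λ}

-- The part of each block outside the `r`-neighbourhood is averaged out. The distance from `X` to
-- such a part is at least `r`, and at least `dist a₀ m - 2ξ` by the triangle inequality, so the
-- errors sum over the net.
include B in
theorem exists_tail (hσ : 0 < σ) (hσξ : σ ≤ ξ) (hX : X.Nonempty) (hXa : X ⊆ block a₀ ξ)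
    (h : N.BlockBound ξ (unitaryConj u) fun r => 2 * Real.exp (-(r - R) / σ))
    {a : 𝒜} (ha : a ∈ N.alg X) {r : ℝ} (hr : 0 ≤ r) :
    ∃ a' ∈ N.alg (nbhd X r), ‖a'‖ ≤ ‖a‖ ∧ ‖a' - unitaryConj u a‖ ≤
      2 * (p.factorial * Real.exp 1) * K * (3 + r / ξ) ^ p * Real.exp (-(r - R) / σ) * ‖a‖ := by
  classical
  set Q : Λ → Finset Λ := fun m => block m ξ \ nbhd X r with hQ
  set I := B.net.filter fun m => (Q m).Nonempty with hI
  set b : Λ → ℝ := fun m => 2 * Real.exp (-(max r (dist a₀ m - 2 * ξ) - R) / σ)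
  have hb : ∀ m, 0 ≤ b m := fun m => by positivity
  obtain ⟨a', ha', hn, hd⟩ := N.exists_localized I Q (fun m => b m * ‖a‖)
    (N.mem_univ (unitaryConj u a)) fun m hm g hg hgQ => by
      refine CommBound.norm_commutator_unitary_le (hb m) ?_ ha hg hgQ
      refine h _ a₀ m X (Q m) hX (Finset.mem_filter.1 hm).2 hXa Finset.sdiff_subset ?_
      intro i hi j hj
      rw [hQ, Finset.mem_sdiff, mem_block, mem_nbhd] at hj
      have h1 : r ≤ dist i j := by
        by_contra hlt
        exact hj.2 ⟨i, hi, (not_le.1 hlt).le⟩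
      have h2 := mem_block.1 (hXa hi)
      have h3 := dist_triangle4 a₀ i j m
      rw [dist_comm j m] at h3
      exact max_le h1 (by linarith [hj.1])
  refine ⟨a', N.mono ?_ ha', by rwa [norm_unitaryConj] at hn, hd.trans ?_⟩
  · intro i hi
    rw [Finset.mem_sdiff, Finset.mem_biUnion] at hi
    by_contra hin
    obtain ⟨m, hm, hmi⟩ := B.covers i
    have : i ∈ Q m := Finset.mem_sdiff.2 ⟨mem_block.2 hmi, hin⟩
    exact hi.2 ⟨m, Finset.mem_filter.2 ⟨hm, ⟨i, this⟩⟩, this⟩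
  · rw [← Finset.sum_mul]
    refine mul_le_mul_of_nonneg_right ?_ (norm_nonneg a)
    have hξ : 0 < ξ := hσ.trans_le hσξ
    calc ∑ m ∈ I, b m ≤ ∑ m ∈ B.net, b m :=
          Finset.sum_le_sum_of_subset_of_nonneg (Finset.filter_subset _ _) fun m _ _ => hb m
      _ ≤ ∑ m ∈ B.net, 2 * (p.factorial * Real.exp 1) * (3 + r / ξ) ^ p *
            Real.exp (-(r - R) / σ) * ((1 + dist a₀ m / ξ) ^ p)⁻¹ :=
          Finset.sum_le_sum fun m _ => exp_block_le p hσ hσξ hr dist_nonneg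
      _ = 2 * (p.factorial * Real.exp 1) * (3 + r / ξ) ^ p *
            Real.exp (-(r - R) / σ) * ∑ m ∈ B.net, ((1 + dist a₀ m / ξ) ^ p)⁻¹ := by
          rw [Finset.mul_sum]
      _ ≤ 2 * (p.factorial * Real.exp 1) * (3 + r / ξ) ^ p *
            Real.exp (-(r - R) / σ) * K := by
          gcongr
          exact B.sum_le a₀
      _ = _ := by ring

include B in
/-- An evolved operator is a sum of operators on growing neighbourhoods, of exponentially decaying
norms. -/
theorem exists_shell_decomposition (hK : 0 ≤ K) (hσ : 0 < σ) (hσξ : σ ≤ ξ) (hR : 0 ≤ R)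
    (hRξ : R ≤ ξ) (hX : X.Nonempty) (hXa : X ⊆ block a₀ ξ)
    (h : N.BlockBound ξ (unitaryConj u) fun r => 2 * Real.exp (-(r - R) / σ))
    {a : 𝒜} (ha : a ∈ N.alg X) :
    ∃ (n₀ : ℕ) (A : ℕ → 𝒜), unitaryConj u a = ∑ n ∈ Finset.range n₀, A n ∧
      ∀ n : ℕ, A n ∈ N.alg (nbhd X (R + n * σ)) ∧
        ‖A n‖ ≤ shellConst p K * (4 + n) ^ p * Real.exp (-n) * ‖a‖ := by
  have hξ : 0 < ξ := hσ.trans_le hσξ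
  set C := 2 * (p.factorial * Real.exp 1) * K with hC
  have hC0 : 0 ≤ C := by positivity
  have ht : ∀ n : ℕ, ∃ a' ∈ N.alg (nbhd X (R + n * σ)), ‖a'‖ ≤ ‖a‖ ∧
      ‖a' - unitaryConj u a‖ ≤ C * (4 + n) ^ p * Real.exp (-n) * ‖a‖ := by
    intro n
    obtain ⟨a', h1, h2, h3⟩ := exists_tail B hσ hσξ hX hXa h ha (r := R + n * σ) (by positivity)
    refine ⟨a', h1, h2, h3.trans ?_⟩
    have e1 : -(R + n * σ - R) / σ = -(n : ℝ) := by field_simp; ring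
    have e2 : 3 + (R + n * σ) / ξ ≤ 4 + n := by
      have : (R + n * σ) / ξ ≤ 1 + n := by
        rw [div_le_iff₀ hξ]
        have : n * σ ≤ n * ξ := by gcongr
        linarith
      linarith
    rw [e1]
    gcongr
  choose S hS hSn hSd using ht
  obtain ⟨M, hM0, hM⟩ := exists_dist_le Λ
  obtain ⟨n₁, hn₁⟩ := exists_nat_ge (M / σ)
  -- From `n₁` on the neighbourhood is all of `Λ`, so the approximant can be replaced by the evolved
  -- operator itself. The telescoping sum is then finite and exact.
  set S' : ℕ → 𝒜 := fun n => if n < n₁ then S n else unitaryConj u a with hS'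
  have hS'mem : ∀ n : ℕ, S' n ∈ N.alg (nbhd X (R + n * σ)) := by
    intro n
    by_cases hn : n < n₁
    · simpa [hS', hn] using hS n
    · have : nbhd X (R + n * σ) = Finset.univ := by
        ext i
        simp only [Finset.mem_univ, iff_true, mem_nbhd]
        obtain ⟨j, hj⟩ := hX
        refine ⟨j, hj, (hM j i).trans ?_⟩
        have h1 : (n₁ : ℝ) ≤ n := by exact_mod_cast not_lt.1 hn
        rw [div_le_iff₀ hσ] at hn₁
        nlinarith
      rw [this]
      exact N.mem_univ _
  have hS'd : ∀ n : ℕ, ‖S' n - unitaryConj u a‖ ≤ C * (4 + n) ^ p * Real.exp (-n) * ‖a‖ := by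
    intro n
    by_cases hn : n < n₁
    · simpa [hS', hn] using hSd n
    · simp only [hS', hn, if_false, sub_self, norm_zero]
      positivity
  have hS'0 : ‖S' 0‖ ≤ ‖a‖ := by
    by_cases hn : 0 < n₁
    · simpa [hS', hn] using hSn 0
    · simp [hS', hn, norm_unitaryConj]
  set A : ℕ → 𝒜 := fun n => match n with
    | 0 => S' 0
    | n + 1 => S' (n + 1) - S' n
  refine ⟨n₁ + 1, A, ?_, ?_⟩
  · rw [Finset.sum_range_succ']
    change _ = ∑ n ∈ Finset.range n₁, (S' (n + 1) - S' n) + S' 0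
    rw [Finset.sum_range_sub]
    simp [hS']
  · have hexp : 1 ≤ Real.exp 1 := Real.one_le_exp zero_le_one
    -- A difference of consecutive approximants has error at most `C` plus `C e`, both relative to
    -- the later `e^{-n}`; the `+ 1` pays for the zeroth shell, which is only bounded by `‖a‖`.
    have hC2 : shellConst p K = 2 * C * Real.exp 1 + 1 := by rw [shellConst, hC]; ring
    intro n
    cases n with
    | zero =>
      refine ⟨hS'mem 0, hS'0.trans ?_⟩
      have h1 : (1 : ℝ) ≤ (4 + ((0 : ℕ) : ℝ)) ^ p := one_le_pow₀ (by norm_num)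
      have h2 : 1 ≤ shellConst p K := by rw [hC2]; nlinarith [Real.exp_pos 1]
      have h3 : Real.exp (-((0 : ℕ) : ℝ)) = 1 := by simp
      rw [h3, mul_one]
      exact le_mul_of_one_le_left (norm_nonneg _) (one_le_mul_of_one_le_of_one_le h2 h1)
    | succ n =>
      refine ⟨Subalgebra.sub_mem _ (hS'mem _) (N.mono ?_ (hS'mem n)), ?_⟩
      · intro i
        rw [mem_nbhd, mem_nbhd]
        rintro ⟨j, hj, hji⟩
        refine ⟨j, hj, hji.trans ?_⟩
        push_cast
        nlinarith
      · have h1 : S' (n + 1) - S' n =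
            (S' (n + 1) - unitaryConj u a) - (S' n - unitaryConj u a) := by abel
        have h2 := norm_sub_le (S' (n + 1) - unitaryConj u a) (S' n - unitaryConj u a)
        have h3 := hS'd (n + 1)
        have h4 : ‖S' n - unitaryConj u a‖ ≤ C * (4 + ((n + 1 : ℕ) : ℝ)) ^ p *
            (Real.exp 1 * Real.exp (-((n + 1 : ℕ) : ℝ))) * ‖a‖ := by
          refine (hS'd n).trans ?_
          have : Real.exp (-(n : ℝ)) = Real.exp 1 * Real.exp (-((n + 1 : ℕ) : ℝ)) := by
            rw [← Real.exp_add]; push_cast; ring_nf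
          rw [this]
          gcongr
          simp
        change ‖S' (n + 1) - S' n‖ ≤ _
        rw [h1, hC2]
        refine h2.trans ((add_le_add h3 h4).trans ?_)
        set w := (4 + ((n + 1 : ℕ) : ℝ)) ^ p * Real.exp (-((n + 1 : ℕ) : ℝ)) * ‖a‖
        have hw : 0 ≤ w := by positivity
        calc _ = C * w + C * Real.exp 1 * w := by ring
          _ ≤ C * Real.exp 1 * w + C * Real.exp 1 * w + w := by
            have : C * w ≤ C * Real.exp 1 * w := by
              nlinarith [mul_le_mul_of_nonneg_left hexp (mul_nonneg hC0 hw)]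
            linarith
          _ = _ := by ring

end Shell

end LocalNet

/-! ### Composition of evolutions -/

/-- The sum of `(5 + n) ^ P e^{-n/8}`. -/
noncomputable def expSum (P : ℕ) : ℝ := ∑' n : ℕ, (5 + (n : ℝ)) ^ P * Real.exp (-(n / 8))

theorem summable_expSum (P : ℕ) :
    Summable fun n : ℕ => (5 + (n : ℝ)) ^ P * Real.exp (-(n / 8)) := by
  have h := (summable_nat_add_iff 5).2
    (Real.summable_pow_mul_exp_neg_nat_mul P (r := 1 / 8) (by norm_num))
  refine (h.mul_left (Real.exp (5 / 8))).congr fun n => ?_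
  rw [mul_left_comm, ← Real.exp_add]
  push_cast
  ring_nf

theorem sum_le_expSum (P n₀ : ℕ) :
    ∑ n ∈ Finset.range n₀, (5 + (n : ℝ)) ^ P * Real.exp (-(n / 8)) ≤ expSum P :=
  (summable_expSum P).sum_le_tsum _ fun _ _ => by positivity

theorem expSum_nonneg (P : ℕ) : 0 ≤ expSum P := tsum_nonneg fun _ => by positivity

namespace LocalNet

variable {Λ 𝒜 : Type*} [Fintype Λ] [DecidableEq Λ] [PseudoMetricSpace Λ] [CStarAlgebra 𝒜]
  {N : LocalNet Λ 𝒜} {ξ K : ℝ} {p : ℕ}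

theorem shellConst_nonneg (hK : 0 ≤ K) : 0 ≤ shellConst p K := by
  unfold shellConst; positivity

variable (B : BlockNet Λ ξ K p) {u v : unitary 𝒜} {σ R : ℝ} {X Y : Finset Λ} {a₀ b₀ : Λ}

include B in
/-- Composition of an evolution with exponential tails outside of the radius `R` with an
arbitrary one. -/
theorem commBound_mul (hK : 0 ≤ K) (hσ : 0 < σ) (hσξ : σ ≤ ξ) (hR : 0 ≤ R) (hRξ : R ≤ ξ)
    (hu : N.BlockBound ξ (unitaryConj u) fun r => 2 * Real.exp (-(r - R) / σ))
    {f : ℝ → ℝ} (hv : N.BlockBound ξ (unitaryConj v) f) (hf : ∀ r, 0 ≤ f r)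
    (hX : X.Nonempty) (hY : Y.Nonempty) (hXa : X ⊆ block a₀ ξ) (hYb : Y ⊆ block b₀ ξ)
    {r F : ℝ} (hXY : Apart r X Y) (hF : 0 ≤ F)
    (hfF : ∀ n : ℕ, f (r - (R + n * σ)) ≤ Real.exp (7 * n / 8) * F) :
    N.CommBound (unitaryConj (v * u)) X Y (2 * shellConst p K * K * expSum (2 * p) * F) := by
  classical
  have hξ : 0 < ξ := hσ.trans_le hσξ
  intro a ha b hb
  obtain ⟨n₀, A, hA, hAn⟩ := exists_shell_decomposition B hK hσ hσξ hR hRξ hX hXa hu ha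
  have hterm : ∀ n : ℕ, ‖unitaryConj v (A n) * b - b * unitaryConj v (A n)‖ ≤
      2 * shellConst p K * K * F * ((5 + (n : ℝ)) ^ (2 * p) * Real.exp (-(n / 8))) *
        (‖a‖ * ‖b‖) := by
    intro n
    set ρ := R + n * σ with hρ
    have hρξ : ρ ≤ (1 + n) * ξ := by
      have : (n : ℝ) * σ ≤ n * ξ := by gcongr
      linarith
    set P : Λ → Finset Λ := fun m => block m ξ ∩ nbhd X ρ with hP
    set I := B.net.filter fun m => (P m).Nonempty with hI
    have hcov : nbhd X ρ ⊆ I.biUnion P := by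
      intro i hi
      obtain ⟨m, hm, hmi⟩ := B.covers i
      have : i ∈ P m := Finset.mem_inter.2 ⟨mem_block.2 hmi, hi⟩
      exact Finset.mem_biUnion.2 ⟨m, Finset.mem_filter.2 ⟨hm, ⟨i, this⟩⟩, this⟩
    have hcb : ∀ m ∈ I, N.CommBound (unitaryConj v) (P m) Y (f (r - ρ)) := by
      intro m hm
      refine hv _ m b₀ _ _ (Finset.mem_filter.1 hm).2 hY Finset.inter_subset_left hYb ?_
      intro i hi j hj
      obtain ⟨x, hx, hxi⟩ := mem_nbhd.1 (Finset.mem_inter.1 hi).2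
      have h1 := hXY x hx j hj
      have h2 := dist_triangle x i j
      linarith
    have hcard : (I.card : ℝ) ≤ K * (4 + n) ^ p := by
      have := B.card_le hξ a₀ (t := 3 + n) (by positivity) (Finset.filter_subset _ _) (I := I) ?_
      · rwa [← add_assoc, show (1 : ℝ) + 3 = 4 by norm_num] at this
      · intro m hm
        obtain ⟨i, hi⟩ := (Finset.mem_filter.1 hm).2
        obtain ⟨hmi, hi⟩ := Finset.mem_inter.1 hi
        obtain ⟨x, hx, hxi⟩ := mem_nbhd.1 hi
        have h1 := mem_block.1 (hXa hx)
        have h2 := mem_block.1 hmi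
        have h3 := dist_triangle4 a₀ x i m
        rw [dist_comm i m] at h3
        linarith
    have h1 := CommBound.biUnion_left (fun m _ => hf _) hcb hcov (A n) (hAn n).1 b hb
    rw [Finset.sum_const, nsmul_eq_mul] at h1
    -- The shell norm `e^{-n}` beats the loss `e^{7n/8}` caused by the shortened distance. The
    -- remaining `e^{-n/8}` absorbs the polynomial number of blocks.
    calc _ ≤ _ := h1
      _ ≤ 2 * (K * (4 + n) ^ p * (Real.exp (7 * n / 8) * F)) *
          ((shellConst p K * (4 + n) ^ p * Real.exp (-n) * ‖a‖) * ‖b‖) := by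
        gcongr
        · exact hf _
        · exact hfF n
        · exact (hAn n).2
      _ = 2 * shellConst p K * K * F * ((4 + (n : ℝ)) ^ (2 * p) * Real.exp (-(n / 8))) *
          (‖a‖ * ‖b‖) := by
        have : Real.exp (-(n / 8 : ℝ)) = Real.exp (7 * n / 8) * Real.exp (-n) := by
          rw [← Real.exp_add]; ring_nf
        rw [this]; ring
      _ ≤ _ := by
        have := shellConst_nonneg (p := p) hK
        gcongr
        norm_num
  have h0 : unitaryConj (v * u) a * b - b * unitaryConj (v * u) a =
      ∑ n ∈ Finset.range n₀, (unitaryConj v (A n) * b - b * unitaryConj v (A n)) := by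
    rw [unitaryConj_mul_left, hA, unitaryConj_sum, Finset.sum_mul, Finset.mul_sum,
      Finset.sum_sub_distrib]
  rw [h0]
  refine (norm_sum_le _ _).trans ((Finset.sum_le_sum fun n _ => hterm n).trans ?_)
  rw [← Finset.sum_mul, ← Finset.mul_sum]
  have := shellConst_nonneg (p := p) hK
  have h2 := sum_le_expSum (2 * p) n₀
  calc _ ≤ 2 * shellConst p K * K * F * expSum (2 * p) * (‖a‖ * ‖b‖) := by gcongr
    _ = _ := by ring

/-! ### Commutators with an interaction, split into blocks -/

open Classical in
/-- The total norm of the interaction terms which couple `W` to the block of center `m`. -/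
noncomputable def coupling (ξ : ℝ) (h : Finset Λ → 𝒜) (W : Finset Λ) (m : Λ) : ℝ :=
  ∑ Z : Finset Λ with ¬ Disjoint Z W ∧ ((Z ∪ W) ∩ block m ξ).Nonempty, ‖h Z‖

theorem coupling_nonneg (ξ : ℝ) (h : Finset Λ → 𝒜) (W : Finset Λ) (m : Λ) :
    0 ≤ coupling ξ h W m := by
  unfold coupling; positivity

-- Only terms meeting `W` fail to commute with `x`. For these the commutator lives on `Z ∪ W`, which
-- may be huge, so it is cut into blocks; exchanging the sums over `Z` and over blocks produces
-- `coupling`. The 4 is a 2 from the norm of the commutator times a 2 from the cutting.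
include B in
theorem norm_interaction_commutator_le {h : Finset Λ → 𝒜} (hh : ∀ Z, h Z ∈ N.alg Z)
    {W : Finset Λ} {x b : 𝒜} (hx : x ∈ N.alg W) (hb : b ∈ N.alg Y) {g : Λ → ℝ}
    (hg0 : ∀ m ∈ B.net, 0 ≤ g m)
    (hg : ∀ m ∈ B.net, ∀ Z, h Z ≠ 0 → ¬ Disjoint Z W → ((Z ∪ W) ∩ block m ξ).Nonempty →
      N.CommBound (unitaryConj v) ((Z ∪ W) ∩ block m ξ) Y (g m)) :
    ‖unitaryConj v ((∑ Z, h Z) * x - x * ∑ Z, h Z) * b -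
        b * unitaryConj v ((∑ Z, h Z) * x - x * ∑ Z, h Z)‖ ≤
      4 * (‖x‖ * ‖b‖) * ∑ m ∈ B.net, coupling ξ h W m * g m := by
  classical
  have hterm : ∀ Z : Finset Λ, ‖unitaryConj v (h Z * x - x * h Z) * b -
        b * unitaryConj v (h Z * x - x * h Z)‖ ≤
      ∑ m ∈ B.net, 4 * (‖x‖ * ‖b‖) *
        ((if ¬ Disjoint Z W ∧ ((Z ∪ W) ∩ block m ξ).Nonempty then ‖h Z‖ else 0) * g m) := by
    intro Z
    have hnn : 0 ≤ ∑ m ∈ B.net, 4 * (‖x‖ * ‖b‖) *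
        ((if ¬ Disjoint Z W ∧ ((Z ∪ W) ∩ block m ξ).Nonempty then ‖h Z‖ else 0) * g m) := by
      refine Finset.sum_nonneg fun m hm => ?_
      have := hg0 m hm
      split_ifs <;> positivity
    by_cases hd : Disjoint Z W
    · rw [N.comm hd (hh Z) hx, sub_self]
      simpa [unitaryConj] using hnn
    by_cases hz : h Z = 0
    · rw [hz]
      simp [unitaryConj]
    set P : Λ → Finset Λ := fun m => (Z ∪ W) ∩ block m ξ with hP
    set I := B.net.filter fun m => (P m).Nonempty with hI
    have hcov : Z ∪ W ⊆ I.biUnion P := by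
      intro i hi
      obtain ⟨m, hm, hmi⟩ := B.covers i
      have : i ∈ P m := Finset.mem_inter.2 ⟨hi, mem_block.2 hmi⟩
      exact Finset.mem_biUnion.2 ⟨m, Finset.mem_filter.2 ⟨hm, ⟨i, this⟩⟩, this⟩
    have hmem : h Z * x - x * h Z ∈ N.alg (Z ∪ W) := by
      have h1 := N.mono Finset.subset_union_left (hh Z) (Y := Z ∪ W)
      have h2 := N.mono Finset.subset_union_right hx (Y := Z ∪ W)
      exact Subalgebra.sub_mem _ (Subalgebra.mul_mem _ h1 h2) (Subalgebra.mul_mem _ h2 h1)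
    have hIg : ∀ m ∈ I, 0 ≤ g m := fun m hm => hg0 m (Finset.mem_filter.1 hm).1
    have h1 := CommBound.biUnion_left hIg
      (fun m hm => hg m (Finset.mem_filter.1 hm).1 Z hz hd (Finset.mem_filter.1 hm).2) hcov
      _ hmem b hb
    have hs : 0 ≤ ∑ m ∈ I, g m := Finset.sum_nonneg hIg
    refine h1.trans ?_
    calc 2 * (∑ m ∈ I, g m) * (‖h Z * x - x * h Z‖ * ‖b‖)
        ≤ 2 * (∑ m ∈ I, g m) * (2 * (‖h Z‖ * ‖x‖) * ‖b‖) := by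
          gcongr
          exact norm_commutator_le _ _
      _ = ∑ m ∈ I, 4 * (‖x‖ * ‖b‖) * (‖h Z‖ * g m) := by
          rw [← Finset.mul_sum, ← Finset.mul_sum]; ring
      _ = _ := by
          rw [hI, Finset.sum_filter]
          refine Finset.sum_congr rfl fun m _ => ?_
          simp [hd, hP]
  have h0 : (∑ Z, h Z) * x - x * ∑ Z, h Z = ∑ Z, (h Z * x - x * h Z) := by
    rw [Finset.sum_mul, Finset.mul_sum, Finset.sum_sub_distrib]
  rw [h0, unitaryConj_sum, Finset.sum_mul, Finset.mul_sum, ← Finset.sum_sub_distrib]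
  refine (norm_sum_le _ _).trans ((Finset.sum_le_sum fun Z _ => hterm Z).trans ?_)
  rw [Finset.sum_comm, Finset.mul_sum]
  refine Finset.sum_le_sum fun m _ => ?_
  rw [← Finset.mul_sum, ← Finset.sum_mul, coupling, Finset.sum_filter]

end LocalNet

/-! ### One-parameter unitary groups and Duhamel's formula -/

section Flow

variable {𝒜 : Type*} [CStarAlgebra 𝒜]

/-- The one-parameter unitary group `s ↦ e^{isH}`. -/
noncomputable def flow (H : selfAdjoint 𝒜) (s : ℝ) : unitary 𝒜 := selfAdjoint.expUnitary (s • H)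

theorem flow_zero (H : selfAdjoint 𝒜) : flow H 0 = 1 := by simp [flow]

theorem flow_add (H : selfAdjoint 𝒜) (s t : ℝ) : flow H (s + t) = flow H s * flow H t := by
  rw [flow, add_smul]
  exact Commute.expUnitary_add
    (((Commute.refl (H : 𝒜)).smul_left s).smul_right t)

theorem star_flow (H : selfAdjoint 𝒜) (s : ℝ) : star (flow H s) = flow H (-s) := by
  have h : flow H s * flow H (-s) = 1 := by rw [← flow_add, add_neg_cancel, flow_zero]
  calc star (flow H s) = star (flow H s) * (flow H s * flow H (-s)) := by rw [h, mul_one]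
    _ = flow H (-s) := by rw [← mul_assoc, Unitary.star_mul_self, one_mul]

theorem flow_neg_left (H : selfAdjoint 𝒜) (s : ℝ) : flow (-H) s = flow H (-s) := by
  simp [flow]

theorem flow_smul_left (H : selfAdjoint 𝒜) (c s : ℝ) : flow (c • H) s = flow H (s * c) := by
  simp [flow, smul_smul]

theorem coe_flow (H : selfAdjoint 𝒜) (s : ℝ) :
    (flow H s : 𝒜) = NormedSpace.exp ((Complex.I * s) • (H : 𝒜)) := by
  rw [flow, selfAdjoint.expUnitary_coe, selfAdjoint.val_smul, mul_smul, Complex.coe_smul]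

theorem hasDerivAt_flow (H : selfAdjoint 𝒜) (s : ℝ) :
    HasDerivAt (fun τ => (flow H τ : 𝒜)) (flow H s * (Complex.I • (H : 𝒜))) s := by
  have h := (hasDerivAt_exp_smul_const (𝕂 := ℂ) (Complex.I • (H : 𝒜)) (s : ℂ)).scomp s
    (Complex.ofRealCLM.hasDerivAt (x := s))
  simpa [Function.comp_def, smul_smul, mul_comm, coe_flow] using h

theorem hasDerivAt_flow' (H : selfAdjoint 𝒜) (s : ℝ) :
    HasDerivAt (fun τ => (flow H τ : 𝒜)) ((Complex.I • (H : 𝒜)) * flow H s) s := by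
  have h := (hasDerivAt_exp_smul_const' (𝕂 := ℂ) (Complex.I • (H : 𝒜)) (s : ℂ)).scomp s
    (Complex.ofRealCLM.hasDerivAt (x := s))
  simpa [Function.comp_def, smul_smul, mul_comm, coe_flow] using h

/-- Each flow commutes with its own generator, so differentiating the interpolation from the
`H₀`-evolution to the `H₁`-evolution leaves only the commutator with `H₁ - H₀`. -/
theorem hasDerivAt_interpolation (H₀ H₁ : selfAdjoint 𝒜) (s u : ℝ) (a : 𝒜) :
    HasDerivAt (fun τ => unitaryConj (flow H₁ τ) (unitaryConj (flow H₀ (s - τ)) a))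
      (Complex.I • unitaryConj (flow H₁ u)
        (((H₁ - H₀ : selfAdjoint 𝒜) : 𝒜) * unitaryConj (flow H₀ (s - u)) a -
          unitaryConj (flow H₀ (s - u)) a * ((H₁ - H₀ : selfAdjoint 𝒜) : 𝒜))) u := by
  have hQ : HasDerivAt (fun τ => (flow H₀ (s - τ) : 𝒜))
      (-((Complex.I • (H₀ : 𝒜)) * flow H₀ (s - u))) u := by
    have h := (hasDerivAt_flow' H₀ (s - u)).scomp u ((hasDerivAt_id u).const_sub s)
    simpa [Function.comp_def] using h
  have hW := (hasDerivAt_flow H₁ u).mul hQ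
  have hF := (hW.mul_const a).mul hW.star
  have e : (fun τ => unitaryConj (flow H₁ τ) (unitaryConj (flow H₀ (s - τ)) a)) =
      ((fun y => ((fun τ => (flow H₁ τ : 𝒜)) * fun τ => (flow H₀ (s - τ) : 𝒜)) y * a) *
        fun x => star (((fun τ => (flow H₁ τ : 𝒜)) * fun τ => (flow H₀ (s - τ) : 𝒜)) x)) := by
    funext τ
    simp [unitaryConj, mul_assoc]
  rw [e]
  refine hF.congr_deriv ?_
  have h0 : star (H₀ : 𝒜) = H₀ := H₀.2
  have h1 : star (H₁ : 𝒜) = H₁ := H₁.2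
  simp only [unitaryConj, Pi.mul_apply, star_add, star_mul, star_neg, star_smul, h0, h1,
    Complex.star_def, Complex.conj_I, AddSubgroupClass.coe_sub]
  generalize (flow H₁ u : 𝒜) = P
  generalize (flow H₀ (s - u) : 𝒜) = Q
  generalize (H₀ : 𝒜) = A
  generalize (H₁ : 𝒜) = B
  simp only [mul_smul_comm, smul_mul_assoc, neg_smul, mul_neg, neg_mul, add_mul, mul_add, sub_mul,
    mul_sub, smul_sub, mul_assoc, neg_neg]
  abel

/-- Duhamel's formula for commutators. -/
theorem norm_flow_commutator_le (H₀ H₁ : selfAdjoint 𝒜) {s : ℝ} (hs : 0 ≤ s) (a b : 𝒜) {M : ℝ}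
    (hM : ∀ u ∈ Set.Icc 0 s, ‖unitaryConj (flow H₁ u)
        (((H₁ - H₀ : selfAdjoint 𝒜) : 𝒜) * unitaryConj (flow H₀ (s - u)) a -
          unitaryConj (flow H₀ (s - u)) a * ((H₁ - H₀ : selfAdjoint 𝒜) : 𝒜)) * b -
        b * unitaryConj (flow H₁ u)
        (((H₁ - H₀ : selfAdjoint 𝒜) : 𝒜) * unitaryConj (flow H₀ (s - u)) a -
          unitaryConj (flow H₀ (s - u)) a * ((H₁ - H₀ : selfAdjoint 𝒜) : 𝒜))‖ ≤ M) :
    ‖unitaryConj (flow H₁ s) a * b - b * unitaryConj (flow H₁ s) a‖ ≤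
      ‖unitaryConj (flow H₀ s) a * b - b * unitaryConj (flow H₀ s) a‖ + s * M := by
  have hd : ∀ u : ℝ, HasDerivAt
      (fun τ => unitaryConj (flow H₁ τ) (unitaryConj (flow H₀ (s - τ)) a) * b -
        b * unitaryConj (flow H₁ τ) (unitaryConj (flow H₀ (s - τ)) a)) _ u := fun u =>
    ((hasDerivAt_interpolation H₀ H₁ s u a).mul_const b).sub
      ((hasDerivAt_interpolation H₀ H₁ s u a).const_mul b)
  have h := norm_image_sub_le_of_norm_deriv_le_segment' (C := M)
    (fun u _ => (hd u).hasDerivWithinAt (s := Set.Icc 0 s)) (fun u hu => by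
      rw [smul_mul_assoc, mul_smul_comm, ← smul_sub, norm_smul, Complex.norm_I, one_mul]
      exact hM u (Set.Ico_subset_Icc_self hu)) s ⟨hs, le_rfl⟩
  simp only [sub_self, sub_zero, flow_zero, unitaryConj_one] at h
  have h2 := norm_sub_norm_le (unitaryConj (flow H₁ s) a * b - b * unitaryConj (flow H₁ s) a)
    (unitaryConj (flow H₀ s) a * b - b * unitaryConj (flow H₀ s) a)
  linarith

end Flow

/-! ### Self-improving bounds and perturbation of evolutions -/

/-- The map `M ↦ k + M / 2` contracts towards `2 * k`: after `n` steps the prefactor is `2 * k + (M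
- 2 * k) / 2 ^ n`. The hypothesis `hcl` passes to the limit. -/
theorem bootstrap {P : ℝ → Prop} {k : ℝ} (hk : 0 ≤ k) (hex : ∃ M, 2 * k ≤ M ∧ P M)
    (hstep : ∀ M, 0 ≤ M → P M → P (k + M / 2))
    (hcl : ∀ x, (∀ n : ℕ, P (2 * k + x / 2 ^ n)) → P (2 * k)) : P (2 * k) := by
  obtain ⟨M, hM, hPM⟩ := hex
  refine hcl (M - 2 * k) fun n => ?_
  induction n with
  | zero => simpa using hPM
  | succ n ih =>
    have h1 : 0 ≤ (M - 2 * k) / 2 ^ n := div_nonneg (by linarith) (by positivity)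
    have := hstep _ (by linarith) ih
    convert this using 1
    rw [pow_succ]; field_simp; ring

theorem le_of_forall_add_div_pow {x y c d : ℝ} (h : ∀ n : ℕ, x ≤ (c + d / 2 ^ n) * y) :
    x ≤ c * y := by
  have h1 : Filter.Tendsto (fun n : ℕ => (c + d / 2 ^ n) * y) Filter.atTop (nhds ((c + 0) * y)) := by
    refine (tendsto_const_nhds.add ?_).mul_const y
    have := (tendsto_inv_atTop_zero.comp
      (tendsto_pow_atTop_atTop_of_one_lt (one_lt_two (α := ℝ)))).const_mul d
    simpa [div_eq_mul_inv, Function.comp_def] using this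
  rw [add_zero] at h1
  exact ge_of_tendsto' h1 h

theorem sum_biUnion_le_sum {ι κ : Type*} [DecidableEq κ] (s : Finset ι) (t : ι → Finset κ)
    {f : κ → ℝ} (hf : ∀ x, 0 ≤ f x) : ∑ x ∈ s.biUnion t, f x ≤ ∑ i ∈ s, ∑ x ∈ t i, f x := by
  classical
  induction s using Finset.induction_on with
  | empty => simp
  | insert i s hi ih =>
    rw [Finset.biUnion_insert, Finset.sum_insert hi]
    have h1 := Finset.sum_union_inter (s₁ := t i) (s₂ := s.biUnion t) (f := f)
    have h2 : 0 ≤ ∑ x ∈ t i ∩ s.biUnion t, f x := Finset.sum_nonneg fun x _ => hf x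
    linarith

namespace LocalNet

variable {Λ 𝒜 : Type*} [Fintype Λ] [DecidableEq Λ] [PseudoMetricSpace Λ] [CStarAlgebra 𝒜]
  {N : LocalNet Λ 𝒜} {ξ K : ℝ} {p : ℕ} (B : BlockNet Λ ξ K p) {σ : ℝ} {X Y : Finset Λ} {a₀ : Λ}

include B in
/-- Duhamel's formula, with the unperturbed evolution split into shells and the commutators with
the perturbation `∑ Z, V Z` split into blocks. -/
theorem commBound_perturb (hK : 0 ≤ K) (hσ : 0 < σ) (hσξ : σ ≤ ξ) {H₀ H₁ : selfAdjoint 𝒜}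
    {V : Finset Λ → 𝒜} (hV : ∀ Z, V Z ∈ N.alg Z)
    (hVH : ((H₁ - H₀ : selfAdjoint 𝒜) : 𝒜) = ∑ Z, V Z) {s c G : ℝ} (hs : 0 ≤ s) (hG : 0 ≤ G)
    (hX : X.Nonempty) (hXa : X ⊆ block a₀ ξ)
    (hc : N.CommBound (unitaryConj (flow H₀ s)) X Y c) (P : ℕ)
    (hu : ∀ u ∈ Set.Icc 0 s, ∃ R, 0 ≤ R ∧ R ≤ ξ ∧
      N.BlockBound ξ (unitaryConj (flow H₀ (s - u))) (fun r => 2 * Real.exp (-(r - R) / σ)) ∧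
      ∀ n : ℕ, ∃ g : Λ → ℝ, (∀ m ∈ B.net, 0 ≤ g m) ∧
        (∀ m ∈ B.net, ∀ Z, V Z ≠ 0 → ¬ Disjoint Z (nbhd X (R + n * σ)) →
          ((Z ∪ nbhd X (R + n * σ)) ∩ block m ξ).Nonempty →
          N.CommBound (unitaryConj (flow H₁ u)) ((Z ∪ nbhd X (R + n * σ)) ∩ block m ξ) Y (g m)) ∧
        ∑ m ∈ B.net, coupling ξ V (nbhd X (R + n * σ)) m * g m ≤
          G * ((5 + n) ^ P * Real.exp (7 * n / 8))) :
    N.CommBound (unitaryConj (flow H₁ s)) X Y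
      (c + s * (4 * shellConst p K * G * expSum (p + P))) := by
  intro a ha b hb
  have hC := shellConst_nonneg (p := p) hK
  have h := norm_flow_commutator_le H₀ H₁ hs a b
    (M := 4 * shellConst p K * G * expSum (p + P) * (‖a‖ * ‖b‖)) fun u hus => by
      obtain ⟨R, hR, hRξ, hBB, hn⟩ := hu u hus
      obtain ⟨n₀, A, hA, hAn⟩ := exists_shell_decomposition B hK hσ hσξ hR hRξ hX hXa hBB ha
      rw [hVH, hA]
      have hterm : ∀ n : ℕ, ‖unitaryConj (flow H₁ u) ((∑ Z, V Z) * A n - A n * ∑ Z, V Z) * b -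
          b * unitaryConj (flow H₁ u) ((∑ Z, V Z) * A n - A n * ∑ Z, V Z)‖ ≤
          4 * shellConst p K * G * ((5 + (n : ℝ)) ^ (p + P) * Real.exp (-(n / 8))) *
            (‖a‖ * ‖b‖) := by
        intro n
        obtain ⟨g, hg0, hg, hsum⟩ := hn n
        refine (norm_interaction_commutator_le B hV (hAn n).1 hb hg0 hg).trans ?_
        calc _ ≤ 4 * ((shellConst p K * (4 + n) ^ p * Real.exp (-n) * ‖a‖) * ‖b‖) *
              (G * ((5 + n) ^ P * Real.exp (7 * n / 8))) := by
              gcongr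
              · exact Finset.sum_nonneg fun m hm =>
                  mul_nonneg (coupling_nonneg _ _ _ _) (hg0 m hm)
              · exact (hAn n).2
          _ ≤ 4 * ((shellConst p K * (5 + n) ^ p * Real.exp (-n) * ‖a‖) * ‖b‖) *
              (G * ((5 + n) ^ P * Real.exp (7 * n / 8))) := by
              gcongr
              norm_num
          _ = _ := by
              have : Real.exp (-(n / 8 : ℝ)) = Real.exp (7 * n / 8) * Real.exp (-n) := by
                rw [← Real.exp_add]; ring_nf
              rw [this, pow_add]; ring
      have h0 : unitaryConj (flow H₁ u) ((∑ Z, V Z) * (∑ n ∈ Finset.range n₀, A n) -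
            (∑ n ∈ Finset.range n₀, A n) * ∑ Z, V Z) * b -
          b * unitaryConj (flow H₁ u) ((∑ Z, V Z) * (∑ n ∈ Finset.range n₀, A n) -
            (∑ n ∈ Finset.range n₀, A n) * ∑ Z, V Z) = ∑ n ∈ Finset.range n₀,
          (unitaryConj (flow H₁ u) ((∑ Z, V Z) * A n - A n * ∑ Z, V Z) * b -
            b * unitaryConj (flow H₁ u) ((∑ Z, V Z) * A n - A n * ∑ Z, V Z)) := by
        rw [Finset.mul_sum, Finset.sum_mul, ← Finset.sum_sub_distrib, unitaryConj_sum,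
          Finset.sum_mul, Finset.mul_sum, Finset.sum_sub_distrib]
      rw [h0]
      refine (norm_sum_le _ _).trans ((Finset.sum_le_sum fun n _ => hterm n).trans ?_)
      rw [← Finset.sum_mul, ← Finset.mul_sum]
      have h2 := sum_le_expSum (p + P) n₀
      gcongr
  refine h.trans ((add_le_add_left (hc a ha b hb) _).trans (le_of_eq ?_))
  ring

open Classical in
theorem coupling_le_card_mul (h : Finset Λ → 𝒜) (W : Finset Λ) (m : Λ) {β : ℝ}
    (hβ : ∀ i, ∑ Z : Finset Λ with i ∈ Z, ‖h Z‖ ≤ β) : coupling ξ h W m ≤ W.card * β := by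
  calc coupling ξ h W m ≤ ∑ Z ∈ W.biUnion fun i => Finset.univ.filter fun Z => i ∈ Z, ‖h Z‖ := by
        refine Finset.sum_le_sum_of_subset_of_nonneg ?_ fun _ _ _ => norm_nonneg _
        intro Z hZ
        obtain ⟨i, hiZ, hiW⟩ := Finset.not_disjoint_iff.1 (Finset.mem_filter.1 hZ).2.1
        exact Finset.mem_biUnion.2 ⟨i, hiW, by simpa using hiZ⟩
    _ ≤ ∑ i ∈ W, ∑ Z : Finset Λ with i ∈ Z, ‖h Z‖ := by
        exact sum_biUnion_le_sum W _ fun _ => norm_nonneg _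
    _ ≤ ∑ i ∈ W, β := Finset.sum_le_sum fun i _ => hβ i
    _ = _ := by simp

end LocalNet

theorem exp_div_mono {x σ σ' : ℝ} (hσ : 0 < σ) (hσ' : σ ≤ σ') (hx : 0 ≤ x) :
    Real.exp (-x / σ) ≤ Real.exp (-x / σ') := by
  rw [Real.exp_le_exp, neg_div, neg_div, neg_le_neg_iff]
  gcongr

namespace LocalNet

variable {Λ 𝒜 : Type*} [Fintype Λ] [DecidableEq Λ] [PseudoMetricSpace Λ] [CStarAlgebra 𝒜]
  {N : LocalNet Λ 𝒜} {ξ K : ℝ} {p : ℕ}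

theorem BlockBound.mono {T : 𝒜 → 𝒜} {f g : ℝ → ℝ} (h : N.BlockBound ξ T f)
    (hfg : ∀ r, f r ≤ g r) : N.BlockBound ξ T g := fun r a b X Y hX hY hXa hYb hXY =>
  (h r a b X Y hX hY hXa hYb hXY).weaken subset_rfl subset_rfl (hfg r)

/-- For `r < R'` the exponentials need not compare, but there the new bound exceeds the trivial one;
this is why `2 ≤ c` is needed. -/
theorem BlockBound.exp_mono {u : unitary 𝒜} {c σ σ' R R' : ℝ} (hc : 2 ≤ c) (hσ : 0 < σ)
    (hσ' : σ ≤ σ') (hR : R ≤ R')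
    (h : N.BlockBound ξ (unitaryConj u) fun r => c * Real.exp (-(r - R) / σ)) :
    N.BlockBound ξ (unitaryConj u) fun r => c * Real.exp (-(r - R') / σ') := by
  intro r a b X Y hX hY hXa hYb hXY
  have hσ'0 : 0 < σ' := hσ.trans_le hσ'
  by_cases hr : R' ≤ r
  · refine (h r a b X Y hX hY hXa hYb hXY).weaken subset_rfl subset_rfl ?_
    have h1 : Real.exp (-(r - R) / σ) ≤ Real.exp (-(r - R') / σ) := by gcongr
    have h2 := exp_div_mono hσ hσ' (sub_nonneg.2 hr)
    exact mul_le_mul_of_nonneg_left (h1.trans h2) (by linarith)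
  · refine (commBound_two u X Y).weaken subset_rfl subset_rfl ?_
    have : 1 ≤ Real.exp (-(r - R') / σ') := Real.one_le_exp (div_nonneg (by linarith) hσ'0.le)
    nlinarith

/-- Starting point of the bootstrap: distances are bounded, hence `φ` is bounded below at all
distances that occur, and a large prefactor makes the trivial bound sufficient. -/
theorem exists_forall_blockBound (ξ : ℝ) (u : ℝ → unitary 𝒜) {φ : ℝ → ℝ → ℝ} {S : Set ℝ}
    (hφ : ∀ s ∈ S, Antitone (φ s)) (hφ0 : ∀ M : ℝ, ∃ ε, 0 < ε ∧ ∀ s ∈ S, ε ≤ φ s M) (k : ℝ) :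
    ∃ M, k ≤ M ∧ ∀ s ∈ S, N.BlockBound ξ (unitaryConj (u s)) fun r => M * φ s r := by
  obtain ⟨d, -, hd⟩ := exists_dist_le Λ
  obtain ⟨ε, hε, hφε⟩ := hφ0 d
  refine ⟨max k (2 / ε), le_max_left _ _, fun s hs r a b X Y hX hY _ _ hXY => ?_⟩
  refine (commBound_two (u s) X Y).weaken subset_rfl subset_rfl ?_
  obtain ⟨x, hx⟩ := hX
  obtain ⟨y, hy⟩ := hY
  have h1 : ε ≤ φ s r := (hφε s hs).trans (hφ s hs ((hXY x hx y hy).trans (hd x y)))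
  calc (2 : ℝ) = 2 / ε * ε := by field_simp
    _ ≤ max k (2 / ε) * φ s r := by gcongr; exact le_max_right _ _

/-- A bound with an arbitrary prefactor which can be improved by halving the prefactor, up to a
constant. -/
theorem blockBound_bootstrap (ξ : ℝ) (u : ℝ → unitary 𝒜) {φ : ℝ → ℝ → ℝ} {S : Set ℝ} {k : ℝ}
    (hk : 0 ≤ k)
    (hφ : ∀ s ∈ S, Antitone (φ s)) (hφ0 : ∀ M : ℝ, ∃ ε, 0 < ε ∧ ∀ s ∈ S, ε ≤ φ s M)
    (hstep : ∀ M, 0 ≤ M → (∀ s ∈ S, N.BlockBound ξ (unitaryConj (u s)) fun r => M * φ s r) →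
      ∀ s ∈ S, N.BlockBound ξ (unitaryConj (u s)) fun r => (k + M / 2) * φ s r) :
    ∀ s ∈ S, N.BlockBound ξ (unitaryConj (u s)) fun r => (2 * k) * φ s r := by
  refine bootstrap (P := fun M => ∀ s ∈ S, N.BlockBound ξ (unitaryConj (u s)) fun r => M * φ s r)
    hk (exists_forall_blockBound ξ u hφ hφ0 _) hstep ?_
  intro x hx s hs r a b X Y hX hY hXa hYb hXY o ho o' ho'
  rw [mul_assoc]
  refine le_of_forall_add_div_pow (d := x) fun n => ?_
  rw [← mul_assoc]
  exact hx n s hs r a b X Y hX hY hXa hYb hXY o ho o' ho'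

variable (B : BlockNet Λ ξ K p) {σ : ℝ}

-- The perturbation has reach `σ`, strength `β` per site, and total effect at most `1/2` over the
-- time `T`, so the bootstrap closes. The range must grow from `σ` to `σ' ≥ 8σ/7`: shell `n` brings
-- the operator closer by `n σ`, which costs `e^{nσ/σ'} ≤ e^{7n/8}` and is still beaten by the shell
-- norm `e^{-n}`.
include B in
theorem blockBound_perturb_exp (hK : 0 ≤ K) (hσ : 0 < σ) (hσξ : σ ≤ ξ) (hξ : 1 ≤ ξ) {γ : ℝ}
    {D : ℕ} (hcard : ∀ (i : Λ) (r : ℝ), 1 ≤ r → ((block i r).card : ℝ) ≤ γ * (2 * r) ^ D)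
    {H₀ H₁ : selfAdjoint 𝒜} {V : Finset Λ → 𝒜} (hV : ∀ Z, V Z ∈ N.alg Z)
    (hVH : ((H₁ - H₀ : selfAdjoint 𝒜) : 𝒜) = ∑ Z, V Z)
    (hVσ : ∀ Z, V Z ≠ 0 → ∀ i ∈ Z, ∀ j ∈ Z, dist i j ≤ σ) {β : ℝ}
    (hβ : ∀ (i : Λ), (open Classical in ∑ Z : Finset Λ with i ∈ Z, ‖V Z‖) ≤ β)
    {σ' v w y T : ℝ} (hσ' : σ ≤ 7 / 8 * σ') (hv : 0 ≤ v) (hw : 0 ≤ w) (hwy : w ≤ y * σ)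
    (hvT : v * T + w ≤ ξ)
    (h₀ : ∀ s ∈ Set.Icc 0 T, N.BlockBound ξ (unitaryConj (flow H₀ s))
      fun r => 2 * Real.exp (-(r - (v * s + w)) / σ))
    (hT : T * (4 * shellConst p K * (K * (γ * (2 * ξ) ^ D * β) * Real.exp (1 + y)) *
      expSum (p + (p + D))) ≤ 1 / 2) :
    ∀ s ∈ Set.Icc 0 T, N.BlockBound ξ (unitaryConj (flow H₁ s))
      fun r => (2 * 2) * Real.exp (-(r - (v * s + w)) / σ') := by
  classical
  have hσ'0 : 0 < σ' := by linarith
  have hσσ' : σ ≤ σ' := by linarith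
  have hξ0 : 0 < ξ := by linarith
  have hy : 0 ≤ y := by
    by_contra hlt
    nlinarith
  refine blockBound_bootstrap ξ (flow H₁) zero_le_two
    (φ := fun s r => Real.exp (-(r - (v * s + w)) / σ')) ?_ ?_ ?_
  · intro s _ r r' hrr
    dsimp only
    gcongr
  · intro M
    refine ⟨Real.exp (-M / σ'), Real.exp_pos _, fun s hs => ?_⟩
    have : 0 ≤ v * s := mul_nonneg hv hs.1
    gcongr
    linarith
  intro M hM hMb s hs r a b X Y hX hY hXa hYb hXY
  set φ := Real.exp (-(r - (v * s + w)) / σ') with hφ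
  have hβ0 : 0 ≤ β := by
    obtain ⟨x, -⟩ := hX
    exact le_trans (Finset.sum_nonneg fun _ _ => norm_nonneg _) (hβ x)
  have hγ0 : 0 ≤ γ := by
    have h1 := (Nat.cast_nonneg _).trans (hcard a 1 le_rfl)
    have h2 : (0 : ℝ) < (2 * 1) ^ D := by positivity
    exact nonneg_of_mul_nonneg_left h1 h2
  have hc : N.CommBound (unitaryConj (flow H₀ s)) X Y (2 * φ) :=
    (h₀ s hs).exp_mono le_rfl hσ hσσ' le_rfl r a b X Y hX hY hXa hYb hXY
  set G := K * (γ * (2 * ξ) ^ D * β) * Real.exp (1 + y) * (M * φ) with hG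
  have hG0 : 0 ≤ G := by positivity
  have key := commBound_perturb B hK hσ hσξ hV hVH hs.1 hG0 hX hXa hc (p + D) (fun u hu => by
    have hu1 : u ≤ T := hu.2.trans hs.2
    refine ⟨v * (s - u) + w, by have := mul_nonneg hv (sub_nonneg.2 hu.2); linarith, ?_,
      h₀ (s - u) ⟨sub_nonneg.2 hu.2, by linarith [hu.1, hs.2]⟩, fun n => ?_⟩
    · have : v * (s - u) ≤ v * T := by gcongr; linarith [hu.1, hs.2]
      linarith
    set R := v * (s - u) + w with hR
    have hRξ : R ≤ ξ := by
      have : v * (s - u) ≤ v * T := by gcongr; linarith [hu.1, hs.2]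
      linarith
    set W := nbhd X (R + n * σ) with hW
    set r' := r - (R + n * σ) - σ with hr'
    have hnσ : (n : ℝ) * σ ≤ n * ξ := by gcongr
    have hdist : ∀ Z, V Z ≠ 0 → ¬ Disjoint Z W → ∀ i ∈ Z ∪ W, ∃ x ∈ X,
        dist x i ≤ R + n * σ + σ := by
      intro Z hZ hZW i hi
      rcases Finset.mem_union.1 hi with hi | hi
      · obtain ⟨z, hz, hzW⟩ := Finset.not_disjoint_iff.1 hZW
        obtain ⟨x, hx, hxz⟩ := mem_nbhd.1 hzW
        exact ⟨x, hx, (dist_triangle x z i).trans (add_le_add hxz (hVσ Z hZ z hz i hi))⟩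
      · obtain ⟨x, hx, hxi⟩ := mem_nbhd.1 hi
        exact ⟨x, hx, by linarith⟩
    refine ⟨fun _ => M * Real.exp (-(r' - (v * u + w)) / σ'), fun m _ => by positivity, ?_, ?_⟩
    · intro m _ Z hZ hZW hne
      refine hMb u ⟨hu.1, hu1⟩ r' m b _ Y hne hY Finset.inter_subset_right hYb ?_
      intro i hi j hj
      obtain ⟨x, hx, hxi⟩ := hdist Z hZ hZW i (Finset.mem_inter.1 hi).1
      have h1 := hXY x hx j hj
      have h2 := dist_triangle x i j
      linarith
    · have hWcard : (W.card : ℝ) ≤ γ * (2 * ξ) ^ D * (5 + n) ^ D := by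
        have h1 : W ⊆ block a ((2 + n) * ξ) := by
          intro i hi
          obtain ⟨x, hx, hxi⟩ := mem_nbhd.1 hi
          have h2 := mem_block.1 (hXa hx)
          have h3 := dist_triangle a x i
          exact mem_block.2 (by linarith)
        calc (W.card : ℝ) ≤ (block a ((2 + n) * ξ)).card := by
              exact_mod_cast Finset.card_le_card h1
          _ ≤ γ * (2 * ((2 + n) * ξ)) ^ D := hcard _ _ (by nlinarith)
          _ = γ * (2 * ξ) ^ D * (2 + n) ^ D := by rw [mul_assoc γ, ← mul_pow]; ring
          _ ≤ _ := by gcongr; norm_num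
      set I := B.net.filter fun m => coupling ξ V W m ≠ 0 with hI
      have hIcard : (I.card : ℝ) ≤ K * (5 + n) ^ p := by
        have := B.card_le hξ0 a (t := 4 + n) (by positivity) (Finset.filter_subset _ _) (I := I) ?_
        · rwa [← add_assoc, show (1 : ℝ) + 4 = 5 by norm_num] at this
        · intro m hm
          obtain ⟨Z, hZ, hZ0⟩ := Finset.exists_ne_zero_of_sum_ne_zero (Finset.mem_filter.1 hm).2
          obtain ⟨hZW, i, hi⟩ := (Finset.mem_filter.1 hZ).2
          obtain ⟨hi, him⟩ := Finset.mem_inter.1 hi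
          obtain ⟨x, hx, hxi⟩ := hdist Z (norm_ne_zero_iff.1 hZ0) hZW i hi
          have h1 := mem_block.1 (hXa hx)
          have h2 := mem_block.1 him
          have h3 := dist_triangle4 a x i m
          rw [dist_comm i m] at h3
          linarith
      have hexp : Real.exp (-(r' - (v * u + w)) / σ') ≤
          φ * Real.exp (1 + y) * Real.exp (7 * n / 8) := by
        rw [hφ, ← Real.exp_add, ← Real.exp_add, Real.exp_le_exp]
        -- Cutting the evolution at time `u` uses the offset `w` once for each piece. The surplus
        -- `w` costs `e^y`, and the reach `σ` of the perturbation at most `e`.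
        have e1 : -(r' - (v * u + w)) / σ' = -(r - (v * s + w)) / σ' +
            (n * (σ / σ') + σ / σ' + w / σ') := by
          rw [hr', hR]; field_simp; ring
        have e2 : σ / σ' ≤ 7 / 8 := by rw [div_le_iff₀ hσ'0]; exact hσ'
        have e3 : w / σ' ≤ y := by
          rw [div_le_iff₀ hσ'0]
          exact hwy.trans (by gcongr)
        have e4 : (n : ℝ) * (σ / σ') ≤ n * (7 / 8) := by gcongr
        rw [e1]
        linarith
      rw [← Finset.sum_mul]
      have hsum : ∑ m ∈ B.net, coupling ξ V W m ≤
          K * (5 + n) ^ p * (γ * (2 * ξ) ^ D * (5 + n) ^ D * β) := by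
        calc ∑ m ∈ B.net, coupling ξ V W m = ∑ m ∈ I, coupling ξ V W m := by
              rw [hI, Finset.sum_filter_ne_zero]
          _ ≤ ∑ m ∈ I, W.card * β := Finset.sum_le_sum fun m _ => coupling_le_card_mul V W m hβ
          _ = I.card * (W.card * β) := by simp
          _ ≤ _ := by gcongr
      calc _ ≤ K * (5 + n) ^ p * (γ * (2 * ξ) ^ D * (5 + n) ^ D * β) *
            (M * (φ * Real.exp (1 + y) * Real.exp (7 * n / 8))) := by gcongr
        _ = _ := by rw [hG, pow_add]; ring)
  refine key.weaken subset_rfl subset_rfl ?_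
  have h1 : s * (4 * shellConst p K * G * expSum (p + (p + D))) ≤ 1 / 2 * (M * φ) := by
    have h2 : 0 ≤ 4 * shellConst p K * (K * (γ * (2 * ξ) ^ D * β) * Real.exp (1 + y)) *
        expSum (p + (p + D)) := by
      have := shellConst_nonneg (p := p) hK
      have := expSum_nonneg (p + (p + D))
      positivity
    calc _ = s * (4 * shellConst p K * (K * (γ * (2 * ξ) ^ D * β) * Real.exp (1 + y)) *
        expSum (p + (p + D))) * (M * φ) := by rw [hG]; ring
      _ ≤ T * (4 * shellConst p K * (K * (γ * (2 * ξ) ^ D * β) * Real.exp (1 + y)) *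
        expSum (p + (p + D))) * (M * φ) := by
          gcongr
          exact hs.2
      _ ≤ _ := by gcongr
  calc _ ≤ 2 * φ + 1 / 2 * (M * φ) := by linarith
    _ = _ := by ring

-- Up to time `T` nothing is to be done. Beyond it the evolution is a product of two halves; the
-- composition constant `e^L` becomes a shift `σ' L` of the distance, and since `s > T` this shift
-- and the second offset `w` are absorbed into the velocity, by `hv'`.
include B in
theorem blockBound_double_time (hK : 0 ≤ K) (hσ : 0 < σ) (hσξ : σ ≤ ξ) {H : selfAdjoint 𝒜}
    {σ' v v' w L T : ℝ} (hσ' : σ ≤ 7 / 8 * σ') (hv : 0 ≤ v) (hw : 0 ≤ w) (hvT : v * T + w ≤ ξ)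
    (hL : 2 * shellConst p K * K * expSum (2 * p) ≤ Real.exp L) (hvv' : v ≤ v')
    (hv' : v * T + (w + σ' * L) ≤ v' * T) (hT : 0 < T)
    (h : ∀ s ∈ Set.Icc 0 T, N.BlockBound ξ (unitaryConj (flow H s))
      fun r => 2 * Real.exp (-(r - (v * s + w)) / σ)) :
    ∀ s ∈ Set.Icc 0 (2 * T), N.BlockBound ξ (unitaryConj (flow H s))
      fun r => 2 * Real.exp (-(r - (v' * s + w)) / σ') := by
  intro s hs
  have hσ'0 : 0 < σ' := by linarith
  have hσσ' : σ ≤ σ' := by linarith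
  by_cases hsT : s ≤ T
  · exact (h s ⟨hs.1, hsT⟩).exp_mono le_rfl hσ hσσ' (by have := hs.1; gcongr)
  rw [not_le] at hsT
  have hs2 : s / 2 ∈ Set.Icc 0 T := ⟨by linarith [hs.1], by linarith [hs.2]⟩
  intro r a b X Y hX hY hXa hYb hXY
  set R := v * (s / 2) + w with hR
  have hR0 : 0 ≤ R := by have := mul_nonneg hv hs2.1; linarith
  have hRξ : R ≤ ξ := by
    have : v * (s / 2) ≤ v * T := by gcongr; exact hs2.2
    linarith
  have h2 := commBound_mul B hK hσ hσξ hR0 hRξ (h _ hs2)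
    ((h _ hs2).exp_mono le_rfl hσ hσσ' le_rfl) (fun r => by positivity) hX hY hXa hYb hXY
    (F := 2 * Real.exp (-(r - 2 * R) / σ')) (by positivity) (fun n => by
      rw [mul_left_comm, ← Real.exp_add]
      gcongr
      have e2 : σ / σ' ≤ 7 / 8 := by rw [div_le_iff₀ hσ'0]; exact hσ'
      have e4 : (n : ℝ) * (σ / σ') ≤ n * (7 / 8) := by gcongr
      have e1 : -(r - (R + n * σ) - (v * (s / 2) + w)) / σ' = n * (σ / σ') +
          -(r - 2 * R) / σ' := by
        rw [hR]; field_simp; ring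
      rw [e1]
      linarith)
  rw [← flow_add, add_halves] at h2
  refine h2.weaken subset_rfl subset_rfl ?_
  calc _ ≤ Real.exp L * (2 * Real.exp (-(r - 2 * R) / σ')) := by gcongr
    _ = 2 * Real.exp (-(r - (2 * R + σ' * L)) / σ') := by
      rw [mul_left_comm, ← Real.exp_add]
      congr 2
      field_simp
      ring
    _ ≤ 2 * Real.exp (-(r - (v' * s + w)) / σ') := by
      have h3 : v * (s - T) ≤ v' * (s - T) := by gcongr
      have h4 : 2 * R + σ' * L ≤ v' * s + w := by rw [hR]; linarith
      gcongr

-- A set inside a block of radius `2 * ξ` meets at most `K * 4 ^ p` blocks of the net of radius `ξ`.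
-- Both sets are cut, each with a factor two.
include B in
theorem BlockBound.double_block (hK : 0 ≤ K) (hξ : 0 < ξ) {u : unitary 𝒜} {f : ℝ → ℝ}
    (hf : ∀ r, 0 ≤ f r) (h : N.BlockBound ξ (unitaryConj u) f) :
    N.BlockBound (2 * ξ) (unitaryConj u) fun r => 4 * (K * 4 ^ p) ^ 2 * f r := by
  classical
  intro r a b X Y hX hY hXa hYb hXY
  have hcov : ∀ S : Finset Λ, S ⊆ (B.net.filter fun m => (S ∩ block m ξ).Nonempty).biUnion
      fun m => S ∩ block m ξ := by
    intro S i hi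
    obtain ⟨m, hm, hmi⟩ := B.covers i
    have : i ∈ S ∩ block m ξ := Finset.mem_inter.2 ⟨hi, mem_block.2 hmi⟩
    exact Finset.mem_biUnion.2 ⟨m, Finset.mem_filter.2 ⟨hm, ⟨i, this⟩⟩, this⟩
  have hcard : ∀ (S : Finset Λ) (c : Λ), S ⊆ block c (2 * ξ) →
      ((B.net.filter fun m => (S ∩ block m ξ).Nonempty).card : ℝ) ≤ K * 4 ^ p := by
    intro S c hS
    have := B.card_le hξ c (t := 3) (by positivity) (Finset.filter_subset _ _)
      (I := B.net.filter fun m => (S ∩ block m ξ).Nonempty) ?_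
    · rwa [show (1 : ℝ) + 3 = 4 by norm_num] at this
    · intro m hm
      obtain ⟨i, hi⟩ := (Finset.mem_filter.1 hm).2
      obtain ⟨hi, him⟩ := Finset.mem_inter.1 hi
      have h1 := mem_block.1 (hS hi)
      have h2 := mem_block.1 him
      have h3 := dist_triangle c i m
      rw [dist_comm i m] at h3
      linarith
  have h1 : ∀ m ∈ B.net.filter (fun m => (X ∩ block m ξ).Nonempty),
      N.CommBound (unitaryConj u) (X ∩ block m ξ) Y (2 * ((K * 4 ^ p) * f r)) := by
    intro m hm
    have h2 := CommBound.biUnion_right (N := N) (u := u) (X := X ∩ block m ξ) (c := fun _ => f r)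
      (fun _ _ => hf r) (fun m' hm' => h r m m' _ _ (Finset.mem_filter.1 hm).2
        (Finset.mem_filter.1 hm').2 Finset.inter_subset_right Finset.inter_subset_right
        fun i hi j hj => hXY i (Finset.mem_inter.1 hi).1 j (Finset.mem_inter.1 hj).1) (hcov Y)
    refine h2.weaken subset_rfl subset_rfl ?_
    rw [Finset.sum_const, nsmul_eq_mul]
    have := hcard Y b hYb
    have := hf r
    gcongr
  have h2 := CommBound.biUnion_left (fun m _ => by have := hf r; positivity) h1 (hcov X)
  refine h2.weaken subset_rfl subset_rfl ?_
  rw [Finset.sum_const, nsmul_eq_mul]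
  have := hcard X a hXa
  have := hf r
  calc _ ≤ 2 * ((K * 4 ^ p) * (2 * ((K * 4 ^ p) * f r))) := by gcongr
    _ = _ := by ring

end LocalNet

/-! ### Lattice geometry and power-law interactions -/

/-- Geometric data of a `D`-dimensional lattice: the diameters of the sets of sites, the volume
growth of the balls, and nets of blocks of all sizes. -/
structure LatticeGeometry (Λ : Type*) [Fintype Λ] [PseudoMetricSpace Λ] (D : ℕ) (γ K : ℝ) where
  size : Finset Λ → ℝ
  one_le_size : ∀ Z, 1 ≤ size Z
  dist_le_size : ∀ Z, ∀ i ∈ Z, ∀ j ∈ Z, dist i j ≤ size Z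
  card_le : ∀ (i : Λ) (r : ℝ), 1 ≤ r → ((block i r).card : ℝ) ≤ γ * (2 * r) ^ D
  blocks : ∀ ξ : ℝ, 1 ≤ ξ → BlockNet Λ ξ K (D + 2)

section Hamiltonians

variable {Λ 𝒜 : Type*} [CStarAlgebra 𝒜]

open Classical in
/-- The interaction terms on the sets of size at most `ℓ`. -/
noncomputable def truncLE (size : Finset Λ → ℝ) (h : Finset Λ → selfAdjoint 𝒜) (ℓ : ℝ)
    (Z : Finset Λ) : selfAdjoint 𝒜 := if size Z ≤ ℓ then h Z else 0

theorem truncLE_sub (size : Finset Λ → ℝ) {ℓ ℓ' : ℝ} (hℓ : ℓ ≤ ℓ') (Z : Finset Λ) :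
    (truncLE size h ℓ' Z - truncLE size h ℓ Z : selfAdjoint 𝒜) =
      (open Classical in if ℓ < size Z ∧ size Z ≤ ℓ' then h Z else 0) := by
  unfold truncLE
  by_cases h1 : size Z ≤ ℓ
  · simp [h1, h1.trans hℓ, not_lt.2 h1]
  · by_cases h2 : size Z ≤ ℓ' <;> simp [h1, h2, not_le.1 h1]

variable [Fintype Λ] {h h' : Finset Λ → selfAdjoint 𝒜}

/-- The total Hamiltonian. -/
def ham (h : Finset Λ → selfAdjoint 𝒜) : selfAdjoint 𝒜 := ∑ Z, h Z

theorem ham_smul (c : ℝ) : ham (fun Z => c • h Z) = c • ham h := by simp [ham, Finset.smul_sum]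

theorem ham_sub : ham h' - ham h = ham fun Z => h' Z - h Z := by simp [ham]

theorem coe_ham : (ham h : 𝒜) = ∑ Z, (h Z : 𝒜) := by simp [ham]

end Hamiltonians

section Interactions

variable {Λ 𝒜 : Type*} [Fintype Λ] [DecidableEq Λ] [PseudoMetricSpace Λ] [CStarAlgebra 𝒜]

/-- Interactions of coupling strength `τ` with power-law decay. -/
structure PowerLaw (N : LocalNet Λ 𝒜) (size : Finset Λ → ℝ) (D : ℕ) (α τ g : ℝ)
    (h : Finset Λ → selfAdjoint 𝒜) : Prop where
  mem : ∀ Z, (h Z : 𝒜) ∈ N.alg Z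
  tail_le : ∀ (i : Λ) (r : ℝ), 0 < r → (open Classical in
    ∑ Z : Finset Λ with i ∈ Z ∧ r ≤ size Z, ‖(h Z : 𝒜)‖) ≤ τ * r ^ (-α + D)
  pair_le : ∀ i j : Λ, (open Classical in
    ∑ Z : Finset Λ with i ∈ Z ∧ j ∈ Z, ‖(h Z : 𝒜)‖) ≤ τ * g * (dist i j + 1) ^ (-α)

variable {N : LocalNet Λ 𝒜} {size : Finset Λ → ℝ} {D : ℕ} {α τ g : ℝ}
  {h h' : Finset Λ → selfAdjoint 𝒜}

theorem PowerLaw.of_norm_le (hh : PowerLaw N size D α τ g h) (hmem : ∀ Z, (h' Z : 𝒜) ∈ N.alg Z)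
    (hn : ∀ Z, ‖(h' Z : 𝒜)‖ ≤ ‖(h Z : 𝒜)‖) : PowerLaw N size D α τ g h' where
  mem := hmem
  tail_le i r hr := (Finset.sum_le_sum fun Z _ => hn Z).trans (hh.tail_le i r hr)
  pair_le i j := (Finset.sum_le_sum fun Z _ => hn Z).trans (hh.pair_le i j)

theorem PowerLaw.truncLE (hh : PowerLaw N size D α τ g h) (ℓ : ℝ) :
    PowerLaw N size D α τ g (truncLE size h ℓ) :=
  hh.of_norm_le
    (fun Z => by
      unfold LongRange.truncLE
      split_ifs
      · exact hh.mem Z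
      · exact Subalgebra.zero_mem _)
    (fun Z => by
      unfold LongRange.truncLE
      split_ifs <;> simp)

theorem PowerLaw.smul (hh : PowerLaw N size D α τ g h) {c : ℝ} (hc : 0 ≤ c) :
    PowerLaw N size D α (c * τ) g fun Z => c • h Z where
  mem Z := by
    rw [selfAdjoint.val_smul, ← Complex.coe_smul]
    exact Subalgebra.smul_mem _ (hh.mem Z) _
  tail_le i r hr := by
    have := hh.tail_le i r hr
    simp only [selfAdjoint.val_smul, norm_smul, Real.norm_of_nonneg hc, ← Finset.mul_sum]
    rw [mul_assoc]
    gcongr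
  pair_le i j := by
    have := hh.pair_le i j
    simp only [selfAdjoint.val_smul, norm_smul, Real.norm_of_nonneg hc, ← Finset.mul_sum]
    rw [mul_assoc, mul_assoc, ← mul_assoc τ]
    gcongr

end Interactions

/-! ### Multiscale induction: the linear light cone of the truncated Hamiltonian -/

namespace LocalNet

variable {Λ 𝒜 : Type*} [Fintype Λ] [DecidableEq Λ] [PseudoMetricSpace Λ] [CStarAlgebra 𝒜]
  {N : LocalNet Λ 𝒜} {D : ℕ} {γ K α τ g : ℝ} {h : Finset Λ → selfAdjoint 𝒜}

theorem blockBound_flow_zero (ξ s : ℝ) {y σ : ℝ} (hy : 0 ≤ y) (hσ : 0 < σ) :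
    N.BlockBound ξ (unitaryConj (flow (0 : selfAdjoint 𝒜) s))
      fun r => 2 * Real.exp (-(r - y) / σ) := by
  intro r a b X Y hX hY hXa hYb hXY
  by_cases hr : y < r
  · intro o ho o' ho'
    have hd : Disjoint X Y := by
      rw [Finset.disjoint_left]
      intro i hi hi'
      have := hXY i hi i hi'
      rw [dist_self] at this
      linarith
    have h0 : flow (0 : selfAdjoint 𝒜) s = 1 := by simp [flow]
    rw [h0, unitaryConj_one, N.comm hd ho ho', sub_self, norm_zero]
    positivity
  · refine (commBound_two _ X Y).weaken subset_rfl subset_rfl ?_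
    have : 1 ≤ Real.exp (-(r - y) / σ) := Real.one_le_exp (div_nonneg (by linarith) hσ.le)
    linarith

theorem sum_norm_le_of_lt_size {size : Finset Λ → ℝ} (hh : PowerLaw N size D α τ g h)
    {V : Finset Λ → selfAdjoint 𝒜} {ℓ : ℝ} (hℓ : 0 < ℓ)
    (hV : ∀ Z, V Z = 0 ∨ ℓ < size Z ∧ V Z = h Z) (i : Λ) :
    (open Classical in ∑ Z : Finset Λ with i ∈ Z, ‖(V Z : 𝒜)‖) ≤ τ * ℓ ^ (-α + D) := by
  classical
  refine le_trans ?_ (hh.tail_le i ℓ hℓ)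
  rw [← Finset.filter_filter, Finset.sum_filter (fun Z => ℓ ≤ size Z)]
  refine Finset.sum_le_sum fun Z _ => ?_
  rcases hV Z with h0 | ⟨h1, h2⟩
  · rw [h0]
    split_ifs <;> simp
  · rw [if_pos h1.le, h2]

/-- One scale step. Interactions of size between `σ/2` and `θ²σ/2` are added (range `σ` to `θσ`),
the time is doubled (range `θσ` to `θ²σ`), and then the blocks are doubled. The bound `θ ≥ 8/7`
serves both widenings, and `θ² ≤ 2` keeps the reach of the added terms below `σ`. The composition
constant `e^{M₁}` goes into the velocity, the covering constant `e^{M₂}` into the offset. -/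
theorem blockBound_truncLE_step (L : LatticeGeometry Λ D γ K) (hK : 0 ≤ K)
    (hh : PowerLaw N L.size D α τ g h) {θ v v' w w' y M₁ M₂ T ξ σ : ℝ} (hσ : 1 ≤ σ)
    (hθ : 8 / 7 ≤ θ) (hθ2 : θ ^ 2 ≤ 2) (hv : 0 ≤ v) (hw : 0 ≤ w) (hwy : w ≤ y * σ)
    (hT : 0 < T)
    (hξ : v * T + w + θ * σ ≤ ξ)
    (hsmall : T * (4 * shellConst (D + 2) K * (K * (γ * (2 * ξ) ^ D * (τ * (σ / 2) ^ (-α + D))) *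
      Real.exp (1 + y)) * expSum (D + 2 + (D + 2 + D))) ≤ 1 / 2)
    (hM₁ : 2 * shellConst (D + 2) K * K * expSum (2 * (D + 2)) ≤ Real.exp M₁)
    (hM₂ : 4 * (K * 4 ^ (D + 2)) ^ 2 ≤ Real.exp M₂) (hvv' : v ≤ v')
    (hv' : v * T + (w + θ * σ + θ ^ 2 * σ * M₁) ≤ v' * T)
    (hw' : w + θ * σ + θ ^ 2 * σ * M₂ ≤ w')
    (h₀ : ∀ s ∈ Set.Icc 0 T, N.BlockBound ξ (unitaryConj (flow (ham (truncLE L.size h (σ / 2))) s))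
      fun r => 2 * Real.exp (-(r - (v * s + w)) / σ)) :
    ∀ s ∈ Set.Icc 0 (2 * T), N.BlockBound (2 * ξ)
      (unitaryConj (flow (ham (truncLE L.size h (θ ^ 2 * σ / 2))) s))
      fun r => 2 * Real.exp (-(r - (v' * s + w')) / (θ ^ 2 * σ)) := by
  classical
  have hσ0 : 0 < σ := by linarith
  have hvT : 0 ≤ v * T := by positivity
  have hσξ : σ ≤ ξ := by nlinarith
  have hθσξ : θ * σ ≤ ξ := by linarith
  have hξ1 : 1 ≤ ξ := hσ.trans hσξ
  have hθ1 : 1 ≤ θ ^ 2 := by nlinarith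
  set V : Finset Λ → selfAdjoint 𝒜 := fun Z =>
    truncLE L.size h (θ ^ 2 * σ / 2) Z - truncLE L.size h (σ / 2) Z with hVdef
  have hVcase : ∀ Z, V Z = if σ / 2 < L.size Z ∧ L.size Z ≤ θ ^ 2 * σ / 2 then h Z else 0 :=
    fun Z => truncLE_sub L.size (by nlinarith) Z
  have hVor : ∀ Z, V Z = 0 ∨ σ / 2 < L.size Z ∧ V Z = h Z := by
    intro Z
    rw [hVcase]
    split_ifs with hz
    · exact Or.inr ⟨hz.1, rfl⟩
    · exact Or.inl rfl
  have h₁ := blockBound_perturb_exp (L.blocks ξ hξ1) hK hσ0 hσξ hξ1 L.card_le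
    (H₁ := ham (truncLE L.size h (θ ^ 2 * σ / 2))) (V := fun Z => (V Z : 𝒜))
    (fun Z => by
      rcases hVor Z with h0 | ⟨-, h1⟩
      · rw [h0]; exact Subalgebra.zero_mem _
      · rw [h1]; exact hh.mem Z)
    (by rw [ham_sub, coe_ham])
    (fun Z hZ i hi j hj => by
      have h1 : V Z ≠ 0 := fun h0 => hZ (by simp [h0])
      rw [hVcase] at h1
      have h2 : σ / 2 < L.size Z ∧ L.size Z ≤ θ ^ 2 * σ / 2 := by
        by_contra hn
        exact h1 (if_neg hn)
      have := L.dist_le_size Z i hi j hj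
      nlinarith [h2.2])
    (fun i => sum_norm_le_of_lt_size hh (half_pos hσ0) hVor i) (σ' := θ * σ) (by nlinarith)
    hv hw hwy (by nlinarith) h₀ hsmall
  have h₂ : ∀ s ∈ Set.Icc 0 T, N.BlockBound ξ
      (unitaryConj (flow (ham (truncLE L.size h (θ ^ 2 * σ / 2))) s))
      fun r => 2 * Real.exp (-(r - (v * s + (w + θ * σ))) / (θ * σ)) := by
    intro s hs
    refine (h₁ s hs).mono fun r => ?_
    have hθσ : 0 < θ * σ := by positivity
    -- The bootstrap has doubled the prefactor. A shift by one tail length `θσ` gains `e ≥ 2` and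
    -- restores it.
    have e1 : -(r - (v * s + (w + θ * σ))) / (θ * σ) = -(r - (v * s + w)) / (θ * σ) + 1 := by
      field_simp; ring
    have e2 : 2 ≤ Real.exp 1 := by linarith [Real.add_one_le_exp 1]
    rw [e1, Real.exp_add, mul_assoc]
    have := Real.exp_pos (-(r - (v * s + w)) / (θ * σ))
    nlinarith
  have h₃ := blockBound_double_time (L.blocks ξ hξ1) hK (by positivity) hθσξ
    (σ' := θ ^ 2 * σ) (by
      have : θ * σ * (8 / 7) ≤ θ * σ * θ := by gcongr
      linarith) hv (by positivity) (by linarith) hM₁ hvv' hv' hT h₂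
  intro s hs
  refine (BlockBound.double_block (L.blocks ξ hξ1) hK (by linarith) (fun r => by positivity)
    (h₃ s hs)).mono fun r => ?_
  have hσ'0 : 0 < θ ^ 2 * σ := by positivity
  calc _ ≤ Real.exp M₂ * (2 * Real.exp (-(r - (v' * s + (w + θ * σ))) / (θ ^ 2 * σ))) := by gcongr
    _ = 2 * Real.exp (-(r - (v' * s + (w + θ * σ + θ ^ 2 * σ * M₂))) / (θ ^ 2 * σ)) := by
      rw [mul_left_comm, ← Real.exp_add]
      congr 2
      field_simp
      ring
    _ ≤ _ := by gcongr

/-- The linear light cone of the truncated Hamiltonians. -/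
theorem blockBound_truncLE (L : LatticeGeometry Λ D γ K) (hK : 0 ≤ K)
    (hh : PowerLaw N L.size D α τ g h) {θ y A V c M₁ M₂ : ℝ}
    (hθ : 8 / 7 ≤ θ) (hθ2 : θ ^ 2 < 2) (hθ3 : 7 / 5 ≤ θ ^ 2)
    (hM₁0 : 0 ≤ M₁) (hM₂0 : 0 ≤ M₂)
    (hM₁ : 2 * shellConst (D + 2) K * K * expSum (2 * (D + 2)) ≤ Real.exp M₁)
    (hM₂ : 4 * (K * 4 ^ (D + 2)) ^ 2 ≤ Real.exp M₂)
    (hy : y = 5 * (1 + M₂)) (hA : A = y + 2 + 2 * M₁) (hV : V = A / (1 - θ ^ 2 / 2))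
    (hc : V + y + 2 ≤ c)
    (hsmall : ∀ n : ℕ, 2 ^ n * (4 * shellConst (D + 2) K * (K * (γ * (2 * (c * 2 ^ n)) ^ D *
      (τ * ((θ ^ 2) ^ n / 2) ^ (-α + D))) *
      Real.exp (1 + y)) * expSum (D + 2 + (D + 2 + D))) ≤ 1 / 2) (n : ℕ) :
    ∀ s ∈ Set.Icc (0 : ℝ) (2 ^ n), N.BlockBound (c * 2 ^ n)
      (unitaryConj (flow (ham (truncLE L.size h ((θ ^ 2) ^ n / 2))) s))
      fun r => 2 * Real.exp (-(r - (V * s + y * (θ ^ 2) ^ n)) / (θ ^ 2) ^ n) := by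
  have hθ0 : 0 < θ := by linarith
  have hθ4 : θ ≤ 2 := by nlinarith
  have hy0 : 0 ≤ y := by rw [hy]; positivity
  have hA0 : 0 ≤ A := by rw [hA]; positivity
  have hden : 0 < 1 - θ ^ 2 / 2 := by linarith
  have hV0 : 0 ≤ V := by rw [hV]; positivity
  have hVA : V * (1 - θ ^ 2 / 2) = A := by rw [hV]; exact div_mul_cancel₀ _ hden.ne'
  -- These velocities satisfy `v (n+1) - v n = A (θ²/2)^n`, exactly the increase that scale `n`
  -- requires: a shift `A θ^{2n}` over the time `2^n`. They stay below `V` because `θ² < 2`.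
  set v : ℕ → ℝ := fun n => V * (1 - (θ ^ 2 / 2) ^ n) with hv
  have hpow1 : ∀ n : ℕ, (θ ^ 2 / 2) ^ n ≤ 1 := fun n => pow_le_one₀ (by positivity) (by linarith)
  have hpow2 : ∀ n : ℕ, (θ ^ 2) ^ n ≤ 2 ^ n := fun n => pow_le_pow_left₀ (by positivity) hθ2.le n
  have hpow3 : ∀ n : ℕ, 1 ≤ (θ ^ 2) ^ n := fun n => one_le_pow₀ (by linarith)
  have hv0 : ∀ n, 0 ≤ v n := fun n => mul_nonneg hV0 (by linarith [hpow1 n])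
  have hvV : ∀ n, v n ≤ V := fun n => by
    have : 0 ≤ (θ ^ 2 / 2) ^ n := by positivity
    simp only [hv]
    nlinarith
  have main : ∀ n : ℕ, ∀ s ∈ Set.Icc (0 : ℝ) (2 ^ n), N.BlockBound (c * 2 ^ n)
      (unitaryConj (flow (ham (truncLE L.size h ((θ ^ 2) ^ n / 2))) s))
      fun r => 2 * Real.exp (-(r - (v n * s + y * (θ ^ 2) ^ n)) / (θ ^ 2) ^ n) := by
    intro n
    induction n with
    | zero =>
      intro s hs
      -- Every size is at least 1, so truncation at 1/2 leaves no interaction.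
      have h0 : ham (truncLE L.size h ((θ ^ 2) ^ 0 / 2)) = 0 := by
        refine Finset.sum_eq_zero fun Z _ => if_neg ?_
        have := L.one_le_size Z
        norm_num
        linarith
      rw [h0]
      exact blockBound_flow_zero _ s (by have := mul_nonneg (hv0 0) hs.1; positivity)
        (by positivity)
    | succ n ih =>
      have hq := hpow2 n
      have hq1 := hpow3 n
      have h2n : (0 : ℝ) < 2 ^ n := by positivity
      have hstep : v (n + 1) * 2 ^ n = v n * 2 ^ n + A * (θ ^ 2) ^ n := by
        simp only [hv]
        rw [← hVA, pow_succ (θ ^ 2 / 2), div_pow (θ ^ 2) 2 n]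
        field_simp
        ring
      have h1 := blockBound_truncLE_step L hK hh (v' := v (n + 1))
        (w' := y * (θ ^ 2 * (θ ^ 2) ^ n)) (M₁ := M₁) (M₂ := M₂) hq1 hθ hθ2.le
        (hv0 n) (by positivity) le_rfl h2n ?_ (hsmall n) hM₁ hM₂ ?_ ?_ ?_ ih
      · rw [pow_succ' 2, mul_left_comm, pow_succ' (θ ^ 2)]
        exact h1
      · have := hvV n
        calc v n * 2 ^ n + y * (θ ^ 2) ^ n + θ * (θ ^ 2) ^ n
            ≤ V * 2 ^ n + y * 2 ^ n + 2 * 2 ^ n := by gcongr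
          _ = (V + y + 2) * 2 ^ n := by ring
          _ ≤ _ := by gcongr
      · simp only [hv]
        have : (θ ^ 2 / 2) ^ (n + 1) ≤ (θ ^ 2 / 2) ^ n :=
          pow_le_pow_of_le_one (by positivity) (by linarith) (Nat.le_succ n)
        gcongr
      · rw [hstep, hA]
        have e1 : θ * (θ ^ 2) ^ n ≤ 2 * (θ ^ 2) ^ n := by gcongr
        have e2 : θ ^ 2 * (θ ^ 2) ^ n * M₁ ≤ 2 * (θ ^ 2) ^ n * M₁ := by gcongr
        linarith
      · have e1 : θ * (θ ^ 2) ^ n ≤ 2 * (θ ^ 2) ^ n := by gcongr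
        have e2 : θ ^ 2 * (θ ^ 2) ^ n * M₂ ≤ 2 * (θ ^ 2) ^ n * M₂ := by gcongr
        have e3 : 7 / 5 * (y * (θ ^ 2) ^ n) ≤ θ ^ 2 * (y * (θ ^ 2) ^ n) := by gcongr
        -- The offset may grow by the factor `θ² ≥ 7/5`, and the gain `2y/5` must cover `2 + 2 M₂`;
        -- hence `y = 5 (1 + M₂)`.
        have e4 : 2 / 5 * (y * (θ ^ 2) ^ n) = 2 * (θ ^ 2) ^ n + 2 * (θ ^ 2) ^ n * M₂ := by
          rw [hy]; ring
        linarith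
  intro s hs
  refine (main n s hs).mono fun r => ?_
  have := hvV n
  have := hpow3 n
  have := hs.1
  gcongr

end LocalNet

/-! ### The power-law profile -/

theorem rpow_neg_le_mul {a b x α : ℝ} (ha : 0 < a) (hb : 0 < b) (hx : 0 ≤ x) (hα : 0 ≤ α)
    (h : a ≤ x * b) : b ^ (-α) ≤ x ^ α * a ^ (-α) := by
  have h1 : a ^ α ≤ x ^ α * b ^ α := by
    rw [← Real.mul_rpow hx hb.le]; exact Real.rpow_le_rpow ha.le h hα
  rw [Real.rpow_neg ha.le, Real.rpow_neg hb.le, ← div_eq_mul_inv,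
    le_div_iff₀ (Real.rpow_pos_of_pos ha α), inv_mul_le_iff₀ (Real.rpow_pos_of_pos hb α)]
  linarith

/-- The power-law profile, as a function of the distance in units of the block radius: it
decreases from order one to order `T ^ (-δ)` over a distance of order `κ`. -/
noncomputable def profile (T δ κ α ρ : ℝ) : ℝ :=
  T ^ (-(δ * min 1 (max 0 (ρ - 2) / κ))) * (1 + max 0 ρ) ^ (-α)

section Profile

variable {T δ κ α ρ : ℝ}

theorem profile_pos (hT : 1 ≤ T) : 0 < profile T δ κ α ρ :=
  mul_pos (Real.rpow_pos_of_pos (by linarith) _)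
    (Real.rpow_pos_of_pos (by have := le_max_left 0 ρ; linarith) _)

theorem profile_antitone (hT : 1 ≤ T) (hδ : 0 ≤ δ) (hκ : 0 < κ) (hα : 0 ≤ α) :
    Antitone (profile T δ κ α) := by
  intro ρ ρ' h
  have h0 := le_max_left 0 ρ
  unfold profile
  refine mul_le_mul (Real.rpow_le_rpow_of_exponent_le hT ?_)
    (Real.rpow_le_rpow_of_nonpos (by linarith) (by gcongr) (by linarith)) ?_ ?_
  · rw [neg_le_neg_iff]
    gcongr
  · exact Real.rpow_nonneg (by have := le_max_left 0 ρ'; linarith) _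
  · exact Real.rpow_nonneg (by linarith) _

/-- The profile varies slowly: coming closer by `x` block radii costs a polynomial in `x` and a
power of `T` proportional to `x / κ`. A large `κ` makes the second loss as mild as required. -/
theorem profile_sub_le (hT : 1 ≤ T) (hδ : 0 ≤ δ) (hκ : 0 < κ) (hα : 0 ≤ α) {x : ℝ} (hx : 0 ≤ x) :
    profile T δ κ α (ρ - x) ≤ (1 + x) ^ α * T ^ (δ * x / κ) * profile T δ κ α ρ := by
  have hT0 : 0 < T := by linarith
  have h0 := le_max_left 0 (ρ - x)
  have h1 := le_max_left 0 ρ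
  have h2 : T ^ (-(δ * min 1 (max 0 (ρ - x - 2) / κ))) ≤
      T ^ (δ * x / κ) * T ^ (-(δ * min 1 (max 0 (ρ - 2) / κ))) := by
    rw [← Real.rpow_add hT0]
    refine Real.rpow_le_rpow_of_exponent_le hT ?_
    have h3 : max 0 (ρ - 2) ≤ max 0 (ρ - x - 2) + x := by
      refine max_le (by have := le_max_left 0 (ρ - x - 2); linarith) ?_
      have := le_max_right 0 (ρ - x - 2)
      linarith
    have h4 : min 1 (max 0 (ρ - 2) / κ) ≤ min 1 (max 0 (ρ - x - 2) / κ) + x / κ := by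
      rw [← min_add_add_right]
      refine min_le_min (by have : 0 ≤ x / κ := by positivity
                            linarith) ?_
      rw [← add_div]
      gcongr
    have h5 := mul_le_mul_of_nonneg_left h4 hδ
    rw [mul_add, ← mul_div_assoc] at h5
    linarith
  have h6 : (1 + max 0 (ρ - x)) ^ (-α) ≤ (1 + x) ^ α * (1 + max 0 ρ) ^ (-α) := by
    refine rpow_neg_le_mul (by linarith) (by linarith) (by linarith) hα ?_
    have h7 : max 0 ρ ≤ max 0 (ρ - x) + x := by
      refine max_le (by linarith) ?_
      have := le_max_right 0 (ρ - x)
      linarith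
    nlinarith
  unfold profile
  calc _ ≤ T ^ (δ * x / κ) * T ^ (-(δ * min 1 (max 0 (ρ - 2) / κ))) *
        ((1 + x) ^ α * (1 + max 0 ρ) ^ (-α)) := by gcongr
    _ = _ := by ring

theorem profile_le (hT : 1 ≤ T) (hδ : 0 ≤ δ) (hκ : 0 < κ) :
    profile T δ κ α ρ ≤ (1 + max 0 ρ) ^ (-α) := by
  have h1 := le_max_left 0 ρ
  refine mul_le_of_le_one_left (Real.rpow_nonneg (by linarith) _)
    (Real.rpow_le_one_of_one_le_of_nonpos hT ?_)
  have : 0 ≤ min 1 (max 0 (ρ - 2) / κ) :=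
    le_min zero_le_one (div_nonneg (le_max_left _ _) hκ.le)
  have := mul_nonneg hδ this
  linarith

theorem le_profile (hT : 1 ≤ T) (hδ : 0 ≤ δ) :
    T ^ (-δ) * (1 + max 0 ρ) ^ (-α) ≤ profile T δ κ α ρ := by
  have h1 := le_max_left 0 ρ
  refine mul_le_mul_of_nonneg_right (Real.rpow_le_rpow_of_exponent_le hT ?_)
    (Real.rpow_nonneg (by linarith) _)
  have := mul_le_mul_of_nonneg_left (min_le_left 1 (max 0 (ρ - 2) / κ)) hδ
  linarith

theorem profile_of_le (hκ : 0 < κ) (hρ : 2 + κ ≤ ρ) :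
    profile T δ κ α ρ = T ^ (-δ) * (1 + ρ) ^ (-α) := by
  have h1 : max 0 (ρ - 2) = ρ - 2 := max_eq_right (by linarith)
  have h2 : min 1 (max 0 (ρ - 2) / κ) = 1 := by
    rw [h1, min_eq_left]
    rw [one_le_div hκ]
    linarith
  rw [profile, h2, max_eq_right (by linarith), mul_one]

theorem le_profile_of_le_two (hα : 0 ≤ α) (hρ : ρ ≤ 2) :
    3 ^ (-α) ≤ profile T δ κ α ρ := by
  have h1 : max 0 (ρ - 2) = 0 := max_eq_left (by linarith)
  have h2 : max 0 ρ ≤ 2 := max_le (by norm_num) hρ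
  have h3 := le_max_left 0 ρ
  rw [profile, h1]
  simp only [zero_div, zero_le_one, min_eq_right, mul_zero, neg_zero, Real.rpow_zero, one_mul]
  exact Real.rpow_le_rpow_of_nonpos (by linarith) (by linarith) (by linarith)

/-- Convolution of two power laws on the centers of the blocks. -/
theorem sum_rpow_mul_rpow_le {Λ : Type*} [PseudoMetricSpace Λ] {ξ K : ℝ} {p : ℕ}
    (B : BlockNet Λ ξ K p) (hξ : 0 < ξ) (hα : (p : ℝ) ≤ α) (a b : Λ)
    (hab : (ρ - 2) * ξ ≤ dist a b) :
    ∑ m ∈ B.net, (1 + dist a m / ξ) ^ (-α) * (1 + dist m b / ξ) ^ (-α) ≤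
      2 * K * 3 ^ α * (1 + max 0 ρ) ^ (-α) := by
  have hα0 : 0 ≤ α := (Nat.cast_nonneg p).trans hα
  have hρ := le_max_left 0 ρ
  have hpow : ∀ x y : Λ, (1 + dist x y / ξ) ^ (-α) ≤ ((1 + dist x y / ξ) ^ p)⁻¹ := by
    intro x y
    have h1 : (1 : ℝ) ≤ 1 + dist x y / ξ := by
      have : 0 ≤ dist x y / ξ := by positivity
      linarith
    rw [← Real.rpow_natCast, ← Real.rpow_neg (by linarith)]
    exact Real.rpow_le_rpow_of_exponent_le h1 (by linarith)
  have hterm : ∀ m, (1 + dist a m / ξ) ^ (-α) * (1 + dist m b / ξ) ^ (-α) ≤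
      3 ^ α * (1 + max 0 ρ) ^ (-α) *
        (((1 + dist a m / ξ) ^ p)⁻¹ + ((1 + dist b m / ξ) ^ p)⁻¹) := by
    intro m
    have hq : 0 ≤ dist a m / ξ := by positivity
    have hq' : 0 ≤ dist m b / ξ := by positivity
    have hsum : ρ - 2 ≤ dist a m / ξ + dist m b / ξ := by
      rw [← add_div, le_div_iff₀ hξ]
      exact hab.trans (dist_triangle _ _ _)
    have hI1 : 0 ≤ ((1 + dist a m / ξ) ^ p)⁻¹ := by positivity
    have hI2 : 0 ≤ ((1 + dist b m / ξ) ^ p)⁻¹ := by positivity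
    have hC : 0 ≤ 3 ^ α * (1 + max 0 ρ) ^ (-α) := by positivity
    have key : ∀ x : ℝ, 0 ≤ x → ρ - 2 ≤ 2 * x → (1 + x) ^ (-α) ≤
        3 ^ α * (1 + max 0 ρ) ^ (-α) := by
      intro x hx hx2
      refine rpow_neg_le_mul (by linarith) (by linarith) (by norm_num) hα0 ?_
      have : max 0 ρ ≤ 2 + 3 * x := max_le (by linarith) (by linarith)
      linarith
    -- The larger of the two distances is at least half of the total. Its factor gives the decay in
    -- `ρ`; the other factor is summed over the net.
    rcases le_total (dist a m / ξ) (dist m b / ξ) with hle | hle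
    · have h1 := key _ hq' (by linarith)
      calc _ ≤ ((1 + dist a m / ξ) ^ p)⁻¹ * (3 ^ α * (1 + max 0 ρ) ^ (-α)) := by
            gcongr
            exact hpow a m
        _ ≤ _ := by nlinarith
    · have h1 := key _ hq (by linarith)
      calc _ ≤ (3 ^ α * (1 + max 0 ρ) ^ (-α)) * ((1 + dist b m / ξ) ^ p)⁻¹ := by
            gcongr
            rw [dist_comm m b]
            exact hpow b m
        _ ≤ _ := by nlinarith
  refine (Finset.sum_le_sum fun m _ => hterm m).trans ?_
  rw [← Finset.mul_sum, Finset.sum_add_distrib]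
  have h1 := B.sum_le a
  have h2 := B.sum_le b
  calc _ ≤ 3 ^ α * (1 + max 0 ρ) ^ (-α) * (K + K) := by gcongr
    _ = _ := by ring

end Profile

/-! ### The power-law light cone of the full Hamiltonian -/

namespace LocalNet

variable {Λ 𝒜 : Type*} [Fintype Λ] [DecidableEq Λ] [PseudoMetricSpace Λ] [CStarAlgebra 𝒜]
  {ξ : ℝ}

open Classical in
theorem coupling_le_of_pair (h : Finset Λ → 𝒜) (W : Finset Λ) (m : Λ) {β : ℝ}
    (hd : Disjoint W (block m ξ))
    (hβ : ∀ i ∈ W, ∀ j ∈ block m ξ, ∑ Z : Finset Λ with i ∈ Z ∧ j ∈ Z, ‖h Z‖ ≤ β) :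
    coupling ξ h W m ≤ W.card * ((block m ξ).card * β) := by
  calc coupling ξ h W m ≤ ∑ Z ∈ W.biUnion fun i => (block m ξ).biUnion fun j =>
        Finset.univ.filter fun Z => i ∈ Z ∧ j ∈ Z, ‖h Z‖ := by
        refine Finset.sum_le_sum_of_subset_of_nonneg ?_ fun _ _ _ => norm_nonneg _
        intro Z hZ
        obtain ⟨hZW, j, hj⟩ := (Finset.mem_filter.1 hZ).2
        obtain ⟨i, hiZ, hiW⟩ := Finset.not_disjoint_iff.1 hZW
        obtain ⟨hj, hjm⟩ := Finset.mem_inter.1 hj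
        have hjZ : j ∈ Z := (Finset.mem_union.1 hj).resolve_right
          fun hjW => Finset.disjoint_left.1 hd hjW hjm
        exact Finset.mem_biUnion.2 ⟨i, hiW, Finset.mem_biUnion.2 ⟨j, hjm, by simp [hiZ, hjZ]⟩⟩
    _ ≤ ∑ i ∈ W, ∑ j ∈ block m ξ, ∑ Z : Finset Λ with i ∈ Z ∧ j ∈ Z, ‖h Z‖ :=
        (sum_biUnion_le_sum W _ fun _ => norm_nonneg _).trans
          (Finset.sum_le_sum fun i _ => sum_biUnion_le_sum _ _ fun _ => norm_nonneg _)
    _ ≤ ∑ i ∈ W, ∑ j ∈ block m ξ, β :=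
        Finset.sum_le_sum fun i hi => Finset.sum_le_sum fun j hj => hβ i hi j hj
    _ = _ := by simp

end LocalNet

namespace LocalNet

variable {Λ 𝒜 : Type*} [Fintype Λ] [DecidableEq Λ] [PseudoMetricSpace Λ] [CStarAlgebra 𝒜]
  {N : LocalNet Λ 𝒜} {D : ℕ} {γ K α τ g : ℝ} {h : Finset Λ → selfAdjoint 𝒜}

/-- There are few blocks near `W`, and each is coupled with strength at most `|W| β`. The distance
shrinks by at most `6 + ν` block radii: since `κ ≥ 12`, the 6 costs at most `T^(δ/2)`, and `ν` costs
at most `e`, apart from polynomial factors. -/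
theorem sum_coupling_mul_profile_near_le (L : LatticeGeometry Λ D γ K) (hK : 0 ≤ K) {ξ : ℝ}
    (hξ : 1 ≤ ξ) (hα : (D : ℝ) + 2 ≤ α) {V : Finset Λ → 𝒜} {β T δ κ : ℝ}
    (hβ : ∀ i : Λ, (open Classical in ∑ Z : Finset Λ with i ∈ Z, ‖V Z‖) ≤ β)
    (hT : 1 ≤ T) (hδ : 0 ≤ δ) (hκ : 12 ≤ κ) {a b : Λ} {W : Finset Λ} {n : ℕ} {ν r e : ℝ}
    (hν : 0 ≤ ν) (hνn : ν ≤ n) (he : 1 ≤ e) (hνe : T ^ (δ * ν / κ) ≤ e)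
    (hW : W ⊆ block a ((2 + ν) * ξ)) :
    (open Classical in ∑ m ∈ (L.blocks ξ hξ).net with dist a m / ξ ≤ 4 + ν, coupling ξ V W m *
        profile T δ κ α (max (r - (2 + dist a m / ξ) * ξ) (dist m b - 2 * ξ) / ξ)) ≤
      K * (γ * (2 * ξ) ^ D * β) * T ^ (δ / 2) * profile T δ κ α (r / ξ) *
        ((5 + n) ^ (2 * D + 2 + 2 * ⌈α⌉₊) * e) := by
  classical
  set B := L.blocks ξ hξ
  set A := ⌈α⌉₊ with hA
  have hαA : α ≤ A := Nat.le_ceil α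
  have hξ0 : 0 < ξ := by linarith
  have hT0 : 0 < T := by linarith
  have hκ0 : 0 < κ := by linarith
  have hα0 : 0 ≤ α := by have : (0 : ℝ) ≤ D := Nat.cast_nonneg D
                         linarith
  have hn0 : (0 : ℝ) ≤ n := Nat.cast_nonneg n
  have hβ0 : 0 ≤ β := le_trans (Finset.sum_nonneg fun _ _ => norm_nonneg _) (hβ a)
  have hγ0 : 0 ≤ γ := by
    have h1 := (Nat.cast_nonneg _).trans (L.card_le a 1 le_rfl)
    have h2 : (0 : ℝ) < (2 * 1) ^ D := by positivity
    exact nonneg_of_mul_nonneg_left h1 h2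
  set φ := profile T δ κ α (r / ξ) with hφ
  have hφ0 : 0 < φ := profile_pos hT
  have hWcard : (W.card : ℝ) ≤ γ * (2 * ξ) ^ D * (5 + n) ^ D := by
    calc (W.card : ℝ) ≤ (block a ((2 + ν) * ξ)).card := by exact_mod_cast Finset.card_le_card hW
      _ ≤ γ * (2 * ((2 + ν) * ξ)) ^ D := L.card_le _ _ (by nlinarith)
      _ = γ * (2 * ξ) ^ D * (2 + ν) ^ D := by rw [mul_assoc γ, ← mul_pow]; ring
      _ ≤ _ := by gcongr; norm_num
  have hone : (1 : ℝ) ≤ 5 + n := by linarith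
  set Q := (5 + (n : ℝ)) ^ (2 * D + 2 + 2 * A) * e with hQ
  set I := B.net.filter fun m => dist a m / ξ ≤ 4 + ν with hI
  have hIcard : (I.card : ℝ) ≤ K * (5 + n) ^ (D + 2) := by
    refine (B.card_le hξ0 a (t := 4 + ν) (by linarith) (Finset.filter_subset _ _) ?_).trans ?_
    · intro m hm
      exact (div_le_iff₀ hξ0).1 (Finset.mem_filter.1 hm).2
    · gcongr ?_ * ?_ ^ _
      linarith
  have hprof : ∀ m ∈ I,
      profile T δ κ α (max (r - (2 + dist a m / ξ) * ξ) (dist m b - 2 * ξ) / ξ) ≤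
      (5 + n) ^ (2 * A) * (T ^ (δ / 2) * e) * φ := by
    intro m hm
    have hm := (Finset.mem_filter.1 hm).2
    have h1 : r / ξ - (6 + ν) ≤
        max (r - (2 + dist a m / ξ) * ξ) (dist m b - 2 * ξ) / ξ := by
      rw [le_div_iff₀ hξ0]
      refine le_trans ?_ (le_max_left _ _)
      have e1 : (r / ξ - (6 + ν)) * ξ = r - (6 + ν) * ξ := by field_simp
      rw [e1]
      exact sub_le_sub_left (mul_le_mul_of_nonneg_right (by linarith) hξ0.le) r
    refine (profile_antitone hT hδ hκ0 hα0 h1).trans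
      ((profile_sub_le hT hδ hκ0 hα0 (by linarith)).trans ?_)
    have h2 : (1 + (6 + ν)) ^ α ≤ (5 + (n : ℝ)) ^ (2 * A) := by
      calc (1 + (6 + ν)) ^ α ≤ (1 + (6 + ν)) ^ (A : ℝ) :=
            Real.rpow_le_rpow_of_exponent_le (by linarith) hαA
        _ = (1 + (6 + ν)) ^ A := Real.rpow_natCast _ _
        _ ≤ ((5 + (n : ℝ)) ^ 2) ^ A := by gcongr; nlinarith
        _ = _ := by rw [pow_mul]
    have h3 : T ^ (δ * (6 + ν) / κ) ≤ T ^ (δ / 2) * e := by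
      have e1 : δ * (6 + ν) / κ = δ * 6 / κ + δ * ν / κ := by ring
      rw [e1, Real.rpow_add hT0]
      have h4 : δ * 6 / κ ≤ δ / 2 := by
        rw [div_le_div_iff₀ hκ0 two_pos]
        nlinarith
      have h5 := Real.rpow_le_rpow_of_exponent_le hT h4
      gcongr
    gcongr
  calc _ ≤ ∑ m ∈ I, (γ * (2 * ξ) ^ D * (5 + n) ^ D * β) *
        ((5 + n) ^ (2 * A) * (T ^ (δ / 2) * e) * φ) := by
        refine Finset.sum_le_sum fun m hm => ?_
        have h1 := coupling_le_card_mul (ξ := ξ) V W m hβ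
        have h2 := hprof m hm
        have h3 := coupling_nonneg ξ V W m
        have h4 : (W.card : ℝ) * β ≤ γ * (2 * ξ) ^ D * (5 + n) ^ D * β := by gcongr
        have h5 := (profile_pos hT (δ := δ) (κ := κ) (α := α)
          (ρ := max (r - (2 + dist a m / ξ) * ξ) (dist m b - 2 * ξ) / ξ)).le
        exact mul_le_mul (h1.trans h4) h2 h5 (by positivity)
    _ = I.card * ((γ * (2 * ξ) ^ D * (5 + n) ^ D * β) *
        ((5 + n) ^ (2 * A) * (T ^ (δ / 2) * e) * φ)) := by simp
    _ ≤ K * (5 + n) ^ (D + 2) * ((γ * (2 * ξ) ^ D * (5 + n) ^ D * β) *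
        ((5 + n) ^ (2 * A) * (T ^ (δ / 2) * e) * φ)) := by gcongr
    _ = _ := by rw [hQ, show 2 * D + 2 + 2 * A = D + 2 + D + 2 * A by ring]; ring

/-- A block far from `W` is disjoint from it, so a term coupling them contains a site of each and
the pair decay applies. Here the transition of the profile is ignored: its pure power law is
convolved with the pair decay, and the result is compared with the profile at the full price `T^δ`.
-/
theorem sum_coupling_mul_profile_far_le (L : LatticeGeometry Λ D γ K) (hK : 0 ≤ K) {ξ : ℝ}
    (hξ : 1 ≤ ξ) (hα : (D : ℝ) + 2 ≤ α) {V : Finset Λ → 𝒜} {β ζ T δ κ : ℝ} (hζ : 0 ≤ ζ)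
    (hβ : ∀ i : Λ, (open Classical in ∑ Z : Finset Λ with i ∈ Z, ‖V Z‖) ≤ β)
    (hpair : ∀ i j : Λ, (open Classical in
      ∑ Z : Finset Λ with i ∈ Z ∧ j ∈ Z, ‖V Z‖) ≤ ζ * (dist i j + 1) ^ (-α))
    (hT : 1 ≤ T) (hδ : 0 ≤ δ) (hκ : 12 ≤ κ) {a b : Λ} {W : Finset Λ} {n : ℕ} {ν r e : ℝ}
    (hν : 0 ≤ ν) (hνn : ν ≤ n) (he : 1 ≤ e)
    (hW : W ⊆ block a ((2 + ν) * ξ)) (hab : r - 2 * ξ ≤ dist a b) :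
    (open Classical in ∑ m ∈ (L.blocks ξ hξ).net with ¬ dist a m / ξ ≤ 4 + ν, coupling ξ V W m *
        profile T δ κ α (max (r - (2 + dist a m / ξ) * ξ) (dist m b - 2 * ξ) / ξ)) ≤
      2 * K * (γ * (2 * ξ) ^ D) ^ 2 * (ζ * ξ ^ (-α)) * 9 ^ α * T ^ δ * profile T δ κ α (r / ξ) *
        ((5 + n) ^ (2 * D + 2 + 2 * ⌈α⌉₊) * e) := by
  classical
  set B := L.blocks ξ hξ
  set A := ⌈α⌉₊ with hA
  have hαA : α ≤ A := Nat.le_ceil α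
  have hξ0 : 0 < ξ := by linarith
  have hT0 : 0 < T := by linarith
  have hκ0 : 0 < κ := by linarith
  have hα0 : 0 ≤ α := by have : (0 : ℝ) ≤ D := Nat.cast_nonneg D
                         linarith
  have hn0 : (0 : ℝ) ≤ n := Nat.cast_nonneg n
  have hβ0 : 0 ≤ β := le_trans (Finset.sum_nonneg fun _ _ => norm_nonneg _) (hβ a)
  have hγ0 : 0 ≤ γ := by
    have h1 := (Nat.cast_nonneg _).trans (L.card_le a 1 le_rfl)
    have h2 : (0 : ℝ) < (2 * 1) ^ D := by positivity
    exact nonneg_of_mul_nonneg_left h1 h2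
  set φ := profile T δ κ α (r / ξ) with hφ
  have hφ0 : 0 < φ := profile_pos hT
  have hWcard : (W.card : ℝ) ≤ γ * (2 * ξ) ^ D * (5 + n) ^ D := by
    calc (W.card : ℝ) ≤ (block a ((2 + ν) * ξ)).card := by exact_mod_cast Finset.card_le_card hW
      _ ≤ γ * (2 * ((2 + ν) * ξ)) ^ D := L.card_le _ _ (by nlinarith)
      _ = γ * (2 * ξ) ^ D * (2 + ν) ^ D := by rw [mul_assoc γ, ← mul_pow]; ring
      _ ≤ _ := by gcongr; norm_num
  have hone : (1 : ℝ) ≤ 5 + n := by linarith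
  set Q := (5 + (n : ℝ)) ^ (2 * D + 2 + 2 * A) * e with hQ
  set J := B.net.filter fun m => ¬ dist a m / ξ ≤ 4 + ν with hJ
  have hterm : ∀ m ∈ J, coupling ξ V W m *
      profile T δ κ α (max (r - (2 + dist a m / ξ) * ξ) (dist m b - 2 * ξ) / ξ) ≤
      (γ * (2 * ξ) ^ D) ^ 2 * (ζ * ξ ^ (-α)) * (5 + n) ^ (D + A) * 3 ^ α *
        ((1 + dist a m / ξ) ^ (-α) * (1 + dist m b / ξ) ^ (-α)) := by
    intro m hm
    have hm := not_le.1 (Finset.mem_filter.1 hm).2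
    set q := dist a m / ξ with hq
    have hqξ : q * ξ = dist a m := by rw [hq]; field_simp
    have hdist : ∀ i ∈ W, ∀ j ∈ block m ξ, (q - (3 + ν)) * ξ ≤ dist i j := by
      intro i hi j hj
      have h1 := mem_block.1 (hW hi)
      have h2 := mem_block.1 hj
      have h3 := dist_triangle4 a i j m
      rw [dist_comm j m] at h3
      nlinarith
    have hc : coupling ξ V W m ≤ W.card * ((block m ξ).card *
        (ζ * (ξ ^ (-α) * ((5 + n) ^ A * (1 + q) ^ (-α))))) := by
      refine coupling_le_of_pair V W m ?_ fun i hi j hj => (hpair i j).trans ?_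
      · rw [Finset.disjoint_left]
        intro i hi hi'
        have := hdist i hi i hi'
        rw [dist_self] at this
        nlinarith
      · have h1 := hdist i hi j hj
        have h2 : (1 + q) ≤ (5 + n) * ((dist i j + 1) / ξ) := by
          have h3 : q - (3 + ν) ≤ (dist i j + 1) / ξ := by
            rw [le_div_iff₀ hξ0]; linarith
          have h4 : (5 + ν) * (q - (3 + ν)) ≤ (5 + n) * ((dist i j + 1) / ξ) := by
            have : 0 ≤ q - (3 + ν) := by linarith
            gcongr
          nlinarith
        have hq0 : 0 ≤ q := by positivity
        have h5 := rpow_neg_le_mul (α := α) (a := 1 + q) (b := (dist i j + 1) / ξ)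
          (by linarith) (by positivity) (x := 5 + n) (by linarith) hα0 h2
        have h6 : (dist i j + 1) ^ (-α) = ξ ^ (-α) * ((dist i j + 1) / ξ) ^ (-α) := by
          rw [← Real.mul_rpow hξ0.le (by positivity), mul_div_cancel₀ _ hξ0.ne']
        have h7 : (5 + (n : ℝ)) ^ α ≤ (5 + n) ^ A := by
          rw [← Real.rpow_natCast]
          exact Real.rpow_le_rpow_of_exponent_le hone hαA
        rw [h6]
        have h8 : 0 ≤ (1 + q) ^ (-α) := Real.rpow_nonneg (by linarith) _
        gcongr
        exact h5.trans (by gcongr)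
    have hg : profile T δ κ α (max (r - (2 + q) * ξ) (dist m b - 2 * ξ) / ξ) ≤
        3 ^ α * (1 + dist m b / ξ) ^ (-α) := by
      have h1 : (dist m b - 2 * ξ) / ξ ≤ max (r - (2 + q) * ξ) (dist m b - 2 * ξ) / ξ := by
        gcongr
        exact le_max_right _ _
      refine (profile_antitone hT hδ hκ0 hα0 h1).trans ((profile_le hT hδ hκ0).trans ?_)
      have h2 : 0 ≤ dist m b / ξ := by positivity
      have h3 := le_max_left 0 ((dist m b - 2 * ξ) / ξ)
      refine rpow_neg_le_mul (by linarith) (by linarith) (by norm_num) hα0 ?_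
      have h4 := le_max_right 0 ((dist m b - 2 * ξ) / ξ)
      have h5 : (dist m b - 2 * ξ) / ξ = dist m b / ξ - 2 := by field_simp
      linarith
    have hq0 : 0 ≤ q := by positivity
    have hmcard := L.card_le m ξ hξ
    have h8 : 0 ≤ (1 + q) ^ (-α) := Real.rpow_nonneg (by linarith) _
    have h9 := (profile_pos hT (δ := δ) (κ := κ) (α := α)
          (ρ := max (r - (2 + q) * ξ) (dist m b - 2 * ξ) / ξ)).le
    calc _ ≤ (γ * (2 * ξ) ^ D * (5 + n) ^ D) * ((γ * (2 * ξ) ^ D) *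
        (ζ * (ξ ^ (-α) * ((5 + n) ^ A * (1 + q) ^ (-α))))) *
          (3 ^ α * (1 + dist m b / ξ) ^ (-α)) := by
          refine mul_le_mul (hc.trans ?_) hg h9 (by positivity)
          exact mul_le_mul hWcard (mul_le_mul_of_nonneg_right hmcard (by positivity))
            (by positivity) (by positivity)
      _ = _ := by ring
  have hconv := sum_rpow_mul_rpow_le (p := D + 2) B hξ0 (α := α) (by push_cast; exact hα) a b
    (ρ := r / ξ) (by rw [sub_mul, div_mul_cancel₀ _ hξ0.ne']; exact hab)
  have hle := le_profile (T := T) (δ := δ) (κ := κ) (α := α) (ρ := r / ξ) hT hδ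
  have hφT : (1 + max 0 (r / ξ)) ^ (-α) ≤ T ^ δ * φ := by
    rw [Real.rpow_neg hT0.le, inv_mul_le_iff₀ (Real.rpow_pos_of_pos hT0 _)] at hle
    exact hle
  calc _ ≤ ∑ m ∈ J, (γ * (2 * ξ) ^ D) ^ 2 * (ζ * ξ ^ (-α)) * (5 + n) ^ (D + A) * 3 ^ α *
        ((1 + dist a m / ξ) ^ (-α) * (1 + dist m b / ξ) ^ (-α)) := Finset.sum_le_sum hterm
    _ ≤ ∑ m ∈ B.net, (γ * (2 * ξ) ^ D) ^ 2 * (ζ * ξ ^ (-α)) * (5 + n) ^ (D + A) * 3 ^ α *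
        ((1 + dist a m / ξ) ^ (-α) * (1 + dist m b / ξ) ^ (-α)) :=
        Finset.sum_le_sum_of_subset_of_nonneg (Finset.filter_subset _ _)
          fun m _ _ => by positivity
    _ ≤ (γ * (2 * ξ) ^ D) ^ 2 * (ζ * ξ ^ (-α)) * (5 + n) ^ (D + A) * 3 ^ α *
        (2 * K * 3 ^ α * (T ^ δ * φ)) := by
        rw [← Finset.mul_sum]
        gcongr
        exact hconv.trans (by gcongr)
    _ = 2 * K * (γ * (2 * ξ) ^ D) ^ 2 * (ζ * ξ ^ (-α)) * 9 ^ α * T ^ δ * φ *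
        ((5 + n) ^ (D + A) * 1) := by
        rw [show (9 : ℝ) = 3 * 3 by norm_num, Real.mul_rpow (by norm_num) (by norm_num)]
        ring
    _ ≤ _ := by
        rw [hQ]
        gcongr
        · omega
        · omega

/-- Geometric part of the power-law bound: the couplings of a neighbourhood of radius `(1 + ν) ξ` of
a set inside a block to the blocks, weighted with the profile of the distances to another set. -/
theorem sum_coupling_mul_profile_le (L : LatticeGeometry Λ D γ K) (hK : 0 ≤ K) {ξ : ℝ}
    (hξ : 1 ≤ ξ) (hα : (D : ℝ) + 2 ≤ α) {V : Finset Λ → 𝒜} {β ζ T δ κ : ℝ} (hζ : 0 ≤ ζ)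
    (hβ : ∀ i : Λ, (open Classical in ∑ Z : Finset Λ with i ∈ Z, ‖V Z‖) ≤ β)
    (hpair : ∀ i j : Λ, (open Classical in
      ∑ Z : Finset Λ with i ∈ Z ∧ j ∈ Z, ‖V Z‖) ≤ ζ * (dist i j + 1) ^ (-α))
    (hT : 1 ≤ T) (hδ : 0 ≤ δ) (hκ : 12 ≤ κ) {a b : Λ} {W : Finset Λ} {n : ℕ} {ν r e : ℝ}
    (hν : 0 ≤ ν) (hνn : ν ≤ n) (he : 1 ≤ e) (hνe : T ^ (δ * ν / κ) ≤ e)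
    (hW : W ⊆ block a ((2 + ν) * ξ)) (hab : r - 2 * ξ ≤ dist a b) :
    ∑ m ∈ (L.blocks ξ hξ).net, coupling ξ V W m *
        profile T δ κ α (max (r - (2 + dist a m / ξ) * ξ) (dist m b - 2 * ξ) / ξ) ≤
      (K * (γ * (2 * ξ) ^ D * β) * T ^ (δ / 2) +
        2 * K * (γ * (2 * ξ) ^ D) ^ 2 * (ζ * ξ ^ (-α)) * 9 ^ α * T ^ δ) *
        profile T δ κ α (r / ξ) * ((5 + n) ^ (2 * D + 2 + 2 * ⌈α⌉₊) * e) := by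
  classical
  rw [← Finset.sum_filter_add_sum_filter_not _ fun m => dist a m / ξ ≤ 4 + ν]
  refine (add_le_add
    (sum_coupling_mul_profile_near_le L hK hξ hα hβ hT hδ hκ hν hνn he hνe hW)
    (sum_coupling_mul_profile_far_le L hK hξ hα hζ hβ hpair hT hδ hκ hν hνn he hW hab)).trans
    (le_of_eq ?_)
  ring

/-- The power-law light cone of the full Hamiltonian. -/
theorem blockBound_full (L : LatticeGeometry Λ D γ K) (hK : 0 ≤ K) (hτ : 0 ≤ τ) (hg : 0 ≤ g)
    (hα : (D : ℝ) + 2 ≤ α) (hh : PowerLaw N L.size D α τ g h) {ξ σ R T δ κ k : ℝ}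
    (hξ : 1 ≤ ξ) (hσ : 0 < σ) (hσξ : σ ≤ ξ) (hR : 0 ≤ R) (hRξ : R ≤ ξ) (hT : 1 ≤ T) (hδ : 0 ≤ δ)
    (hκ : 12 ≤ κ) (hlog : δ * (σ / ξ) / κ * Real.log T ≤ 7 / 8)
    (hk : 2 * 3 ^ α ≤ k)
    (hk' : ∀ r, 2 ≤ r / ξ → 2 * Real.exp (-(r - ξ) / σ) ≤ k * profile T δ κ α (r / ξ))
    (hsmall : T * (4 * shellConst (D + 2) K *
      (K * (γ * (2 * ξ) ^ D * (τ * (σ / 2) ^ (-α + D))) * T ^ (δ / 2) +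
        2 * K * (γ * (2 * ξ) ^ D) ^ 2 * (τ * g * ξ ^ (-α)) * 9 ^ α * T ^ δ) *
      expSum (D + 2 + (2 * D + 2 + 2 * ⌈α⌉₊))) ≤ 1 / 2)
    (h₀ : ∀ s ∈ Set.Icc 0 T, N.BlockBound ξ (unitaryConj (flow (ham (truncLE L.size h (σ / 2))) s))
      fun r => 2 * Real.exp (-(r - R) / σ)) :
    ∀ s ∈ Set.Icc 0 T, N.BlockBound ξ (unitaryConj (flow (ham h) s))
      fun r => (2 * k) * profile T δ κ α (r / ξ) := by
  classical
  have hξ0 : 0 < ξ := by linarith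
  have hT0 : 0 < T := by linarith
  have hκ0 : 0 < κ := by linarith
  have hα0 : 0 ≤ α := by have : (0 : ℝ) ≤ D := Nat.cast_nonneg D
                         linarith
  have hk0 : 0 ≤ k := le_trans (by positivity) hk
  have hanti : Antitone fun r => profile T δ κ α (r / ξ) := fun r r' hrr =>
    profile_antitone hT hδ hκ0 hα0 (by gcongr)
  refine blockBound_bootstrap ξ (flow (ham h)) hk0 (φ := fun _ r => profile T δ κ α (r / ξ))
    (fun _ _ => hanti) (fun M => ⟨_, profile_pos hT, fun _ _ => le_rfl⟩) ?_
  intro M hM hMb s hs r a b X Y hX hY hXa hYb hXY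
  set φ := profile T δ κ α (r / ξ) with hφ
  have hφ0 : 0 < φ := profile_pos hT
  -- Beyond two block radii the exponential tail of the truncated evolution lies below the profile.
  -- Closer in, the profile is at least `3 ^ (-α)` and the trivial bound is enough.
  have hc : N.CommBound (unitaryConj (flow (ham (truncLE L.size h (σ / 2))) s)) X Y (k * φ) := by
    by_cases hr : 2 ≤ r / ξ
    · refine (h₀ s hs r a b X Y hX hY hXa hYb hXY).weaken subset_rfl subset_rfl
        (le_trans ?_ (hk' r hr))
      have : Real.exp (-(r - R) / σ) ≤ Real.exp (-(r - ξ) / σ) := by gcongr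
      exact mul_le_mul_of_nonneg_left this two_pos.le
    · refine (commBound_two _ X Y).weaken subset_rfl subset_rfl ?_
      have h1 := le_profile_of_le_two (T := T) (δ := δ) (κ := κ) hα0 (not_le.1 hr).le
      calc (2 : ℝ) = 2 * 3 ^ α * 3 ^ (-α) := by
            rw [mul_assoc, ← Real.rpow_add (by norm_num)]; simp
        _ ≤ k * φ := by gcongr
  set V : Finset Λ → selfAdjoint 𝒜 := fun Z => h Z - truncLE L.size h (σ / 2) Z with hVdef
  have hVor : ∀ Z, V Z = 0 ∨ σ / 2 < L.size Z ∧ V Z = h Z := by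
    intro Z
    simp only [hVdef, truncLE]
    split_ifs with hz
    · simp
    · exact Or.inr ⟨not_le.1 hz, sub_zero _⟩
  have hVmem : ∀ Z, (V Z : 𝒜) ∈ N.alg Z := by
    intro Z
    rcases hVor Z with h0 | ⟨-, h1⟩
    · rw [h0]; exact Subalgebra.zero_mem _
    · rw [h1]; exact hh.mem Z
  have hpair : ∀ i j : Λ, ∑ Z : Finset Λ with i ∈ Z ∧ j ∈ Z, ‖(V Z : 𝒜)‖ ≤
      τ * g * (dist i j + 1) ^ (-α) :=
    (hh.of_norm_le hVmem fun Z => by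
      rcases hVor Z with h0 | ⟨-, h1⟩
      · rw [h0]; simp
      · rw [h1]).pair_le
  have hβ := fun i => sum_norm_le_of_lt_size hh (half_pos hσ) hVor i
  set β := τ * (σ / 2) ^ (-α + D)
  set G₀ := K * (γ * (2 * ξ) ^ D * β) * T ^ (δ / 2) +
        2 * K * (γ * (2 * ξ) ^ D) ^ 2 * (τ * g * ξ ^ (-α)) * 9 ^ α * T ^ δ with hG₀
  have hγ0 : 0 ≤ γ := by
    have h1 := (Nat.cast_nonneg _).trans (L.card_le a 1 le_rfl)
    have h2 : (0 : ℝ) < (2 * 1) ^ D := by positivity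
    exact nonneg_of_mul_nonneg_left h1 h2
  have hG₀0 : 0 ≤ G₀ := by positivity
  set P := 2 * D + 2 + 2 * ⌈α⌉₊ with hP
  have key := commBound_perturb (L.blocks ξ hξ) hK hσ hσξ hVmem
    (show ((ham h - ham (truncLE L.size h (σ / 2)) : selfAdjoint 𝒜) : 𝒜) = _ by
      rw [ham_sub, coe_ham]) hs.1 (G := G₀ * (M * φ)) (by positivity) hX hXa hc P (fun u hu => by
    refine ⟨R, hR, hRξ, h₀ _ ⟨sub_nonneg.2 hu.2, by linarith [hu.1, hs.2]⟩, fun n => ?_⟩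
    set W := nbhd X (R + n * σ) with hW
    refine ⟨fun m => M * profile T δ κ α
      (max (r - (2 + dist a m / ξ) * ξ) (dist m b - 2 * ξ) / ξ),
      fun m _ => mul_nonneg hM (profile_pos hT).le, ?_, ?_⟩
    · intro m _ Z hZ hZW hne
      refine hMb u ⟨hu.1, hu.2.trans hs.2⟩ _ m b _ Y hne hY Finset.inter_subset_right hYb ?_
      intro i hi j hj
      have hi := mem_block.1 (Finset.mem_inter.1 hi).2
      have hj' := mem_block.1 (hYb hj)
      -- Two lower bounds for the distance from the piece in block `m` to `Y`: one through `X`, good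
      -- for nearby blocks, and one through the center `b`, good for distant ones.
      refine max_le ?_ ?_
      · obtain ⟨x, hx⟩ := hX
        have h1 := hXY x hx j hj
        have h2 := mem_block.1 (hXa hx)
        have h3 := dist_triangle x i j
        have h4 := dist_triangle4 x a m i
        rw [dist_comm x a] at h4
        have h5 : (2 + dist a m / ξ) * ξ = 2 * ξ + dist a m := by field_simp
        linarith
      · have h3 := dist_triangle4 m i j b
        rw [dist_comm j b] at h3
        linarith
    -- In units of the block radius shell `n` has moved by only `n σ / ξ`, and `(σ / ξ) log T` is
    -- bounded; so the power of `T` lost is merely exponential in `n`.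
    · have hν : T ^ (δ * (n * (σ / ξ)) / κ) ≤ Real.exp (7 * n / 8) := by
        rw [Real.rpow_def_of_pos hT0, Real.exp_le_exp]
        have := mul_le_mul_of_nonneg_left hlog (Nat.cast_nonneg n)
        calc _ = n * (δ * (σ / ξ) / κ * Real.log T) := by ring
          _ ≤ _ := this
          _ = _ := by ring
      have hσξ1 : σ / ξ ≤ 1 := by rw [div_le_one hξ0]; exact hσξ
      have hsum := sum_coupling_mul_profile_le L hK hξ hα (mul_nonneg hτ hg) hβ hpair hT hδ hκ
        (a := a) (b := b) (W := W) (n := n) (r := r) (ν := n * (σ / ξ)) (by positivity)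
        (mul_le_of_le_one_right (Nat.cast_nonneg n) hσξ1)
        (Real.one_le_exp (by positivity)) hν ?_ ?_
      · calc _ = M * ∑ m ∈ (L.blocks ξ hξ).net, coupling ξ (fun Z => (V Z : 𝒜)) W m *
            profile T δ κ α (max (r - (2 + dist a m / ξ) * ξ) (dist m b - 2 * ξ) / ξ) := by
              rw [Finset.mul_sum]
              exact Finset.sum_congr rfl fun m _ => by ring
          _ ≤ M * (G₀ * φ * ((5 + n) ^ P * Real.exp (7 * n / 8))) := by gcongr
          _ = _ := by ring
      · intro i hi
        obtain ⟨x, hx, hxi⟩ := mem_nbhd.1 hi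
        have h2 := mem_block.1 (hXa hx)
        have h3 := dist_triangle a x i
        have h4 : (2 + n * (σ / ξ)) * ξ = 2 * ξ + n * σ := by field_simp
        exact mem_block.2 (by linarith)
      · obtain ⟨x, hx⟩ := hX
        obtain ⟨z, hz⟩ := hY
        have h1 := hXY x hx z hz
        have h2 := mem_block.1 (hXa hx)
        have h3 := mem_block.1 (hYb hz)
        have h4 := dist_triangle4 x a b z
        rw [dist_comm x a] at h4
        linarith)
  refine key.weaken subset_rfl subset_rfl ?_
  have h1 : s * (4 * shellConst (D + 2) K * (G₀ * (M * φ)) * expSum (D + 2 + P)) ≤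
      1 / 2 * (M * φ) := by
    have h2 : 0 ≤ 4 * shellConst (D + 2) K * G₀ * expSum (D + 2 + P) := by
      have := shellConst_nonneg (p := D + 2) hK
      have := expSum_nonneg (D + 2 + P)
      positivity
    calc _ = s * (4 * shellConst (D + 2) K * G₀ * expSum (D + 2 + P)) * (M * φ) := by ring
      _ ≤ T * (4 * shellConst (D + 2) K * G₀ * expSum (D + 2 + P)) * (M * φ) := by
          gcongr
          exact hs.2
      _ ≤ _ := by gcongr
  calc _ ≤ k * φ + 1 / 2 * (M * φ) := by linarith
    _ = _ := by ring

end LocalNet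

/-! ### Powers of the time and the choice of the truncation exponent -/

theorem etaTilde_mul {D : ℕ} {α : ℝ} (hα : 2 * (D : ℝ) + 1 < α) :
    etaTilde D α * (α - D) = D + 1 + (α - 2 * D - 1) / 2 := by
  have hD : (0 : ℝ) ≤ D := Nat.cast_nonneg D
  have : α - D ≠ 0 := by linarith
  unfold etaTilde
  field_simp
  ring

theorem half_lt_etaTilde {D : ℕ} {α : ℝ} (hα : 2 * (D : ℝ) + 1 < α) : 1 / 2 < etaTilde D α := by
  have hD : (0 : ℝ) ≤ D := Nat.cast_nonneg D
  have h0 : 0 < α - D := by linarith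
  have h1 : (α - 2 * D - 1) / (2 * (α - D)) < 1 / 2 := by
    rw [div_lt_div_iff₀ (by linarith) two_pos]
    linarith
  unfold etaTilde
  linarith

theorem etaTilde_lt_one {D : ℕ} {α : ℝ} (hα : 2 * (D : ℝ) + 1 < α) : etaTilde D α < 1 := by
  have hD : (0 : ℝ) ≤ D := Nat.cast_nonneg D
  have : 0 < (α - 2 * D - 1) / (2 * (α - D)) := div_pos (by linarith) (by linarith)
  unfold etaTilde
  linarith

/-- The reason for the value of `etaTilde`: time, times the volume of a block, times the interaction
tail at the truncation length decays as `T^(-(α-2D-1)/2)`, half of the available exponent. The other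
half pays for the variation of the profile. -/
theorem volume_mul_tail_eq {D : ℕ} {α c T : ℝ} (hα : 2 * (D : ℝ) + 1 < α) (hT : 0 < T) :
    T * ((2 * (c * T)) ^ D * (T ^ etaTilde D α / 2) ^ (-α + D)) *
      T ^ ((α - 2 * D - 1) / 2) = (2 * c) ^ D * 2 ^ (α - D) := by
  have h1 : (T ^ etaTilde D α / 2) ^ (-α + D) = T ^ (-(D + 1 + (α - 2 * D - 1) / 2)) *
      2 ^ (α - D) := by
    rw [Real.div_rpow (Real.rpow_nonneg hT.le _) zero_le_two, ← Real.rpow_mul hT.le,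
      div_eq_mul_inv, ← Real.rpow_neg zero_le_two, ← etaTilde_mul hα]
    congr 2 <;> ring
  have h2 : T * T ^ (D : ℝ) * (T ^ (-(D + 1 + (α - 2 * D - 1) / 2))) * T ^ ((α - 2 * D - 1) / 2) = 1 := by
    rw [← Real.rpow_one_add' hT.le (by positivity), ← Real.rpow_add hT, ← Real.rpow_add hT]
    ring_nf
    exact Real.rpow_zero T
  rw [h1, ← mul_assoc 2 c T, mul_pow, ← Real.rpow_natCast T D]
  calc _ = (2 * c) ^ D * 2 ^ (α - D) * (T * T ^ (D : ℝ) *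
        (T ^ (-(D + 1 + (α - 2 * D - 1) / 2))) * T ^ ((α - 2 * D - 1) / 2)) := by ring
    _ = _ := by rw [h2, mul_one]

/-- Time, times the volumes of two blocks, times the pair decay at a block distance decays with the
whole exponent `α - 2D - 1`, the depth of the profile. -/
theorem volume_sq_mul_pair_le {D : ℕ} {α c T : ℝ} (hα : 0 ≤ α) (hc : 1 ≤ c) (hT : 0 < T) :
    T * (((2 * (c * T)) ^ D) ^ 2 * (c * T) ^ (-α)) * T ^ (α - 2 * D - 1) ≤ ((2 * c) ^ D) ^ 2 := by
  have h2 : T * (T ^ (D : ℝ) * T ^ (D : ℝ)) * T ^ (-α) * T ^ (α - 2 * D - 1) = 1 := by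
    rw [← Real.rpow_add hT, ← Real.rpow_one_add' hT.le (by positivity), ← Real.rpow_add hT,
      ← Real.rpow_add hT]
    ring_nf
    exact Real.rpow_zero T
  have h3 : c ^ (-α) ≤ 1 := Real.rpow_le_one_of_one_le_of_nonpos hc (by linarith)
  rw [Real.mul_rpow (by linarith) hT.le, ← mul_assoc 2 c T, mul_pow, ← Real.rpow_natCast T D]
  calc _ = ((2 * c) ^ D) ^ 2 * c ^ (-α) * (T * (T ^ (D : ℝ) * T ^ (D : ℝ)) * T ^ (-α) *
        T ^ (α - 2 * D - 1)) := by ring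
    _ ≤ ((2 * c) ^ D) ^ 2 * 1 * 1 := by rw [h2]; gcongr
    _ = _ := by ring

theorem rpow_le_const_mul_exp {x α : ℝ} (hx : 1 ≤ x) :
    x ^ α ≤ ⌈α⌉₊.factorial * 2 ^ ⌈α⌉₊ * Real.exp (x / 2) := by
  have h1 : x ^ α ≤ x ^ ⌈α⌉₊ := by
    rw [← Real.rpow_natCast]
    exact Real.rpow_le_rpow_of_exponent_le hx (Nat.le_ceil α)
  have h2 := Real.pow_div_factorial_le_exp (x / 2) (by linarith) ⌈α⌉₊
  rw [div_le_iff₀ (by positivity), div_pow, div_le_iff₀ (by positivity)] at h2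
  linarith

/-- Stretched exponential decay is faster than the power-law profile. -/
theorem exists_exp_le_profile {δ η κ α : ℝ} (hδ : 0 ≤ δ) (hη : η < 1) :
    ∃ k, 0 ≤ k ∧ ∀ c T ρ : ℝ, 1 ≤ c → 1 ≤ T → 2 ≤ ρ →
      2 * Real.exp (-((ρ - 1) * (c * T)) / T ^ η) ≤ k * profile T δ κ α ρ := by
  set C₁ : ℝ := ⌈δ / (1 - η)⌉₊.factorial * 2 ^ ⌈δ / (1 - η)⌉₊
  set C₂ : ℝ := ⌈α⌉₊.factorial * 2 ^ ⌈α⌉₊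
  refine ⟨2 * C₁ * (C₂ * Real.exp 1), by positivity, fun c T ρ hc hT hρ => ?_⟩
  have hT0 : 0 < T := by linarith
  set z := T ^ (1 - η) with hz
  have hz1 : 1 ≤ z := Real.one_le_rpow hT (by linarith)
  have e1 : -((ρ - 1) * (c * T)) / T ^ η = -((ρ - 1) * c * z) := by
    rw [hz, Real.rpow_sub hT0, Real.rpow_one]; ring
  -- As `z ≥ 1` and `ρ ≥ 2`, the product `(ρ - 1) z` exceeds `z/2 + (ρ - 1)/2`. The first summand
  -- beats `T^δ`, a power of `z`, and the second beats the power of `ρ`.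
  have e2 : -((ρ - 1) * c * z) ≤ -(z / 2) - (ρ - 1) / 2 := by
    have h1 : (ρ - 1) * z ≤ (ρ - 1) * c * z := by
      have : 0 ≤ (ρ - 1) * z := by nlinarith
      nlinarith
    nlinarith [mul_nonneg (sub_nonneg.2 hz1) (show (0:ℝ) ≤ ρ - 2 by linarith)]
  have e3 : T ^ δ ≤ C₁ * Real.exp (z / 2) := by
    have : T ^ δ = z ^ (δ / (1 - η)) := by
      rw [hz, ← Real.rpow_mul hT0.le]
      congr 1
      have : 1 - η ≠ 0 := by linarith
      field_simp
    rw [this]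
    exact rpow_le_const_mul_exp hz1
  have e4 : (1 + ρ) ^ α ≤ C₂ * Real.exp 1 * Real.exp ((ρ - 1) / 2) := by
    have h1 := rpow_le_const_mul_exp (x := 1 + ρ) (α := α) (by linarith)
    rw [mul_assoc, ← Real.exp_add]
    convert h1 using 3
    ring
  have hle := le_profile (T := T) (δ := δ) (κ := κ) (α := α) (ρ := ρ) hT hδ
  rw [max_eq_right (by linarith : (0 : ℝ) ≤ ρ)] at hle
  refine le_trans ?_ (mul_le_mul_of_nonneg_left hle (by positivity))
  rw [e1, Real.rpow_neg hT0.le, Real.rpow_neg (by linarith)]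
  have hTδ : 0 < T ^ δ := Real.rpow_pos_of_pos hT0 _
  have hρα : 0 < (1 + ρ) ^ α := Real.rpow_pos_of_pos (by linarith) _
  rw [← mul_inv, ← div_eq_mul_inv, le_div_iff₀ (mul_pos hTδ hρα)]
  calc 2 * Real.exp (-((ρ - 1) * c * z)) * (T ^ δ * (1 + ρ) ^ α)
      ≤ 2 * Real.exp (-(z / 2) - (ρ - 1) / 2) * ((C₁ * Real.exp (z / 2)) *
        (C₂ * Real.exp 1 * Real.exp ((ρ - 1) / 2))) := by gcongr
    _ = 2 * C₁ * (C₂ * Real.exp 1) * (Real.exp (-(z / 2) - (ρ - 1) / 2) *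
        (Real.exp (z / 2) * Real.exp ((ρ - 1) / 2))) := by ring
    _ = _ := by
      rw [← Real.exp_add, ← Real.exp_add]
      simp

theorem rpow_mul_log_le {T η : ℝ} (hT : 1 ≤ T) (hη : η < 1) :
    T ^ η / T * Real.log T ≤ 1 / (1 - η) := by
  have hT0 : 0 < T := by linarith
  have h1 : 0 < 1 - η := by linarith
  have h2 := Real.log_le_sub_one_of_pos (Real.rpow_pos_of_pos hT0 (1 - η))
  rw [Real.log_rpow hT0] at h2
  have h3 : T ^ η / T = (T ^ (1 - η))⁻¹ := by
    rw [← Real.rpow_neg hT0.le, neg_sub, Real.rpow_sub hT0, Real.rpow_one]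
  rw [h3, inv_mul_le_iff₀ (Real.rpow_pos_of_pos hT0 _), mul_one_div, le_div_iff₀ h1]
  linarith

namespace LocalNet

theorem truncLE_of_size_le {Λ 𝒜 : Type*} [CStarAlgebra 𝒜] {size : Finset Λ → ℝ} {ℓ : ℝ}
    {h : Finset Λ → selfAdjoint 𝒜} (hh : ∀ Z, h Z ≠ 0 → size Z ≤ ℓ) : truncLE size h ℓ = h := by
  funext Z
  unfold truncLE
  split_ifs with hz
  · rfl
  · by_contra hne
    exact hz (hh Z (Ne.symm hne))

end LocalNet

theorem exists_pos_mul_le_half (C : ℝ) : ∃ τ₀ : ℝ, 0 < τ₀ ∧ ∀ τ, 0 ≤ τ → τ ≤ τ₀ → τ * C ≤ 1 / 2 := by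
  refine ⟨(2 * (1 + |C|))⁻¹, by positivity, fun τ h0 h => ?_⟩
  have h1 : τ * C ≤ τ * (1 + |C|) := by
    gcongr
    linarith [le_abs_self C]
  have h2 : τ * (1 + |C|) ≤ (2 * (1 + |C|))⁻¹ * (1 + |C|) := by gcongr
  have h3 : (2 * (1 + |C|))⁻¹ * (1 + |C|) = 1 / 2 := by
    have : 1 + |C| ≠ 0 := by positivity
    field_simp
  linarith

theorem le_exp_abs (x : ℝ) : x ≤ Real.exp |x| :=
  (le_abs_self x).trans ((le_add_of_nonneg_right zero_le_one).trans (Real.add_one_le_exp _))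

/-! ### Uniform constants for small coupling -/

namespace LocalNet

/-- For small coupling, the Hamiltonian truncated at the length `T ^ η̃ / 2` has a linear light
cone with exponential tails of range `T ^ η̃` up to the time `T`. -/
theorem exists_blockBound_truncLE {D : ℕ} {α γ K : ℝ} (v : ℝ) (hα : 2 * (D : ℝ) + 1 < α)
    (hγ : 0 ≤ γ) (hK : 0 ≤ K) :
    ∃ c τ₀ : ℝ, v ≤ c ∧ 1 ≤ c ∧ 0 < τ₀ ∧
      ∀ {Λ 𝒜 : Type u} [Fintype Λ] [DecidableEq Λ] [PseudoMetricSpace Λ] [CStarAlgebra 𝒜]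
        {N : LocalNet Λ 𝒜} (L : LatticeGeometry Λ D γ K) {τ g : ℝ} {h : Finset Λ → selfAdjoint 𝒜},
        0 ≤ τ → τ ≤ τ₀ → PowerLaw N L.size D α τ g h → ∀ n : ℕ, ∀ s ∈ Set.Icc (0 : ℝ) (2 ^ n),
          N.BlockBound (c * 2 ^ n)
            (unitaryConj (flow (ham (truncLE L.size h (((2 : ℝ) ^ n) ^ etaTilde D α / 2))) s))
            fun r => 2 * Real.exp (-(r - c * 2 ^ n) / ((2 : ℝ) ^ n) ^ etaTilde D α) := by
  have hη1 := half_lt_etaTilde hα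
  have hη2 := etaTilde_lt_one hα
  set η := etaTilde D α with hη
  -- With this `θ` the range at scale `n` is `θ^{2n} = (2^n)^η`. The numerical conditions on `θ`
  -- translate `1/2 < η < 1`.
  set θ : ℝ := 2 ^ (η / 2) with hθ
  have hθsq : θ ^ 2 = 2 ^ η := by
    rw [hθ, ← Real.rpow_mul_natCast zero_le_two]
    norm_num
  have hθn : ∀ n : ℕ, (θ ^ 2) ^ n = ((2 : ℝ) ^ n) ^ η := fun n => by
    rw [hθsq, ← Real.rpow_mul_natCast zero_le_two, mul_comm, Real.rpow_natCast_mul zero_le_two]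
  have hθ0 : 0 < θ := Real.rpow_pos_of_pos two_pos _
  have hθ2 : θ ^ 2 < 2 := by
    rw [hθsq]
    exact (Real.rpow_lt_rpow_of_exponent_lt one_lt_two hη2).trans_eq (Real.rpow_one 2)
  have hθ4 : 2 ≤ (θ ^ 2) ^ 2 := by
    rw [hθsq, ← Real.rpow_mul_natCast zero_le_two]
    calc (2 : ℝ) = 2 ^ (1 : ℝ) := (Real.rpow_one 2).symm
      _ ≤ _ := Real.rpow_le_rpow_of_exponent_le one_le_two (by push_cast; linarith)
  have hθ3 : 7 / 5 ≤ θ ^ 2 := by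
    by_contra! hlt
    nlinarith [sq_nonneg θ]
  have hθ1 : 8 / 7 ≤ θ := by
    by_contra! hlt
    nlinarith
  set S := shellConst (D + 2) K
  set M₁ := |2 * S * K * expSum (2 * (D + 2))|
  set M₂ := |4 * (K * 4 ^ (D + 2)) ^ 2|
  set y := 5 * (1 + M₂)
  set A := y + 2 + 2 * M₁
  set V := A / (1 - θ ^ 2 / 2)
  have hM₁ : 0 ≤ M₁ := abs_nonneg _
  have hM₂ : 0 ≤ M₂ := abs_nonneg _
  have hy : 0 ≤ y := by positivity
  have hV : 0 ≤ V := div_nonneg (by positivity) (by linarith)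
  set c := max (V + y + 2) v
  have hc : V + y + 2 ≤ c := le_max_left _ _
  obtain ⟨τ₀, hτ₀, hτ⟩ := exists_pos_mul_le_half
    (4 * S * K * γ * Real.exp (1 + y) * expSum (D + 2 + (D + 2 + D)) *
      ((2 * c) ^ D * 2 ^ (α - D)))
  refine ⟨c, τ₀, le_max_right _ _, by linarith, hτ₀, ?_⟩
  intro Λ 𝒜 _ _ _ _ N L τ g h hτ1 hτ2 hh n s hs
  have key := blockBound_truncLE L hK hh (c := c) hθ1 hθ2 hθ3 hM₁ hM₂ (le_exp_abs _)
    (le_exp_abs _) rfl rfl rfl hc ?_ n s hs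
  · rw [hθn] at key
    have hσ : 0 < ((2 : ℝ) ^ n) ^ η := by positivity
    refine key.exp_mono le_rfl hσ le_rfl ?_
    have h1 : ((2 : ℝ) ^ n) ^ η ≤ 2 ^ n := by
      conv_rhs => rw [← Real.rpow_one ((2 : ℝ) ^ n)]
      exact Real.rpow_le_rpow_of_exponent_le (one_le_pow₀ one_le_two) hη2.le
    calc V * s + y * ((2 : ℝ) ^ n) ^ η ≤ V * 2 ^ n + y * 2 ^ n := by
          gcongr
          exact hs.2
      _ = (V + y) * 2 ^ n := by ring
      _ ≤ c * 2 ^ n := by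
          gcongr
          linarith
  · intro m
    refine le_trans ?_ (hτ τ hτ1 hτ2)
    have hT : (0 : ℝ) < 2 ^ m := by positivity
    have e := volume_mul_tail_eq (c := c) hα hT
    have hδ : 1 ≤ ((2 : ℝ) ^ m) ^ ((α - 2 * D - 1) / 2) :=
      Real.one_le_rpow (one_le_pow₀ one_le_two) (by linarith)
    have hS : 0 ≤ S := shellConst_nonneg hK
    have hE := expSum_nonneg (D + 2 + (D + 2 + D))
    rw [hθn]
    have e2 : (2 : ℝ) ^ m * ((2 * (c * 2 ^ m)) ^ D * (((2 : ℝ) ^ m) ^ η / 2) ^ (-α + D)) ≤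
        (2 * c) ^ D * 2 ^ (α - D) := by
      rw [← e]
      exact le_mul_of_one_le_right (by positivity) hδ
    calc _ = τ * (4 * S * K * γ * Real.exp (1 + y) * expSum (D + 2 + (D + 2 + D)) *
          ((2 : ℝ) ^ m * ((2 * (c * 2 ^ m)) ^ D * (((2 : ℝ) ^ m) ^ η / 2) ^ (-α + D)))) := by ring
      _ ≤ _ := by gcongr

/-- For small coupling, the commutators of blocks of radius `c T` under the full dynamics up to
the time `T` decay like the power-law profile. -/
theorem exists_blockBound_full {D : ℕ} {α γ K g c κ : ℝ} (hα : 2 * (D : ℝ) + 1 < α)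
    (hα' : (D : ℝ) + 2 ≤ α) (hK : 0 ≤ K) (hg : 0 ≤ g) (hc : 1 ≤ c) (hκ : 12 ≤ κ)
    (hκ' : (α - 2 * D - 1) * (1 / (1 - etaTilde D α)) ≤ 7 / 8 * κ) :
    ∃ k τ₀ : ℝ, 0 ≤ k ∧ 0 < τ₀ ∧
      ∀ {Λ 𝒜 : Type u} [Fintype Λ] [DecidableEq Λ] [PseudoMetricSpace Λ] [CStarAlgebra 𝒜]
        {N : LocalNet Λ 𝒜} (L : LatticeGeometry Λ D γ K) {τ T : ℝ}
        {h : Finset Λ → selfAdjoint 𝒜},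
        0 ≤ τ → τ ≤ τ₀ → PowerLaw N L.size D α τ g h → 1 ≤ T →
        (∀ s ∈ Set.Icc 0 T, N.BlockBound (c * T)
          (unitaryConj (flow (ham (truncLE L.size h (T ^ etaTilde D α / 2))) s))
          fun r => 2 * Real.exp (-(r - c * T) / T ^ etaTilde D α)) →
        ∀ s ∈ Set.Icc 0 T, N.BlockBound (c * T) (unitaryConj (flow (ham h) s))
          fun r => k * profile T (α - 2 * D - 1) κ α (r / (c * T)) := by
  have hη1 := half_lt_etaTilde hα
  have hη2 := etaTilde_lt_one hα
  set η := etaTilde D α with hη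
  set δ := α - 2 * D - 1 with hδ
  have hδ0 : 0 ≤ δ := by linarith
  obtain ⟨k₀, hk₀, hk⟩ := exists_exp_le_profile (κ := κ) (α := α) hδ0 hη2
  set k := max k₀ (2 * 3 ^ α)
  set S := shellConst (D + 2) K
  set E := expSum (D + 2 + (2 * D + 2 + 2 * ⌈α⌉₊))
  have hS : 0 ≤ S := shellConst_nonneg hK
  have hE : 0 ≤ E := expSum_nonneg _
  obtain ⟨τ₀, hτ₀, hτ⟩ := exists_pos_mul_le_half
    (4 * S * E * (K * γ * ((2 * c) ^ D * 2 ^ (α - D)) +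
      2 * K * γ ^ 2 * g * 9 ^ α * ((2 * c) ^ D) ^ 2))
  refine ⟨2 * k, τ₀, mul_nonneg zero_le_two (hk₀.trans (le_max_left _ _)), hτ₀, ?_⟩
  intro Λ 𝒜 _ _ _ _ N L τ T h hτ1 hτ2 hh hT h₀
  have hT0 : 0 < T := by linarith
  have hσ : 0 < T ^ η := Real.rpow_pos_of_pos hT0 _
  have hξ : 1 ≤ c * T := one_le_mul_of_one_le_of_one_le hc hT
  have hσT : T ^ η ≤ T := by
    conv_rhs => rw [← Real.rpow_one T]
    exact Real.rpow_le_rpow_of_exponent_le hT hη2.le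
  have hσξ : T ^ η ≤ c * T := hσT.trans (le_mul_of_one_le_left hT0.le hc)
  have hlogT := Real.log_nonneg hT
  refine blockBound_full L hK hτ1 hg hα' hh hξ hσ hσξ (by linarith) le_rfl hT hδ0 hκ ?_
    (le_max_right _ _) ?_ ?_ h₀
  · have h1 : T ^ η / (c * T) * Real.log T ≤ 1 / (1 - η) := by
      refine le_trans ?_ (rpow_mul_log_le hT hη2)
      gcongr
      exact le_mul_of_one_le_left hT0.le hc
    calc δ * (T ^ η / (c * T)) / κ * Real.log T
        = δ * (T ^ η / (c * T) * Real.log T) / κ := by ring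
      _ ≤ δ * (1 / (1 - η)) / κ := by gcongr
      _ ≤ 7 / 8 := by rwa [div_le_iff₀ (by linarith)]
  · intro r hr
    refine le_trans ?_ ((hk c T (r / (c * T)) hc hT hr).trans
      (mul_le_mul_of_nonneg_right (le_max_left _ _) (profile_pos hT).le))
    rw [sub_mul, div_mul_cancel₀ _ (by positivity), one_mul]
  · refine le_trans ?_ (hτ τ hτ1 hτ2)
    -- The nearby and the distant couplings are bounded uniformly in `T`; the remaining factor `τ`
    -- makes them small.
    have e1 := volume_mul_tail_eq (c := c) hα hT0
    have e2 := volume_sq_mul_pair_le (D := D) (α := α) (by linarith) hc hT0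
    calc _ = τ * (4 * S * E * (K * γ *
            (T * ((2 * (c * T)) ^ D * (T ^ η / 2) ^ (-α + D)) * T ^ (δ / 2)) +
          2 * K * γ ^ 2 * g * 9 ^ α * (T * (((2 * (c * T)) ^ D) ^ 2 * (c * T) ^ (-α)) * T ^ δ))) := by
          ring
      _ ≤ _ := by rw [e1]; gcongr

/-- Propagation under the full dynamics composed with a dynamics of short range, for small
coupling. -/
theorem exists_commBound_flow_mul_flow {D : ℕ} {α γ K g : ℝ} (v : ℝ) (hα : 2 * (D : ℝ) + 1 < α)
    (hα' : (D : ℝ) + 2 ≤ α) (hγ : 0 ≤ γ) (hK : 0 ≤ K) (hg : 0 ≤ g) :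
    ∃ c τ J ρ₀ : ℝ, v ≤ c ∧ 1 ≤ c ∧ 0 < τ ∧ τ ≤ 1 / 4 ∧ 0 ≤ J ∧ 0 ≤ ρ₀ ∧
      ∀ {Λ 𝒜 : Type u} [Fintype Λ] [DecidableEq Λ] [PseudoMetricSpace Λ] [CStarAlgebra 𝒜]
        {N : LocalNet Λ 𝒜} (L : LatticeGeometry Λ D γ K)
        {h₁ h₂ : Finset Λ → selfAdjoint 𝒜},
        PowerLaw N L.size D α τ g h₁ → PowerLaw N L.size D α τ g h₂ → ∀ n : ℕ,
        (∀ Z, h₂ Z ≠ 0 → L.size Z ≤ ((2 : ℝ) ^ n) ^ etaTilde D α / 2) →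
        ∀ s ∈ Set.Icc (0 : ℝ) (2 ^ n), ∀ (r : ℝ) (a b : Λ) (X Y : Finset Λ), X.Nonempty →
          Y.Nonempty → X ⊆ block a (c * 2 ^ n) → Y ⊆ block b (c * 2 ^ n) → Apart r X Y →
          ρ₀ * (c * 2 ^ n) ≤ r →
          N.CommBound (unitaryConj (flow (ham h₁) s * flow (ham h₂) s)) X Y
            (J * (2 ^ n) ^ (2 * D + 1) * r ^ (-α)) := by
  have hη1 := half_lt_etaTilde hα
  have hη2 := etaTilde_lt_one hα
  have hα0 : 0 ≤ α := by
    have : (0 : ℝ) ≤ D := Nat.cast_nonneg D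
    linarith
  obtain ⟨c, τ₁, hvc, hc, hτ₁, htr⟩ := exists_blockBound_truncLE v hα hγ hK
  set η := etaTilde D α with hη
  set δ := α - 2 * D - 1 with hδ
  have hδ0 : 0 ≤ δ := by linarith
  -- The budget `e^{7m/8}` for shell `m` is shared: `e^{m/2}` for the polynomial loss of the profile
  -- and `e^{3m/8}` for its power of `T`. Hence the 8/3.
  set κ := max 12 (8 / 3 * (δ * (1 / (1 - η)))) with hκdef
  have hκ : 12 ≤ κ := le_max_left _ _
  have hκ0 : 0 < κ := by linarith
  have hκ2 : δ * (1 / (1 - η)) ≤ 3 / 8 * κ := by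
    have : 8 / 3 * (δ * (1 / (1 - η))) ≤ κ := le_max_right _ _
    linarith
  obtain ⟨k, τ₂, hk, hτ₂, hfull⟩ := exists_blockBound_full (g := g) hα hα' hK hg hc hκ
    (by linarith)
  set τ := min (min τ₁ τ₂) (1 / 4) with hτdef
  have hτ0 : 0 < τ := by positivity
  have hττ₁ : τ ≤ τ₁ := (min_le_left _ _).trans (min_le_left _ _)
  have hττ₂ : τ ≤ τ₂ := (min_le_left _ _).trans (min_le_right _ _)
  set S := shellConst (D + 2) K
  set E := expSum (2 * (D + 2))
  have hS : 0 ≤ S := shellConst_nonneg hK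
  have hE : 0 ≤ E := expSum_nonneg _
  set C : ℝ := ⌈α⌉₊.factorial * 2 ^ ⌈α⌉₊ * Real.exp (1 / 2)
  have hC : 0 ≤ C := by positivity
  refine ⟨c, τ, 2 * S * K * E * (k * C * c ^ α), 3 + κ, hvc, hc, hτ0, min_le_right _ _,
    by positivity, by positivity, ?_⟩
  intro Λ 𝒜 _ _ _ _ N L h₁ h₂ hh₁ hh₂ n hsize s hs r a b X Y hX hY hXa hYb hXY hr
  set T : ℝ := 2 ^ n with hTdef
  have hT : 1 ≤ T := one_le_pow₀ one_le_two
  have hT0 : 0 < T := by linarith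
  have hξ1 : 1 ≤ c * T := one_le_mul_of_one_le_of_one_le hc hT
  have hξ0 : 0 < c * T := by linarith
  have hσ : 0 < T ^ η := Real.rpow_pos_of_pos hT0 _
  have hσT : T ^ η ≤ T := by
    conv_rhs => rw [← Real.rpow_one T]
    exact Real.rpow_le_rpow_of_exponent_le hT hη2.le
  have hσξ : T ^ η ≤ c * T := hσT.trans (le_mul_of_one_le_left hT0.le hc)
  have hu := htr L hτ0.le hττ₁ hh₂ n s hs
  rw [truncLE_of_size_le hsize] at hu
  have hv := hfull L hτ0.le hττ₂ hh₁ hT (htr L hτ0.le hττ₁ hh₁ n) s hs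
  set ρ := r / (c * T) with hρdef
  have hρ : 3 + κ ≤ ρ := by rwa [hρdef, le_div_iff₀ hξ0]
  -- The light cone of the inner evolution has radius one block and uses up one unit of `ρ`. From `3
  -- + κ` on, the profile at `ρ - 1` is already on its plateau.
  have hprof : profile T δ κ α (ρ - 1) = T ^ (-δ) * ρ ^ (-α) := by
    rw [profile_of_le hκ0 (by linarith)]
    congr 2
    ring
  have hρα : 0 ≤ T ^ (-δ) * ρ ^ (-α) := by
    have := Real.rpow_nonneg (show 0 ≤ ρ by linarith) (-α)
    positivity
  have h3 := commBound_mul (L.blocks _ hξ1) hK hσ hσξ hξ0.le le_rfl hu hv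
    (fun r => mul_nonneg hk (profile_pos hT).le) hX hY hXa hYb hXY
    (F := k * C * (T ^ (-δ) * ρ ^ (-α))) (by positivity) ?_
  · refine h3.weaken subset_rfl subset_rfl (le_of_eq ?_)
    have e1 : ρ ^ (-α) = r ^ (-α) * (c ^ α * T ^ α) := by
      have hr0 : 0 ≤ r := le_trans (by positivity) hr
      rw [hρdef, Real.div_rpow hr0 hξ0.le, Real.rpow_neg hξ0.le, div_inv_eq_mul,
        Real.mul_rpow (by linarith) hT0.le]
    have e2 : T ^ (-δ) * T ^ α = T ^ (2 * D + 1) := by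
      rw [← Real.rpow_add hT0, ← Real.rpow_natCast]
      congr 1
      push_cast
      ring
    rw [e1, ← e2]
    ring
  · intro m
    have hx : (0 : ℝ) ≤ m * (T ^ η / (c * T)) := by positivity
    have e0 : (r - (c * T + m * T ^ η)) / (c * T) = (ρ - 1) - m * (T ^ η / (c * T)) := by
      rw [hρdef]
      field_simp
      ring
    have hq1 : T ^ η / (c * T) ≤ 1 := (div_le_one hξ0).2 hσξ
    have h4 := profile_sub_le (ρ := ρ - 1) hT hδ0 hκ0 hα0 hx
    have h5 : (1 + m * (T ^ η / (c * T))) ^ α ≤ C * Real.exp (m / 2) := by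
      calc (1 + m * (T ^ η / (c * T))) ^ α ≤ (1 + (m : ℝ)) ^ α := by
            gcongr
            exact mul_le_of_le_one_right (Nat.cast_nonneg m) hq1
        _ ≤ _ := rpow_le_const_mul_exp (by linarith [Nat.cast_nonneg (α := ℝ) m])
        _ = _ := by
            rw [mul_assoc (_ * _), ← Real.exp_add]
            ring_nf
    have h6 : T ^ (δ * (m * (T ^ η / (c * T))) / κ) ≤ Real.exp (3 * m / 8) := by
      rw [Real.rpow_def_of_pos hT0, Real.exp_le_exp]
      have h7 : T ^ η / (c * T) * Real.log T ≤ 1 / (1 - η) := by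
        refine le_trans ?_ (rpow_mul_log_le hT hη2)
        have := Real.log_nonneg hT
        gcongr
        exact le_mul_of_one_le_left hT0.le hc
      calc Real.log T * (δ * (m * (T ^ η / (c * T))) / κ)
          = m * (δ * (T ^ η / (c * T) * Real.log T) / κ) := by ring
        _ ≤ m * (δ * (1 / (1 - η)) / κ) := by gcongr
        _ ≤ m * (3 / 8) := by
            refine mul_le_mul_of_nonneg_left ?_ (Nat.cast_nonneg m)
            rwa [div_le_iff₀ hκ0]
        _ = 3 * m / 8 := by ring
    rw [hprof] at h4
    rw [e0]
    calc k * profile T δ κ α (ρ - 1 - m * (T ^ η / (c * T)))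
        ≤ k * ((C * Real.exp (m / 2)) * Real.exp (3 * m / 8) * (T ^ (-δ) * ρ ^ (-α))) := by
          gcongr
          refine h4.trans ?_
          gcongr
      _ = (Real.exp (m / 2) * Real.exp (3 * m / 8)) * (k * C * (T ^ (-δ) * ρ ^ (-α))) := by ring
      _ = _ := by
          rw [← Real.exp_add]
          ring_nf

end LocalNet

/-! ### The local operator algebras of a spin system -/

section SpinSystem

variable {Λ : Type*} {q : Λ → ℕ}

/-- The configuration obtained by permuting the basis states of each site. -/
def permSites (σ : ∀ i, Equiv.Perm (Fin (q i))) : Equiv.Perm (Config q) := Equiv.piCongrRight σ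

theorem permSites_apply (σ : ∀ i, Equiv.Perm (Fin (q i))) (s : Config q) (i : Λ) :
    permSites σ s i = σ i (s i) := rfl

theorem permSites_eq_self_of {X : Finset Λ} {σ : ∀ i, Equiv.Perm (Fin (q i))}
    (hσ : ∀ i ∈ X, σ i = 1) (s : Config q) {i : Λ} (hi : i ∈ X) : permSites σ s i = s i := by
  rw [permSites_apply, hσ i hi, Equiv.Perm.one_apply]

/-- A character of the group of signs of the basis states of the sites. -/
def signChar (Y : Finset Λ) (ε : ∀ i, Fin (q i) → ℤˣ) (s : Config q) : ℂ :=
  ∏ i ∈ Y, ((ε i (s i) : ℤ) : ℂ)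

theorem signChar_mul_self (Y : Finset Λ) (ε : ∀ i, Fin (q i) → ℤˣ) (s : Config q) :
    signChar Y ε s * signChar Y ε s = 1 := by
  rw [signChar, ← Finset.prod_mul_distrib]
  refine Finset.prod_eq_one fun i _ => ?_
  rw [← Int.cast_mul, ← Units.val_mul, Int.units_mul_self]
  simp

theorem star_signChar (Y : Finset Λ) (ε : ∀ i, Fin (q i) → ℤˣ) (s : Config q) :
    star (signChar Y ε s) = signChar Y ε s := by
  simp [signChar]

theorem signChar_congr {Y : Finset Λ} (ε : ∀ i, Fin (q i) → ℤˣ) {s s' : Config q}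
    (h : ∀ i ∈ Y, s i = s' i) : signChar Y ε s = signChar Y ε s' :=
  Finset.prod_congr rfl fun i hi => by rw [h i hi]

variable [Fintype Λ] [DecidableEq Λ]

/-- The operators which act as the identity outside of `X`: they do not change the sites outside
of `X`, and their matrix elements do not depend on those sites. -/
def localAlg (q : Λ → ℕ) (X : Finset Λ) : Subalgebra ℂ (Op q) where
  carrier := {A | (∀ s s' : Config q, (∃ i, i ∉ X ∧ s i ≠ s' i) → A s s' = 0) ∧
    ∀ σ : ∀ i, Equiv.Perm (Fin (q i)), (∀ i ∈ X, σ i = 1) →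
      ∀ s s' : Config q, A (permSites σ s) (permSites σ s') = A s s'}
  mul_mem' := by
    rintro A B ⟨hA, hA'⟩ ⟨hB, hB'⟩
    refine ⟨?_, ?_⟩
    · rintro s s' ⟨i, hi, hne⟩
      rw [Matrix.mul_apply]
      refine Finset.sum_eq_zero fun u _ => ?_
      by_cases hu : s i = u i
      · rw [hB u s' ⟨i, hi, hu ▸ hne⟩, mul_zero]
      · rw [hA s u ⟨i, hi, hu⟩, zero_mul]
    · intro σ hσ s s'
      rw [Matrix.mul_apply, Matrix.mul_apply, ← Equiv.sum_comp (permSites σ)]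
      simp only [hA' σ hσ, hB' σ hσ]
  add_mem' := by
    rintro A B ⟨hA, hA'⟩ ⟨hB, hB'⟩
    refine ⟨fun s s' h => ?_, fun σ hσ s s' => ?_⟩
    · rw [Matrix.add_apply, hA s s' h, hB s s' h, add_zero]
    · rw [Matrix.add_apply, Matrix.add_apply, hA' σ hσ, hB' σ hσ]
  algebraMap_mem' c := by
    refine ⟨fun s s' ⟨i, _, hne⟩ => ?_, fun σ _ s s' => ?_⟩
    · rw [Matrix.algebraMap_matrix_apply, if_neg fun h => hne (congrFun h i)]
    · simp only [Matrix.algebraMap_matrix_apply, EmbeddingLike.apply_eq_iff_eq]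

theorem SupportedOn.mem_localAlg {X : Finset Λ} {A : Op q} (hA : SupportedOn X A) :
    A ∈ localAlg q X := by
  obtain ⟨a, ha, ha'⟩ := hA
  refine ⟨ha', fun σ hσ s s' => ?_⟩
  by_cases h : ∀ i, i ∉ X → s i = s' i
  · rw [ha s s' h, ha _ _ fun i hi => by simp [permSites_apply, h i hi]]
    congr 1 <;> funext i <;> exact permSites_eq_self_of hσ _ i.2
  · push Not at h
    obtain ⟨i, hi, hne⟩ := h
    rw [ha' s s' ⟨i, hi, hne⟩, ha' _ _ ⟨i, hi, by simpa [permSites_apply] using hne⟩]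

theorem localAlg_mono {X Y : Finset Λ} (hXY : X ⊆ Y) : localAlg q X ≤ localAlg q Y :=
  fun _ ⟨hA, hA'⟩ => ⟨fun s s' ⟨i, hi, hne⟩ => hA s s' ⟨i, fun h => hi (hXY h), hne⟩,
    fun σ hσ => hA' σ fun i hi => hσ i (hXY hi)⟩

theorem mem_localAlg_univ (A : Op q) : A ∈ localAlg q Finset.univ := by
  refine ⟨fun s s' ⟨i, hi, _⟩ => absurd (Finset.mem_univ i) hi, fun σ hσ s s' => ?_⟩
  have h : ∀ s, permSites σ s = s := fun s => funext fun i =>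
    permSites_eq_self_of hσ s (Finset.mem_univ i)
  rw [h, h]

/-- `A` changes only sites of `X` and `B` only sites of `Y`, so a single intermediate configuration
contributes: `s'` on `X` and `s` elsewhere. -/
theorem localAlg_mul_apply {X Y : Finset Λ} (hXY : Disjoint X Y) {A B : Op q}
    (hA : A ∈ localAlg q X) (hB : B ∈ localAlg q Y) (s s' : Config q) :
    (A * B) s s' = A s (X.piecewise s' s) * B (X.piecewise s' s) s' := by
  rw [Matrix.mul_apply]
  refine Finset.sum_eq_single _ (fun u _ hu => ?_) (fun h => absurd (Finset.mem_univ _) h)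
  obtain ⟨i, hi⟩ := Function.ne_iff.1 hu
  by_cases hiX : i ∈ X
  · rw [Finset.piecewise_eq_of_mem _ _ _ hiX] at hi
    rw [hB.1 u s' ⟨i, Finset.disjoint_left.1 hXY hiX, hi⟩, mul_zero]
  · rw [Finset.piecewise_eq_of_notMem _ _ _ hiX] at hi
    rw [hA.1 s u ⟨i, hiX, hi.symm⟩, zero_mul]

/-- Exchanging `s i` and `s' i` at every site outside `X` carries the first pair of configurations
to the second, and matrix elements of `A` are invariant under such permutations. -/
theorem localAlg_apply_piecewise {X Y : Finset Λ} (hXY : Disjoint X Y) {A : Op q}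
    (hA : A ∈ localAlg q X) {s s' : Config q} (h : ∀ i, i ∉ X → i ∉ Y → s i = s' i) :
    A s (X.piecewise s' s) = A (Y.piecewise s' s) s' := by
  rw [← hA.2 (fun i => if i ∈ X then 1 else Equiv.swap (s i) (s' i))
    (fun i hi => if_pos hi) s (X.piecewise s' s)]
  congr 1
  · funext i
    rw [permSites_apply]
    by_cases hiX : i ∈ X
    · simp [hiX, Finset.disjoint_left.1 hXY hiX]
    · by_cases hiY : i ∈ Y
      · simp [hiX, hiY]
      · simp [hiX, hiY, h i hiX hiY]
  · funext i
    rw [permSites_apply]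
    by_cases hiX : i ∈ X <;> simp [hiX]

theorem localAlg_comm {X Y : Finset Λ} (hXY : Disjoint X Y) {A B : Op q}
    (hA : A ∈ localAlg q X) (hB : B ∈ localAlg q Y) : A * B = B * A := by
  ext s s'
  rw [localAlg_mul_apply hXY hA hB, localAlg_mul_apply hXY.symm hB hA]
  by_cases h : ∀ i, i ∉ X → i ∉ Y → s i = s' i
  · rw [localAlg_apply_piecewise hXY hA h,
      localAlg_apply_piecewise hXY.symm hB fun i hi hi' => h i hi' hi, mul_comm]
  · push Not at h
    obtain ⟨i, hiX, hiY, hne⟩ := h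
    rw [hB.1 _ s' ⟨i, hiY, by simpa [hiX] using hne⟩,
      hA.1 _ s' ⟨i, hiX, by simpa [hiY] using hne⟩, mul_zero, mul_zero]

/-- Flipping the sign attached to the basis state `s i` at the site `i` is a bijection of the sign
families that negates every summand. -/
theorem sum_signChar_mul_eq_zero {Y : Finset Λ} {s s' : Config q} {i : Λ} (hi : i ∈ Y)
    (hne : s i ≠ s' i) :
    ∑ ε : ∀ i, Fin (q i) → ℤˣ, signChar Y ε s * signChar Y ε s' = 0 := by
  set δ : ∀ i, Fin (q i) → ℤˣ := Pi.mulSingle i (Pi.mulSingle (s i) (-1)) with hδ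
  have hmul : ∀ (ε : ∀ i, Fin (q i) → ℤˣ) (u : Config q),
      signChar Y (ε * δ) u = signChar Y ε u * signChar Y δ u := fun ε u => by
    simp [signChar, Finset.prod_mul_distrib]
  have hδ' : ∀ (u : Config q), signChar Y δ u = if u i = s i then -1 else 1 := fun u => by
    rw [signChar, Finset.prod_eq_single_of_mem i hi fun j _ hj => by
      simp [hδ, Pi.mulSingle_eq_of_ne hj]]
    rw [hδ, Pi.mulSingle_eq_same]
    split_ifs with h
    · rw [h, Pi.mulSingle_eq_same]
      simp
    · rw [Pi.mulSingle_eq_of_ne h]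
      simp
  have h := Equiv.sum_comp (Equiv.mulRight δ)
    (fun ε : ∀ i, Fin (q i) → ℤˣ => signChar Y ε s * signChar Y ε s')
  simp only [Equiv.coe_mulRight, hmul, hδ', if_true, if_neg hne.symm] at h
  have h2 : ∀ ε : ∀ i, Fin (q i) → ℤˣ, signChar Y ε s * -1 * (signChar Y ε s' * 1) =
      -(signChar Y ε s * signChar Y ε s') := fun ε => by ring
  simp only [h2, Finset.sum_neg_distrib] at h
  exact self_eq_neg.1 h.symm

/-- The labels of the signed permutation operators. -/
abbrev SignedPerm (q : Λ → ℕ) : Type _ :=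
  (∀ i, Equiv.Perm (Fin (q i))) × (∀ i, Fin (q i) → ℤˣ)

/-- The restriction to the sites of `Y` of a family of permutations. -/
def restrictPerm (Y : Finset Λ) (σ : ∀ i, Equiv.Perm (Fin (q i))) :
    ∀ i, Equiv.Perm (Fin (q i)) := fun i => if i ∈ Y then σ i else 1

/-- The signed permutation operators acting on the sites of `Y`. -/
def signedPermOp (Y : Finset Λ) (g : SignedPerm q) : Op q := Matrix.of fun s s' =>
  if permSites (restrictPerm Y g.1) s = s' then signChar Y g.2 s' else 0

theorem signedPermOp_apply (Y : Finset Λ) (g : SignedPerm q) (s s' : Config q) :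
    signedPermOp Y g s s' =
      if permSites (restrictPerm Y g.1) s = s' then signChar Y g.2 s' else 0 := rfl

theorem signedPermOp_mul_mul_star_apply (Y : Finset Λ) (g : SignedPerm q) (A : Op q)
    (s s' : Config q) :
    (signedPermOp Y g * A * star (signedPermOp Y g)) s s' =
      signChar Y g.2 (permSites (restrictPerm Y g.1) s) *
        signChar Y g.2 (permSites (restrictPerm Y g.1) s') *
        A (permSites (restrictPerm Y g.1) s) (permSites (restrictPerm Y g.1) s') := by
  simp only [Matrix.mul_apply, Matrix.star_apply, signedPermOp_apply, ite_mul, zero_mul,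
    Finset.sum_ite_eq, Finset.mem_univ, if_true, apply_ite star, star_zero, mul_ite, mul_zero,
    star_signChar]
  ring

theorem signedPermOp_mem_unitary (Y : Finset Λ) (g : SignedPerm q) :
    signedPermOp Y g ∈ unitary (Op q) := by
  refine Matrix.mem_unitaryGroup_iff.2 ?_
  ext s s'
  have := signedPermOp_mul_mul_star_apply Y g 1 s s'
  rw [mul_one] at this
  rw [this, Matrix.one_apply, Matrix.one_apply]
  simp only [EmbeddingLike.apply_eq_iff_eq]
  split_ifs with h
  · rw [h, signChar_mul_self, mul_one]
  · rw [mul_zero]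

theorem signedPermOp_mem (Y : Finset Λ) (g : SignedPerm q) :
    signedPermOp Y g ∈ localAlg q Y := by
  refine ⟨fun s s' ⟨i, hi, hne⟩ => ?_, fun σ hσ s s' => ?_⟩
  · rw [signedPermOp_apply, if_neg]
    intro h
    have := congrFun h i
    rw [permSites_apply, restrictPerm, if_neg hi] at this
    exact hne this
  · have hcomm : permSites (restrictPerm Y g.1) (permSites σ s) =
        permSites σ (permSites (restrictPerm Y g.1) s) := by
      funext i
      simp only [permSites_apply, restrictPerm]
      split_ifs with hi
      · simp [hσ i hi]
      · rfl
    rw [signedPermOp_apply, signedPermOp_apply, hcomm]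
    simp only [EmbeddingLike.apply_eq_iff_eq]
    rw [signChar_congr g.2 fun i hi => permSites_eq_self_of hσ s' hi]

/-- The average over the signed permutation operators acting on the sites of `Y`. -/
noncomputable def siteExpect (Y : Finset Λ) : Op q →ₗ[ℂ] Op q where
  toFun A := ((Fintype.card (SignedPerm q) : ℝ)⁻¹ : ℂ) •
    ∑ g : SignedPerm q, signedPermOp Y g * A * star (signedPermOp Y g)
  map_add' A B := by simp only [mul_add, add_mul, Finset.sum_add_distrib, smul_add]
  map_smul' c A := by
    simp only [mul_smul_comm, smul_mul_assoc, ← Finset.smul_sum, RingHom.id_apply]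
    rw [smul_comm]

theorem siteExpect_apply (Y : Finset Λ) (A : Op q) (s s' : Config q) :
    siteExpect Y A s s' = ((Fintype.card (SignedPerm q) : ℝ)⁻¹ : ℂ) *
      ∑ σ : ∀ i, Equiv.Perm (Fin (q i)), (∑ ε : ∀ i, Fin (q i) → ℤˣ,
        signChar Y ε (permSites (restrictPerm Y σ) s) *
          signChar Y ε (permSites (restrictPerm Y σ) s')) *
        A (permSites (restrictPerm Y σ) s) (permSites (restrictPerm Y σ) s') := by
  rw [siteExpect]
  simp only [LinearMap.coe_mk, AddHom.coe_mk, Matrix.smul_apply, Matrix.sum_apply,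
    signedPermOp_mul_mul_star_apply, Fintype.sum_prod_type, Finset.sum_mul, smul_eq_mul]

/-- Averaging over signs kills the matrix elements that change a site of `Y`. Averaging over
permutations makes the others independent of the sites of `Y`. -/
theorem siteExpect_mem (Y : Finset Λ) {W : Finset Λ} {A : Op q} (hA : A ∈ localAlg q W) :
    siteExpect Y A ∈ localAlg q (W \ Y) := by
  refine ⟨fun s s' ⟨i, hi, hne⟩ => ?_, fun σ₀ hσ₀ s s' => ?_⟩
  · rw [siteExpect_apply, Finset.sum_eq_zero fun σ _ => ?_, mul_zero]
    have hne' : permSites (restrictPerm Y σ) s i ≠ permSites (restrictPerm Y σ) s' i := by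
      simpa [permSites_apply] using hne
    by_cases hiY : i ∈ Y
    · rw [sum_signChar_mul_eq_zero hiY hne', zero_mul]
    · rw [hA.1 _ _ ⟨i, fun h => hi (Finset.mem_sdiff.2 ⟨h, hiY⟩), hne'⟩, mul_zero]
  · rw [siteExpect_apply, siteExpect_apply]
    congr 1
    -- Translating the average by `σ₀` absorbs its action on `Y`; what remains, `κ`, is trivial on
    -- `Y` and on `W`, so neither the signs nor `A` notice it.
    conv_rhs => rw [← Equiv.sum_comp (Equiv.mulRight σ₀)]
    refine Finset.sum_congr rfl fun σ _ => ?_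
    set κ : ∀ i, Equiv.Perm (Fin (q i)) := fun i => if i ∈ Y then 1 else σ₀ i with hκ
    have hfac : ∀ u : Config q, permSites (restrictPerm Y σ) (permSites σ₀ u) =
        permSites κ (permSites (restrictPerm Y (Equiv.mulRight σ₀ σ)) u) := by
      intro u
      funext i
      simp only [permSites_apply, restrictPerm, hκ, Equiv.coe_mulRight, Pi.mul_apply]
      split_ifs <;> simp
    have hκY : ∀ i ∈ Y, κ i = 1 := fun i hi => if_pos hi
    have hκW : ∀ i ∈ W, κ i = 1 := fun i hi => by
      simp only [hκ]
      split_ifs with hiY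
      · rfl
      · exact hσ₀ i (Finset.mem_sdiff.2 ⟨hi, hiY⟩)
    rw [hfac, hfac, hA.2 κ hκW]
    simp only [signChar_congr _ fun i hi => permSites_eq_self_of hκY _ hi]

theorem siteExpect_mem_convexHull (Y : Finset Λ) (A : Op q) : siteExpect Y A ∈
    convexHull ℝ {x | ∃ g ∈ unitary (Op q), g ∈ localAlg q Y ∧ x = g * A * star g} := by
  have hcard : (Fintype.card (SignedPerm q) : ℝ) ≠ 0 := by
    exact_mod_cast Fintype.card_ne_zero
  have h := (convex_convexHull ℝ
    {x | ∃ g ∈ unitary (Op q), g ∈ localAlg q Y ∧ x = g * A * star g}).sum_mem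
    (t := (Finset.univ : Finset (SignedPerm q)))
    (w := fun _ => (Fintype.card (SignedPerm q) : ℝ)⁻¹)
    (z := fun g => signedPermOp Y g * A * star (signedPermOp Y g))
    (fun _ _ => by positivity)
    (by rw [Finset.sum_const, Finset.card_univ, nsmul_eq_mul, mul_inv_cancel₀ hcard])
    (fun g _ => subset_convexHull ℝ _
      ⟨_, signedPermOp_mem_unitary Y g, signedPermOp_mem Y g, rfl⟩)
  convert h using 1
  rw [← Finset.smul_sum, ← Complex.coe_smul, siteExpect]
  simp

/-- The local operator algebras of a spin system. -/
noncomputable def spinNet (q : Λ → ℕ) : LocalNet Λ (Op q) where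
  alg := localAlg q
  mono := localAlg_mono
  mem_univ := mem_localAlg_univ
  comm h hA hB := localAlg_comm h hA hB
  expect := siteExpect
  expect_mem := siteExpect_mem
  expect_hull := siteExpect_mem_convexHull

end SpinSystem

/-! ### The geometry of a lattice -/

section Graph

variable {Λ : Type*} {G : SimpleGraph Λ}

/-- The shortest path distance of a connected graph. -/
@[reducible] noncomputable def graphMetric (hG : G.Connected) : PseudoMetricSpace Λ where
  dist i j := (G.dist i j : ℝ)
  dist_self i := by simp
  dist_comm i j := by rw [SimpleGraph.dist_comm]
  dist_triangle i j k := by exact_mod_cast hG.dist_triangle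

theorem dist_le_diam {Z : Finset Λ} {i j : Λ} (hi : i ∈ Z) (hj : j ∈ Z) :
    G.dist i j ≤ diam G Z :=
  ((Finset.le_sup (f := fun j => G.dist i j) hj).trans
    (Finset.le_sup (f := fun i => Z.sup fun j => G.dist i j) hi)).trans (Nat.le_add_left _ _)

theorem diam_le {Z : Finset Λ} {r : ℝ} (hr : 0 ≤ r)
    (h : ∀ i ∈ Z, ∀ j ∈ Z, (G.dist i j : ℝ) ≤ r) : (diam G Z : ℝ) ≤ 1 + r := by
  have h1 : (Z.sup fun i => Z.sup fun j => G.dist i j) ≤ ⌊r⌋₊ :=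
    Finset.sup_le fun i hi => Finset.sup_le fun j hj => Nat.le_floor (h i hi j hj)
  have h2 : ((Z.sup fun i => Z.sup fun j => G.dist i j : ℕ) : ℝ) ≤ r :=
    (Nat.cast_le.2 h1).trans (Nat.floor_le hr)
  rw [diam]
  push_cast
  linarith

theorem setDist_le {X Y : Finset Λ} {i j : Λ} (hi : i ∈ X) (hj : j ∈ Y) :
    setDist G X Y ≤ G.dist i j := Nat.sInf_le ⟨i, hi, j, hj, rfl⟩

variable [Fintype Λ] {C : CoarseGraining G} {D : ℕ} {γ : ℝ}

theorem mem_ball {X : Finset Λ} {r : ℝ} {i : Λ} :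
    i ∈ ball G X r ↔ ∃ j ∈ X, (G.dist j i : ℝ) ≤ r := by simp [ball]

/-- The number of sites of a coarse grained lattice inside a ball. -/
theorem card_net_le (hG : G.Connected) (hC : IsGeometricParameter G C D γ) {ξ : ℝ} (hξ : 1 ≤ ξ)
    (a : Λ) (k : ℕ) {P : Finset Λ} (hP : P ⊆ C.net ξ)
    (h : ∀ m ∈ P, (G.dist a m : ℝ) ≤ (k + 1) * ξ) :
    (P.card : ℝ) ≤ γ * 5 ^ D * (k + 1) ^ D := by
  classical
  have hξ0 : 0 ≤ ξ := by linarith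
  have htri : ∀ i j l : Λ, (G.dist i l : ℝ) ≤ G.dist i j + G.dist j l := fun i j l => by
    exact_mod_cast hG.dist_triangle
  set B := ball G {a} ((k + 2) * ξ) with hB
  have hmemB : ∀ i, i ∈ B ↔ (G.dist a i : ℝ) ≤ (k + 2) * ξ := fun i => by simp [hB, mem_ball]
  -- Exchange argument: the points of `P` cover only sites of the ball `B`, so replacing them by a
  -- cover of `B` still covers everything. Minimality of the net then bounds `P` by the coarse
  -- grained set of `B`.
  have hcover : ball G ((C.net ξ \ P) ∪ C.sub B ξ) ξ = Finset.univ := by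
    refine Finset.eq_univ_iff_forall.2 fun i => ?_
    obtain ⟨m, hm, hmi⟩ := mem_ball.1 ((C.net_covers ξ hξ0).symm ▸ Finset.mem_univ i)
    by_cases hmP : m ∈ P
    · have hi : i ∈ B := by
        rw [hmemB]
        linarith [htri a m i, h m hmP]
      obtain ⟨m', hm', hm'i⟩ := mem_ball.1 (C.sub_covers B ξ hξ0 hi)
      exact mem_ball.2 ⟨m', Finset.mem_union_right _ hm', hm'i⟩
    · exact mem_ball.2 ⟨m, Finset.mem_union_left _ (Finset.mem_sdiff.2 ⟨hm, hmP⟩), hmi⟩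
  have h1 := (C.net_minimal ξ hξ0 _ hcover).trans (Finset.card_union_le _ _)
  rw [Finset.card_sdiff_of_subset hP] at h1
  have h2 := Finset.card_le_card hP
  have h3 : P.card ≤ (C.sub B ξ).card := by omega
  have h4 : (diam G B : ℝ) ≤ 1 + 2 * ((k + 2) * ξ) := by
    refine diam_le (by positivity) fun i hi j hj => ?_
    have e1 := (hmemB i).1 hi
    have e2 := (hmemB j).1 hj
    have e3 := htri i a j
    rw [SimpleGraph.dist_comm] at e1
    linarith
  have h5 : (diam G B : ℝ) / ξ ≤ 5 * (k + 1) := by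
    rw [div_le_iff₀ (by linarith)]
    have hk : (0 : ℝ) ≤ k := Nat.cast_nonneg k
    nlinarith
  have h6 : (1 : ℝ) ≤ 5 * (k + 1) := by
    have hk : (0 : ℝ) ≤ k := Nat.cast_nonneg k
    linarith
  have hγ : 0 ≤ γ := zero_le_one.trans hC.one_le
  calc (P.card : ℝ) ≤ (C.sub B ξ).card := by exact_mod_cast h3
    _ ≤ γ * max 1 (((diam G B : ℝ) / ξ) ^ D) := hC.card_sub_le B ξ (by linarith)
    _ ≤ γ * (5 * (k + 1)) ^ D := by
      gcongr
      exact max_le (one_le_pow₀ h6) (by gcongr)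
    _ = _ := by rw [mul_pow]; ring

theorem sum_range_inv_sq_le (n : ℕ) :
    ∑ k ∈ Finset.range n, (((k : ℝ) + 1) ^ 2)⁻¹ ≤ 2 * (1 - 1 / ((n : ℝ) + 1)) := by
  induction n with
  | zero => simp
  | succ n ih =>
    rw [Finset.sum_range_succ]
    have h : (((n : ℝ) + 1) ^ 2)⁻¹ ≤ 2 * (1 / ((n : ℝ) + 1) - 1 / ((n : ℝ) + 1 + 1)) := by
      rw [div_sub_div _ _ (by positivity) (by positivity), ← mul_div_assoc, inv_eq_one_div,
        div_le_div_iff₀ (by positivity) (by positivity)]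
      have hn : (0 : ℝ) ≤ n := Nat.cast_nonneg n
      nlinarith
    push_cast
    linarith

/-- Grouped by `⌊dist / ξ⌋ = k`, there are of order `(k+1)^D` centers of weight at most
`(k+1)^{-(D+2)}`, leaving the convergent sum of `(k+1)^{-2}`. This is where the exponent `D + 2` of
the nets comes from. -/
theorem sum_net_le (hG : G.Connected) (hC : IsGeometricParameter G C D γ) {ξ : ℝ} (hξ : 1 ≤ ξ)
    (a : Λ) :
    ∑ m ∈ C.net ξ, ((1 + (G.dist a m : ℝ) / ξ) ^ (D + 2))⁻¹ ≤ 2 * γ * 5 ^ D := by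
  classical
  have hξ0 : 0 < ξ := by linarith
  have hγ : 0 ≤ γ := zero_le_one.trans hC.one_le
  set f : Λ → ℕ := fun m => ⌊(G.dist a m : ℝ) / ξ⌋₊ with hf
  set n := (C.net ξ).sup f + 1
  have hmaps : ∀ m ∈ C.net ξ, f m ∈ Finset.range n := fun m hm =>
    Finset.mem_range.2 (Nat.lt_succ_of_le (Finset.le_sup hm))
  rw [← Finset.sum_fiberwise_of_maps_to hmaps]
  calc _ ≤ ∑ k ∈ Finset.range n, γ * 5 ^ D * (((k : ℝ) + 1) ^ 2)⁻¹ := by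
        refine Finset.sum_le_sum fun k _ => ?_
        have hcard := card_net_le hG hC hξ a k (Finset.filter_subset (fun m => f m = k) (C.net ξ))
          (fun m hm => by
            have h1 := Nat.lt_floor_add_one ((G.dist a m : ℝ) / ξ)
            have h2 : ⌊(G.dist a m : ℝ) / ξ⌋₊ = k := (Finset.mem_filter.1 hm).2
            rw [h2, div_lt_iff₀ hξ0] at h1
            exact h1.le)
        calc _ ≤ ∑ m ∈ C.net ξ with f m = k, (((k : ℝ) + 1) ^ (D + 2))⁻¹ := by
              refine Finset.sum_le_sum fun m hm => ?_
              have h2 : ⌊(G.dist a m : ℝ) / ξ⌋₊ = k := (Finset.mem_filter.1 hm).2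
              have h3 := Nat.floor_le (show 0 ≤ (G.dist a m : ℝ) / ξ by positivity)
              rw [h2] at h3
              gcongr ?_⁻¹
              gcongr ?_ ^ _
              linarith
          _ = (((C.net ξ).filter fun m => f m = k).card : ℝ) * (((k : ℝ) + 1) ^ (D + 2))⁻¹ := by
              rw [Finset.sum_const, nsmul_eq_mul]
          _ ≤ γ * 5 ^ D * (k + 1) ^ D * (((k : ℝ) + 1) ^ (D + 2))⁻¹ := by gcongr
          _ = _ := by
              have : (k : ℝ) + 1 ≠ 0 := by positivity
              rw [pow_add]
              field_simp
    _ ≤ γ * 5 ^ D * 2 := by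
        rw [← Finset.mul_sum]
        gcongr
        have : 0 ≤ 1 / ((n : ℝ) + 1) := by positivity
        linarith [sum_range_inv_sq_le n]
    _ = _ := by ring

/-- The lattice geometry of a graph with a geometric parameter. -/
noncomputable def latticeGeometry (hG : G.Connected) (hC : IsGeometricParameter G C D γ) :
    letI := graphMetric hG
    LatticeGeometry Λ D γ (2 * γ * 5 ^ D) :=
  letI := graphMetric hG
  { size := fun Z => (diam G Z : ℝ)
    one_le_size := fun Z => by exact_mod_cast Nat.le_add_right 1 _
    dist_le_size := fun Z i hi j hj => Nat.cast_le.2 (dist_le_diam hi hj)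
    card_le := fun i r hr => by
      convert hC.card_ball_le i r hr using 4
      ext j
      rw [mem_block, mem_ball]
      simp [dist]
    blocks := fun ξ hξ =>
      { net := C.net ξ
        covers := fun i => by
          have := (C.net_covers ξ (by linarith)).symm ▸ Finset.mem_univ i
          exact mem_ball.1 this
        sum_le := sum_net_le hG hC hξ } }

end Graph

/-! ### Rescaling of time and return to the spin system -/

/-- Negative `c` is admitted so that backward evolutions and negative times become forward
evolutions under a Hamiltonian with the opposite sign. -/
theorem PowerLaw.smul_of_abs_le {Λ 𝒜 : Type*} [Fintype Λ] [DecidableEq Λ] [PseudoMetricSpace Λ]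
    [CStarAlgebra 𝒜] {N : LocalNet Λ 𝒜} {size : Finset Λ → ℝ} {D : ℕ} {α τ g c : ℝ}
    {h : Finset Λ → selfAdjoint 𝒜} (hh : PowerLaw N size D α 1 g h) (hc : |c| ≤ τ) :
    PowerLaw N size D α τ g fun Z => c • h Z := by
  have hτ : 0 ≤ τ := (abs_nonneg c).trans hc
  have h1 := hh.smul hτ
  rw [mul_one] at h1
  refine h1.of_norm_le (fun Z => ?_) fun Z => ?_
  · rw [selfAdjoint.val_smul, ← Complex.coe_smul]
    exact Subalgebra.smul_mem _ (hh.mem Z) _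
  · simp only [selfAdjoint.val_smul, norm_smul, Real.norm_eq_abs, abs_of_nonneg hτ]
    gcongr

theorem LocalNet.CommBound.of_cover {Λ 𝒜 : Type*} [Fintype Λ] [DecidableEq Λ] [CStarAlgebra 𝒜]
    {N : LocalNet Λ 𝒜} {u : unitary 𝒜} {I J : Finset Λ} {P : Λ → Finset Λ} {X Y : Finset Λ}
    {c : ℝ} (hc : 0 ≤ c) (hX : X ⊆ I.biUnion P) (hY : Y ⊆ J.biUnion P)
    (h : ∀ m ∈ I, ∀ m' ∈ J, (X ∩ P m).Nonempty → (Y ∩ P m').Nonempty →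
      N.CommBound (unitaryConj u) (X ∩ P m) (Y ∩ P m') c) :
    N.CommBound (unitaryConj u) X Y (4 * I.card * J.card * c) := by
  have hcov : ∀ {I : Finset Λ} {X : Finset Λ}, X ⊆ I.biUnion P →
      X ⊆ (I.filter fun m => (X ∩ P m).Nonempty).biUnion fun m => X ∩ P m := by
    intro I X hX i hi
    obtain ⟨m, hm, him⟩ := Finset.mem_biUnion.1 (hX hi)
    have : i ∈ X ∩ P m := Finset.mem_inter.2 ⟨hi, him⟩
    exact Finset.mem_biUnion.2 ⟨m, Finset.mem_filter.2 ⟨hm, i, this⟩, this⟩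
  have h2 := CommBound.biUnion_left (N := N) (u := u) (Y := Y)
    (c := fun _ => 2 * ∑ _m' ∈ J.filter fun m' => (Y ∩ P m').Nonempty, c)
    (fun _ _ => mul_nonneg zero_le_two (Finset.sum_nonneg fun _ _ => hc))
    (fun m hm => CommBound.biUnion_right (fun _ _ => hc)
      (fun m' hm' => h m (Finset.mem_filter.1 hm).1 m' (Finset.mem_filter.1 hm').1
        (Finset.mem_filter.1 hm).2 (Finset.mem_filter.1 hm').2) (hcov hY)) (hcov hX)
  refine h2.weaken subset_rfl subset_rfl ?_
  simp only [Finset.sum_const, nsmul_eq_mul]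
  have e1 : ((I.filter fun m => (X ∩ P m).Nonempty).card : ℝ) ≤ I.card := by
    exact_mod_cast Finset.card_filter_le _ _
  have e2 : ((J.filter fun m => (Y ∩ P m).Nonempty).card : ℝ) ≤ J.card := by
    exact_mod_cast Finset.card_filter_le _ _
  calc _ = 4 * ((I.filter fun m => (X ∩ P m).Nonempty).card : ℝ) *
        ((J.filter fun m => (Y ∩ P m).Nonempty).card : ℝ) * c := by ring
    _ ≤ _ := by gcongr

section SpinSystem

variable {Λ : Type*} [Fintype Λ] [DecidableEq Λ] {q : Λ → ℕ}

/-- The interaction picture propagator in terms of the two evolutions. -/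
theorem IsTimeOrderedExp.eq_flow_mul_flow {A H : selfAdjoint (Op q)} {B : Op q}
    (hB : (A : Op q) + B = H) {U : ℝ → Op q}
    (hU : IsTimeOrderedExp (fun τ => evolve (A : Op q) B τ) U) (t : ℝ) :
    U t = (flow A t * flow H (-t) : unitary (Op q)) := by
  have hV : IsTimeOrderedExp (fun τ => evolve (A : Op q) B τ)
      fun s => ((flow A s * flow H (-s) : unitary (Op q)) : Op q) := by
    refine ⟨by simp [flow_zero], fun s => ?_⟩
    have h1 := (hasDerivAt_flow A s).mul (hasDerivAt_flow' (-H) s)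
    simp only [flow_neg_left] at h1
    refine h1.congr_deriv ?_
    have e1 : NormedSpace.exp ((Complex.I * s) • (A : Op q)) = (flow A s : Op q) :=
      (coe_flow A s).symm
    have e2 : NormedSpace.exp ((-(Complex.I * s)) • (A : Op q)) = (flow A (-s) : Op q) := by
      rw [coe_flow]
      push_cast
      rw [mul_neg]
    have e3 : (flow A (-s) : Op q) * flow A s = 1 := by
      rw [← Submonoid.coe_mul, ← flow_add, neg_add_cancel, flow_zero, Submonoid.coe_one]
    have e4 : B = H - A := by rw [← hB]; abel
    simp only [evolve, Submonoid.coe_mul]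
    rw [e1, e2]
    generalize (flow A s : Op q) = P at *
    generalize (flow A (-s) : Op q) = P' at *
    generalize (flow H (-s) : Op q) = Q at *
    have e5 : P * B * P' * (P * Q) = P * B * Q := by
      rw [show P * B * P' * (P * Q) = P * B * (P' * P) * Q by noncomm_ring, e3, mul_one]
    rw [e5, e4]
    simp only [mul_smul_comm, smul_mul_assoc, mul_sub, sub_mul, smul_sub, neg_smul,
      NegMemClass.coe_neg, neg_mul, mul_neg, smul_neg, ← mul_assoc]
    abel
  exact congrFun ((existsUnique_isTimeOrderedExp (A : Op q) B).unique hU hV) t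

variable {G : SimpleGraph Λ} {D : ℕ} {α g₀ : ℝ} {h : Finset Λ → Op q}

/-- The interaction terms as self-adjoint elements. -/
def IsPowerLawInteraction.terms (hh : IsPowerLawInteraction G D α g₀ h) (Z : Finset Λ) :
    selfAdjoint (Op q) := ⟨h Z, hh.isHermitian Z⟩

theorem IsPowerLawInteraction.powerLaw (hG : G.Connected)
    (hh : IsPowerLawInteraction G D α g₀ h) :
    letI := graphMetric hG
    PowerLaw (spinNet q) (fun Z => (diam G Z : ℝ)) D α 1 g₀ hh.terms :=
  letI := graphMetric hG
  { mem := fun Z => (hh.supported Z).mem_localAlg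
    tail_le := fun i r hr => by
      rw [one_mul]
      convert hh.tail_le i r hr
      rfl
    pair_le := fun i j => by
      rw [one_mul]
      convert hh.pair_le i j <;> rfl }

theorem IsPowerLawInteraction.coe_ham_truncLE (hh : IsPowerLawInteraction G D α g₀ h) (ℓ : ℝ) :
    (ham (truncLE (fun Z => (diam G Z : ℝ)) hh.terms ℓ) : Op q) = hamLE G h ℓ := by
  rw [coe_ham, hamLE, Finset.sum_filter]
  refine Finset.sum_congr rfl fun Z _ => ?_
  rw [truncLE]
  split_ifs <;> rfl

theorem IsPowerLawInteraction.hamLE_add_hamGT (hh : IsPowerLawInteraction G D α g₀ h) (ℓ : ℝ) :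
    hamLE G h ℓ + hamGT G h ℓ = ham hh.terms := by
  rw [coe_ham, hamLE, hamGT]
  simp only [← not_le]
  exact Finset.sum_filter_add_sum_filter_not _ _ _

end SpinSystem

/-- Since the exponent exceeds 1/2, a factor four in time gives at least a factor two in length.
Rescaling time by `τ ≤ 1/4` therefore brings `ℓ_t` below the truncation `T ^ η̃ / 2` at the rescaled
time. -/
theorem rpow_le_half_rpow {D : ℕ} {α a b : ℝ} (hα : 2 * (D : ℝ) + 1 < α) (ha : 0 ≤ a)
    (hab : a ≤ 1 / 4 * b) : a ^ etaTilde D α ≤ b ^ etaTilde D α / 2 := by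
  have hη := half_lt_etaTilde hα
  have hb : 0 ≤ b := by linarith
  have h1 : (1 / 4 : ℝ) ^ etaTilde D α ≤ 1 / 2 := by
    calc (1 / 4 : ℝ) ^ etaTilde D α ≤ (1 / 4 : ℝ) ^ (1 / 2 : ℝ) :=
          Real.rpow_le_rpow_of_exponent_ge (by norm_num) (by norm_num) hη.le
      _ = 1 / 2 := by
          rw [show (1 / 4 : ℝ) = (1 / 2) ^ (2 : ℝ) by norm_num, ← Real.rpow_mul (by norm_num)]
          norm_num
  calc a ^ etaTilde D α ≤ (1 / 4 * b) ^ etaTilde D α := by gcongr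
    _ = (1 / 4 : ℝ) ^ etaTilde D α * b ^ etaTilde D α := Real.mul_rpow (by norm_num) hb
    _ ≤ 1 / 2 * b ^ etaTilde D α := by gcongr
    _ = _ := by ring

theorem exists_two_pow_near {x : ℝ} (hx : 1 ≤ x) : ∃ n : ℕ, x ≤ 2 ^ n ∧ (2 : ℝ) ^ n ≤ 2 * x := by
  obtain ⟨n, h1, h2⟩ := exists_nat_pow_near hx one_lt_two
  exact ⟨n + 1, h2.le, by rw [pow_succ']; gcongr⟩

/-- The power-law light cone of the long-range part of the dynamics. -/
theorem exists_commutatorBound_propagator {D : ℕ} (hD : 1 ≤ D) {α g₀ γ v : ℝ}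
    (hα : 2 * (D : ℝ) + 1 < α) (hg₀ : 0 ≤ g₀) (hv : 0 < v) (hγ : 0 ≤ γ) :
    ∃ J₀ κ₀ : ℝ, 0 < J₀ ∧ 0 < κ₀ ∧ 2 ≤ κ₀ * v ∧
      ∀ (Λ : Type u) [Fintype Λ] [DecidableEq Λ] (G : SimpleGraph Λ) (C : CoarseGraining G)
        (q : Λ → ℕ) (h : Finset Λ → Op q),
        G.Connected → IsGeometricParameter G C D γ → IsPowerLawInteraction G D α g₀ h →
        ∀ t : ℝ, 1 ≤ |t| →
        ∀ U : ℝ → Op q, IsLongRangePropagator G h (truncLength D α t) U →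
        ∀ X Y : Finset Λ, κ₀ * v * |t| < (setDist G X Y : ℝ) →
          CommutatorBound (U t) X Y
            (J₀ * (C.sub X (v * |t|)).card * (C.sub Y (v * |t|)).card *
              (|t| ^ (2 * D + 1) / ((setDist G X Y : ℝ) - κ₀ * v * |t|) ^ α)) := by
  have hD1 : (1 : ℝ) ≤ D := by exact_mod_cast hD
  have hα0 : 0 ≤ α := by linarith
  obtain ⟨c, τ, J, ρ₀, hvc, hc, hτ, hτ4, hJ, hρ₀, key⟩ := LocalNet.exists_commBound_flow_mul_flow v
    hα (by linarith) hγ (K := 2 * γ * 5 ^ D) (by positivity) hg₀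
  -- The time `2^n` is at most `2|t|/τ`, which gives the powers of `2 / τ`. The `+ 1` makes `J₀`
  -- positive, and the `+ 2` secures `2 ≤ κ₀ v`, hence distances above 2.
  refine ⟨4 * J * (2 / τ) ^ (2 * D + 1) + 1, (ρ₀ * c * (2 / τ) + 2) / v, by positivity,
    by positivity, ?_, ?_⟩
  · rw [div_mul_cancel₀ _ hv.ne']
    linarith [show 0 ≤ ρ₀ * c * (2 / τ) by positivity]
  intro Λ _ _ G C q h hG hC hh t ht U hU X Y hXY
  rw [div_mul_cancel₀ _ hv.ne'] at hXY ⊢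
  let := graphMetric hG
  set x : ℝ := (setDist G X Y : ℝ) with hx
  set w := (ρ₀ * c * (2 / τ) + 2) * |t| with hw
  have ht0 : 0 < |t| := by linarith
  have hw0 : 0 ≤ w := by positivity
  set s := |t| / τ with hs
  have hs0 : 0 < s := by positivity
  have hs1 : 1 ≤ s := by
    rw [hs, le_div_iff₀ hτ]
    linarith
  obtain ⟨n, hn1, hn2⟩ := exists_two_pow_near hs1
  have hn3 : (2 : ℝ) ^ n ≤ 2 / τ * |t| := hn2.trans_eq (by rw [hs]; ring)
  have htn : |t| ≤ 1 / 4 * 2 ^ n := by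
    have : |t| = τ * s := by rw [hs]; field_simp
    rw [this]
    gcongr
  -- The rescaled coupling: `|ε| = τ`, and the sign of `t` sits in `ε`, so the flow time `s` is
  -- positive.
  set ε := t / s with hε
  have hsε : s * ε = t := mul_div_cancel₀ t hs0.ne'
  have hετ : |ε| = τ := by
    rw [hε, abs_div, abs_of_pos hs0, hs]
    field_simp
  set size : Finset Λ → ℝ := fun Z => (diam G Z : ℝ)
  set ℓ := truncLength D α t with hℓ
  have hP := hh.powerLaw hG
  have h₁ := hP.smul_of_abs_le hετ.le
  have h₂ := (hP.truncLE ℓ).smul_of_abs_le (c := -ε) (by rw [abs_neg, hετ])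
  set u : unitary (Op q) := flow (ham hh.terms) t * flow (ham (truncLE size hh.terms ℓ)) (-t)
    with hu
  have hflow : flow (ham fun Z => ε • hh.terms Z) s *
      flow (ham fun Z => -ε • truncLE size hh.terms ℓ Z) s = u := by
    rw [ham_smul, ham_smul, flow_smul_left, flow_smul_left, mul_neg, hsε]
  have hsmall : ∀ Z, -ε • truncLE size hh.terms ℓ Z ≠ 0 →
      (latticeGeometry hG hC).size Z ≤ ((2 : ℝ) ^ n) ^ etaTilde D α / 2 := by
    intro Z hZ
    refine le_trans ?_ (rpow_le_half_rpow hα ht0.le htn)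
    by_contra hlt
    refine hZ ?_
    rw [truncLE, if_neg (show ¬size Z ≤ ℓ from hlt), smul_zero]
  set b := J * (2 ^ n) ^ (2 * D + 1) * x ^ (-α) with hb
  have hb0 : 0 ≤ b := by positivity
  have hcover : ∀ Z : Finset Λ,
      Z ⊆ (C.sub Z (v * |t|)).biUnion fun m => block m (c * 2 ^ n) := by
    intro Z i hi
    obtain ⟨m, hm, hmi⟩ := mem_ball.1 (C.sub_covers Z (v * |t|) (by positivity) hi)
    refine Finset.mem_biUnion.2 ⟨m, hm, mem_block.2 (hmi.trans ?_)⟩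
    have : |t| ≤ 2 ^ n := by linarith
    gcongr
  have hcomm : (spinNet q).CommBound (unitaryConj u) X Y
      (4 * (C.sub X (v * |t|)).card * (C.sub Y (v * |t|)).card * b) := by
    refine LocalNet.CommBound.of_cover hb0 (hcover X) (hcover Y) ?_
    intro m _ m' _ hX hY
    rw [← hflow]
    refine key (latticeGeometry hG hC) h₁ h₂ n hsmall s ⟨hs0.le, hn1⟩ x m m' _ _ hX hY
      Finset.inter_subset_right Finset.inter_subset_right (fun i hi j hj => ?_) ?_
    · exact Nat.cast_le.2 (setDist_le (Finset.mem_inter.1 hi).1 (Finset.mem_inter.1 hj).1)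
    · calc ρ₀ * (c * 2 ^ n) ≤ ρ₀ * (c * (2 / τ * |t|)) := by gcongr
        _ = w - 2 * |t| := by rw [hw]; ring
        _ ≤ x := by linarith
  intro O_X O_Y hOX hOY
  -- Taking the adjoint reverses the order of the factors, so conjugation by `U†` applies the
  -- truncated evolution first and the full one second, as composition requires.
  have hUt : U t = (star u : unitary (Op q)) := by
    have h1 : (ham (truncLE size hh.terms ℓ) : Op q) + hamGT G h ℓ = ham hh.terms := by
      rw [hh.coe_ham_truncLE, hh.hamLE_add_hamGT]
    have h2 : IsTimeOrderedExp
        (fun τ => evolve (ham (truncLE size hh.terms ℓ) : Op q) (hamGT G h ℓ) τ) U := by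
      rw [hh.coe_ham_truncLE]
      exact hU
    rw [h2.eq_flow_mul_flow h1 t, hu, star_mul, star_flow, star_flow, neg_neg]
  have hconj : (U t)ᴴ * O_X * U t = unitaryConj u O_X := by
    rw [hUt, unitaryConj, Unitary.coe_star, ← Matrix.star_eq_conjTranspose, star_star]
  rw [hconj]
  refine (hcomm O_X hOX.mem_localAlg O_Y hOY.mem_localAlg).trans ?_
  refine mul_le_mul_of_nonneg_right ?_ (by positivity)
  have hxw : 0 < x - w := by linarith
  have e1 : x ^ (-α) ≤ ((x - w) ^ α)⁻¹ := by
    rw [← Real.rpow_neg hxw.le]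
    exact Real.rpow_le_rpow_of_nonpos hxw (by linarith) (by linarith)
  have e2 : ((2 : ℝ) ^ n) ^ (2 * D + 1) ≤ (2 / τ) ^ (2 * D + 1) * |t| ^ (2 * D + 1) := by
    rw [← mul_pow]
    gcongr
  have e3 : 0 ≤ ((x - w) ^ α)⁻¹ := by positivity
  calc 4 * ((C.sub X (v * |t|)).card : ℝ) * (C.sub Y (v * |t|)).card * b
      ≤ 4 * (C.sub X (v * |t|)).card * (C.sub Y (v * |t|)).card *
        (J * ((2 / τ) ^ (2 * D + 1) * |t| ^ (2 * D + 1)) * ((x - w) ^ α)⁻¹) := by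
        rw [hb]
        gcongr
    _ = (4 * J * (2 / τ) ^ (2 * D + 1)) * (C.sub X (v * |t|)).card * (C.sub Y (v * |t|)).card *
        (|t| ^ (2 * D + 1) / (x - w) ^ α) := by
        rw [div_eq_mul_inv]
        ring
    _ ≤ _ := by
        gcongr
        linarith

end LongRange

theorem theorem3 (D : ℕ) (hD : 1 ≤ D) (α g₀ γ v : ℝ) (hα : 2 * (D : ℝ) + 1 < α) (hg₀ : 0 < g₀)
    (hv : 0 < v) :
    (∃ J₀ κ₀ : ℝ, 0 < J₀ ∧ 0 < κ₀ ∧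
      ∀ (Λ : Type u) [Fintype Λ] [DecidableEq Λ] (G : SimpleGraph Λ) (C : CoarseGraining G)
        (q : Λ → ℕ) (h : Finset Λ → Op q),
        G.Connected → IsGeometricParameter G C D γ → IsPowerLawInteraction G D α g₀ h →
        ∀ t : ℝ, 1 ≤ |t| →
        ∀ U : ℝ → Op q, IsLongRangePropagator G h (truncLength D α t) U →
        ∀ X Y : Finset Λ, κ₀ * v * |t| < (setDist G X Y : ℝ) →
          CommutatorBound (U t) X Y
            (J₀ * (C.sub X (v * |t|)).card * (C.sub Y (v * |t|)).card *
              (|t| ^ (2 * D + 1) * Real.log ((setDist G X Y : ℝ) + 1) ^ (2 * D) /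
                ((setDist G X Y : ℝ) - κ₀ * v * |t|) ^ α))) ∧
    (∀ k : ℕ, ∃ J₀ κ₀ : ℝ, 0 < J₀ ∧ 0 < κ₀ ∧
      ∀ (Λ : Type u) [Fintype Λ] [DecidableEq Λ] (G : SimpleGraph Λ) (C : CoarseGraining G)
        (q : Λ → ℕ) (h : Finset Λ → Op q),
        G.Connected → IsGeometricParameter G C D γ → IsPowerLawInteraction G D α g₀ h →
        (∀ Z : Finset Λ, k < Z.card → h Z = 0) →
        ∀ t : ℝ, 1 ≤ |t| →
        ∀ U : ℝ → Op q, IsLongRangePropagator G h (truncLength D α t) U →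
        ∀ X Y : Finset Λ, κ₀ * v * |t| < (setDist G X Y : ℝ) →
          CommutatorBound (U t) X Y
            (J₀ * (C.sub X (v * |t|)).card * (C.sub Y (v * |t|)).card *
              (|t| ^ (2 * D + 1) /
                ((setDist G X Y : ℝ) - κ₀ * v * |t|) ^ α))) := by
  -- For `γ < 1` there is no admissible lattice and any constants do.
  by_cases hγ : 1 ≤ γ
  swap
  · refine ⟨⟨1, 1, one_pos, one_pos, ?_⟩, fun _ => ⟨1, 1, one_pos, one_pos, ?_⟩⟩
    · intro Λ _ _ G C q h _ hC
      exact absurd hC.one_le hγ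
    · intro Λ _ _ G C q h _ hC
      exact absurd hC.one_le hγ
  obtain ⟨J₀, κ₀, hJ₀, hκ₀, hκv, key⟩ := exists_commutatorBound_propagator.{u} hD hα hg₀.le hv
    (zero_le_one.trans hγ)
  refine ⟨⟨J₀, κ₀, hJ₀, hκ₀, ?_⟩, fun _ => ⟨J₀, κ₀, hJ₀, hκ₀, ?_⟩⟩
  · intro Λ _ _ G C q h hG hC hh t ht U hU X Y hXY O_X O_Y hX hY
    refine (key Λ G C q h hG hC hh t ht U hU X Y hXY O_X O_Y hX hY).trans ?_
    -- From `κ₀ v ≥ 2` and `|t| ≥ 1` the distance is at least 2, and `log 3 ≥ 1` since `e < 3`; the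
    -- logarithmic factor only weakens the bound.
    have hx : 2 ≤ (setDist G X Y : ℝ) := by nlinarith
    have hlog : 1 ≤ Real.log ((setDist G X Y : ℝ) + 1) := by
      rw [Real.le_log_iff_exp_le (by linarith)]
      linarith [Real.exp_one_lt_d9]
    have hpos : 0 ≤ ((setDist G X Y : ℝ) - κ₀ * v * |t|) ^ α :=
      Real.rpow_nonneg (by linarith) α
    gcongr
    exact le_mul_of_one_le_right (by positivity) (one_le_pow₀ hlog)
  · intro Λ _ _ G C q h hG hC hh _ t ht U hU X Y hXY
    exact key Λ G C q h hG hC hh t ht U hU X Y hXY
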